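/- **Setting.** Let $\Omega$ be either an open connected subset of $\mathbb{R}^d$ with smooth boundary, or a $d$-dimensional flat torus. Let $U_0,U_1\in C^\infty(\Omega,\mathbb{R})$ satisfy $\int_\Omega e^{-U_0}=1$, $\mathcal{Z}_1:=\int_\Omega e^{-U_1}<\infty$ and $\mathrm{Var}^{(\max)}:=\int_\Omega e^{-2(U_1-U_0)}e^{-U_0}\,dx-\mathcal{Z}_1^2\in(0,\infty)$. Let $\mathfrak{B}$ be the space of vector fields $b\in C^\infty(\overline\Omega,\mathbb{R}^d)$ that are tangent to $\partial\Omega$ and satisfy $\sup_\Omega|\nabla b|<\infty$. For $b\in\mathfrak{B}$ let $X_t$ be the flow of $\dot x=b(x)$ on $\Omega$, $J_t(x)=|\det\nabla_xX_t(x)|$, and $F^{(k)}_t(x)=e^{-U_k(X_t(x))}J_t(x)$ for $k=0,1$. Let $\mho(b)$ be the set of points of $\Omega$ having a neighbourhood on which $z\mapsto\int_0^\infty F^{(k)}_t(z)\,dt$ and $z\mapsto\int_{-\infty}^0F^{(k)}_t(z)\,dt$, $k=0,1$, are finite and continuous, and let $\mathfrak{B}_\infty$ (the infinite-time class) be the set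 of all $b\in\mathfrak{B}$ for which $\Omega\setminus\mho(b)$ is Lebesgue-null. For $b\in\mathfrak{B}_\infty$ put $$\mathcal{A}_b(x)=\frac{\int_{\mathbb{R}}F^{(1)}_t(x)\,dt}{\int_{\mathbb{R}}F^{(0)}_t(x)\,dt},\qquad \mathrm{Var}(b)=\int_\Omega|\mathcal{A}_b(x)|^2e^{-U_0(x)}\,dx-\mathcal{Z}_1^2 .$$ A field $w\in C_c^\infty(\Omega,\mathbb{R}^d)$ is *admissible at $b$* if $b+\epsilon w\in\mathfrak{B}_\infty$ for all sufficiently small $|\epsilon|$. The *functional derivative* $\delta\mathrm{Var}(b)/\delta b$ is a field $g:\Omega\to\mathbb{R}^d$ such that $\frac{d}{d\epsilon}\mathrm{Var}(b+\epsilon w)\big|_{\epsilon=0}=\int_\Omega\langle g,w\rangle\,dx$ for every $w$ admissible at $b$. A nonempty open bounded set $D\subset\mho(b)$ is *$b$-stable* if (1) there are $x_0\in D$ and $\zeta\in(0,1)$ with $|b(x_0)|>0$ and $|b(x)-b(x_0)|<\zeta|b(x_0)|$ for all $x\in D$, and (2) for every $x\in D$ the trajectory $\{X_t(x)\}_{t\in\mathbb{R}}$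 meets $\partial D$ in exactly two points. A point $x\in\mho(b)$ is *$b$-stable* if some ball $\{y\in\Omega:|y-x|<r\}$, $r>0$, is $b$-stable, and *$b$-unstable* otherwise. **Proposition.** Let $b\in\mathfrak{B}_\infty$ and assume: 1. (Nontrivial local minimum) $\mathrm{Var}(b)<\mathrm{Var}^{(\max)}$, and for every $w$ admissible at $b$ one has $\mathrm{Var}(b+\epsilon w)\ge\mathrm{Var}(b)$ for all sufficiently small $|\epsilon|$. 2. (Stationarity) $\delta\mathrm{Var}(b)/\delta b$ exists, is continuous and vanishes on $\Omega$, and $\nabla\mathcal{A}_b$ exists and is continuous on $\Omega$. 3. $\mho(b)=\Omega$, the set of $b$-unstable points is Lebesgue-null, and $\{x\in\Omega:\nabla(U_1-U_0)(x)=0\}$ is Lebesgue-null. Then $\mathrm{Var}(b)=0$, and $b$ is a global minimum of the variance: $\mathrm{Var}(b)\le\mathrm{Var}(b')$ for every $b'\in\mathfrak{B}_\infty$. -/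

import Mathlib

open Set Filter Topology MeasureTheory
open scoped ContDiff

noncomputable section

namespace NEIS

/-- Euclidean space of dimension `d`, with the Euclidean norm. -/
abbrev E (d : ℕ) := EuclideanSpace ℝ (Fin d)

/-! ### Domains -/

/-- `φ` is a smooth local defining function of the open set `Ω` at `p`:
near `p`, the set `Ω` is `{φ < 0}`, with `φ p = 0` and nonzero differential at `p`. -/
def IsLocalDefiningFunction {d : ℕ} (Ω : Set (E d)) (p : E d) (φ : E d → ℝ) : Prop :=
  ContDiff ℝ ∞ φ ∧ φ p = 0 ∧ gradient φ p ≠ 0 ∧ ∀ᶠ y in 𝓝 p, (y ∈ Ω ↔ φ y < 0)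

/-- The boundary of `Ω` is smooth (with `Ω` locally on one side of it). -/
def HasSmoothBoundary {d : ℕ} (Ω : Set (E d)) : Prop :=
  ∀ p ∈ frontier Ω, ∃ φ : E d → ℝ, IsLocalDefiningFunction Ω p φ

/-- `n` is the outward unit normal of `Ω` at the boundary point `p`. -/
def IsOutwardNormal {d : ℕ} (Ω : Set (E d)) (p n : E d) : Prop :=
  ∃ φ : E d → ℝ, IsLocalDefiningFunction Ω p φ ∧ n = ‖gradient φ p‖⁻¹ • gradient φ p

/-- A domain is either an open connected subset of `ℝ^d` with smooth boundary, or the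
`d`-dimensional torus `ℝ^d / Λ`, where `Λ` is the lattice spanned by a basis `β` of `ℝ^d`
(the torus `[0,1]^d` is the case of the standard basis). -/
inductive Domain (d : ℕ) where
  | euclidean (Ω : Set (E d)) (isOpen : IsOpen Ω) (isConnected : IsConnected Ω)
      (smooth : HasSmoothBoundary Ω) : Domain d
  | torus (β : Module.Basis (Fin d) ℝ (E d)) : Domain d

namespace Domain

variable {d : ℕ}

/-- The points of the domain, as a subset of `ℝ^d`. Points of a torus are represented by all
their lifts to `ℝ^d`, and functions on a torus by the periodic functions on `ℝ^d`. -/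
def pts : Domain d → Set (E d)
  | euclidean Ω _ _ _ => Ω
  | torus _ => univ

/-- The group of periods: trivial for a subset of `ℝ^d`, the lattice `Λ` for a torus `ℝ^d / Λ`. -/
def periods : Domain d → Submodule ℤ (E d)
  | euclidean _ _ _ _ => ⊥
  | torus β => Submodule.span ℤ (range β)

/-- A measurable set of points that represents every point of the domain exactly once;
integration over the domain is integration over this set. -/
def cell : Domain d → Set (E d)
  | euclidean Ω _ _ _ => Ω
  | torus β => ZSpan.fundamentalDomain β

/-- `f` is a function on the domain: periodic in the case of a torus, no condition otherwise. -/
def IsPeriodic (𝒟 : Domain d) {α : Type*} (f : E d → α) : Prop :=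
  ∀ v ∈ 𝒟.periods, ∀ x, f (x + v) = f x

/-- The ball `B_r(x)` in the domain. -/
def ball (𝒟 : Domain d) (x : E d) (r : ℝ) : Set (E d) :=
  {y ∈ 𝒟.pts | ∃ v ∈ 𝒟.periods, dist y (x + v) < r}

/-- `C_c^∞(Ω, ℝ^d)`: smooth vector fields with compact support in the domain, extended by zero. -/
def testFields (𝒟 : Domain d) : Set (E d → E d) :=
  {w | ContDiff ℝ ∞ w ∧ 𝒟.IsPeriodic w ∧
    ∃ K : Set (E d), IsCompact K ∧ K ⊆ 𝒟.pts ∧ ∀ x, w x ≠ 0 → ∃ v ∈ 𝒟.periods, x + v ∈ K}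

end Domain

/-! ### Velocity fields and flows -/

variable {d : ℕ}

/-- The space `𝔅` of velocity fields `b ∈ C^∞(closure Ω, ℝ^d)` that are tangent to the boundary
and have a bounded gradient. -/
def velocityFields (𝒟 : Domain d) : Set (E d → E d) :=
  {b | ContDiffOn ℝ ∞ b (closure 𝒟.pts) ∧ 𝒟.IsPeriodic b ∧
    (∀ p ∈ frontier 𝒟.pts, ∀ n, IsOutwardNormal 𝒟.pts p n → inner ℝ (b p) n = 0) ∧
    ∃ C : ℝ, ∀ x ∈ 𝒟.pts, ‖fderiv ℝ b x‖ ≤ C}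

/-- `γ` is the solution, for all times, of `γ' = b(γ)` in the domain with `γ(0) = x`. -/
def IsTrajectory (𝒟 : Domain d) (b : E d → E d) (x : E d) (γ : ℝ → E d) : Prop :=
  γ 0 = x ∧ ∀ t, γ t ∈ 𝒟.pts ∧ HasDerivAt γ (b (γ t)) t

open Classical in
/-- The flow map `X_t(x)` of `b`. For `b ∈ velocityFields 𝒟` and `x` in the domain, there is exactly
one trajectory from `x`; the default value `x` is used only in other cases. -/
def flow (𝒟 : Domain d) (b : E d → E d) (t : ℝ) (x : E d) : E d :=
  if h : ∃ γ : ℝ → E d, IsTrajectory 𝒟 b x γ then h.choose t else x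

/-- The Jacobian `J_t(x) = |det ∇_x X_t(x)|`. -/
def jac (𝒟 : Domain d) (b : E d → E d) (t : ℝ) (x : E d) : ℝ :=
  |(fderiv ℝ (fun y => flow 𝒟 b t y) x).det|

/-- `F^{(k)}_t(x) = exp(-U_k(X_t(x))) J_t(x)`. -/
def F (𝒟 : Domain d) (U : Fin 2 → E d → ℝ) (b : E d → E d) (k : Fin 2) (t : ℝ) (x : E d) : ℝ :=
  Real.exp (-U k (flow 𝒟 b t x)) * jac 𝒟 b t x

/-- The set `℧(b)` of the points near which, for `k = 0, 1`, the integrals of `F^{(k)}_t(z)` over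
`t ∈ (0, ∞)` and over `t ∈ (-∞, 0)` are finite and depend continuously on `z`. -/
def mho (𝒟 : Domain d) (U : Fin 2 → E d → ℝ) (b : E d → E d) : Set (E d) :=
  {x ∈ 𝒟.pts | ∃ V ∈ 𝓝 x, V ⊆ 𝒟.pts ∧ ∀ k : Fin 2,
    (∀ z ∈ V, IntegrableOn (fun t => F 𝒟 U b k t z) (Ioi 0)) ∧
    (∀ z ∈ V, IntegrableOn (fun t => F 𝒟 U b k t z) (Iio 0)) ∧
    ContinuousOn (fun z => ∫ t in Ioi 0, F 𝒟 U b k t z) V ∧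
    ContinuousOn (fun z => ∫ t in Iio 0, F 𝒟 U b k t z) V}

/-- The infinite-time class `𝔅_∞` of velocity fields for which `℧(b)` has full measure. -/
def infiniteTimeFields (𝒟 : Domain d) (U : Fin 2 → E d → ℝ) : Set (E d → E d) :=
  {b ∈ velocityFields 𝒟 | volume (𝒟.pts \ mho 𝒟 U b) = 0}

/-! ### The estimator and its variance -/

/-- The partition function `𝒵_k = ∫_Ω exp(-U_k)`. -/
def partitionZ (𝒟 : Domain d) (U : Fin 2 → E d → ℝ) (k : Fin 2) : ℝ :=
  ∫ x in 𝒟.cell, Real.exp (-U k x)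

/-- The infinite-time estimator `𝒜(x) = ∫_ℝ F^{(1)}_t(x) dt / ∫_ℝ F^{(0)}_t(x) dt`. -/
def estimator (𝒟 : Domain d) (U : Fin 2 → E d → ℝ) (b : E d → E d) (x : E d) : ℝ :=
  (∫ t, F 𝒟 U b 1 t x) / (∫ t, F 𝒟 U b 0 t x)

/-- The second moment `ℳ(b) = 𝔼_0[|𝒜|²]`, where `ρ_0 = exp(-U_0)`. -/
def secondMoment (𝒟 : Domain d) (U : Fin 2 → E d → ℝ) (b : E d → E d) : ℝ :=
  ∫ x in 𝒟.cell, |estimator 𝒟 U b x| ^ 2 * Real.exp (-U 0 x)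

/-- The variance `Var(b) = ℳ(b) - 𝒵_1²`. -/
def Var (𝒟 : Domain d) (U : Fin 2 → E d → ℝ) (b : E d → E d) : ℝ :=
  secondMoment 𝒟 U b - partitionZ 𝒟 U 1 ^ 2

/-- The variance `𝔼_0[exp(-2(U_1 - U_0))] - 𝒵_1²` of vanilla importance sampling. -/
def VarMax (𝒟 : Domain d) (U : Fin 2 → E d → ℝ) : ℝ :=
  (∫ x in 𝒟.cell, Real.exp (-2 * (U 1 x - U 0 x)) * Real.exp (-U 0 x)) - partitionZ 𝒟 U 1 ^ 2

/-- The standing assumptions on the potentials: `U_0`, `U_1` are smooth functions on the domain,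
`𝒵_0 = 1`, `𝒵_1 < ∞` and `VarMax ∈ (0, ∞)`. -/
structure IsPotentialPair (𝒟 : Domain d) (U : Fin 2 → E d → ℝ) : Prop where
  smooth : ∀ k, ContDiffOn ℝ ∞ (U k) 𝒟.pts
  periodic : ∀ k, 𝒟.IsPeriodic (U k)
  integrable_zero : IntegrableOn (fun x => Real.exp (-U 0 x)) 𝒟.cell
  partition_zero : partitionZ 𝒟 U 0 = 1
  integrable_one : IntegrableOn (fun x => Real.exp (-U 1 x)) 𝒟.cell
  integrable_varMax :
    IntegrableOn (fun x => Real.exp (-2 * (U 1 x - U 0 x)) * Real.exp (-U 0 x)) 𝒟.cell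
  varMax_pos : 0 < VarMax 𝒟 U

/-! ### Stability, local minima, functional derivative -/

/-- A nonempty open bounded set `D ⊆ ℧(b)` is `b`-stable if `b` is nearly constant and nonzero
on `D` and if every trajectory through `D` meets the boundary of `D` in exactly two points
(points of a torus being counted modulo its periods). -/
def IsStableRegion (𝒟 : Domain d) (U : Fin 2 → E d → ℝ) (b : E d → E d) (D : Set (E d)) : Prop :=
  D.Nonempty ∧ IsOpen D ∧
  (∃ K : Set (E d), Bornology.IsBounded K ∧ ∀ x ∈ D, ∃ v ∈ 𝒟.periods, x + v ∈ K) ∧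
  D ⊆ mho 𝒟 U b ∧
  (∃ x₀ ∈ D, ∃ ζ ∈ Ioo (0 : ℝ) 1, 0 < ‖b x₀‖ ∧ ∀ x ∈ D, ‖b x - b x₀‖ < ζ * ‖b x₀‖) ∧
  ∀ x ∈ D, (𝒟.periods.mkQ '' (range (fun t : ℝ => flow 𝒟 b t x) ∩ frontier D)).encard = 2

/-- The point `x` is `b`-stable if some ball around it is. -/
def IsStablePoint (𝒟 : Domain d) (U : Fin 2 → E d → ℝ) (b : E d → E d) (x : E d) : Prop :=
  ∃ r > 0, IsStableRegion 𝒟 U b (𝒟.ball x r)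

/-- The set of the `b`-unstable points of `℧(b)`. -/
def unstablePoints (𝒟 : Domain d) (U : Fin 2 → E d → ℝ) (b : E d → E d) : Set (E d) :=
  {x ∈ mho 𝒟 U b | ¬ IsStablePoint 𝒟 U b x}

/-- `w` is an admissible direction at `b`: a test field such that `b + ε w` is in the infinite-time
class for all sufficiently small `ε`. -/
def IsAdmissible (𝒟 : Domain d) (U : Fin 2 → E d → ℝ) (b w : E d → E d) : Prop :=
  w ∈ 𝒟.testFields ∧ ∀ᶠ ε in 𝓝 (0 : ℝ), b + ε • w ∈ infiniteTimeFields 𝒟 U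

/-- `b` is a local minimum of the variance: along every admissible direction `w`,
`Var(b + ε w) ≥ Var(b)` for all sufficiently small `ε`. -/
def IsLocalMinimum (𝒟 : Domain d) (U : Fin 2 → E d → ℝ) (b : E d → E d) : Prop :=
  ∀ w, IsAdmissible 𝒟 U b w → ∀ᶠ ε in 𝓝 (0 : ℝ), Var 𝒟 U b ≤ Var 𝒟 U (b + ε • w)

/-- `g` is the functional derivative of the variance at `b`: along every admissible direction `w`,
`d/dε Var(b + ε w) = ∫_Ω ⟨g, w⟩` at `ε = 0`. -/
def IsFunctionalDerivative (𝒟 : Domain d) (U : Fin 2 → E d → ℝ) (b g : E d → E d) : Prop :=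
  ∀ w, IsAdmissible 𝒟 U b w →
    HasDerivAt (fun ε : ℝ => Var 𝒟 U (b + ε • w)) (∫ x in 𝒟.cell, inner ℝ (g x) (w x)) 0

end NEIS

end

/-!
Write `ρₖ = exp(-Uₖ)`, `h = ρ₁ / ρ₀`, `X_t` for the flow of `b` and `A` for the estimator of `b`.

**Projection.** By Fubini's theorem and the change of variables `y = X_t x`, the estimator is the
conditional expectation, under `ρ₀ dx`, of `h` given the trajectory (`integral_mul_estimator`).
Hence it is unbiased, every variance is nonnegative (`Var_nonneg`), and `A` is the closest to `h`
among the square-integrable functions that are constant along trajectories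
(`integral_sq_sub_estimator_le`); minimizing the variance means maximizing the distance from `h` to
its projection.

**Compactly supported perturbations.** The assumption `℧(b) = Ω` makes the flow proper: with
`G = ∫ F⁰_t dt` one has `J_t = G / G ∘ X_t`, so a trajectory that came back to a compact set at large times
would carry too much weight (`HasContinuousIntegrals.exists_flow_notMem`). This survives small
perturbations: the perturbed trajectories cross the support of `w` in uniformly bounded time and
follow trajectories of `b` elsewhere. So every test field is admissible at `b`, and `℧(b + ε w) = Ω`
for small `ε` (`HasContinuousIntegrals.perturbed`).

**First variation.** The function `A - ε ∫_{-∞}^0 ⟨∇A, w⟩(X^ε_t) dt` is constant along the flow of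
`b + ε w`, so by the projection property it bounds `Var(b + ε w)` from below to first order in `ε`.
As the derivative of the variance vanishes, so does the first-order term; after Fubini's theorem
this is the Euler-Lagrange equation `q ∇A = 0` with `q = ∫_0^∞ (F¹_t - A F⁰_t) dt`
(`futureExcess_smul_fderiv_estimator_eq_zero`).

**Rigidity.** The open set `O = {∇A ≠ 0}` is invariant under the flow, and `q = 0` on it;
differentiating `q` along trajectories gives `A = h` on `O`. A perturbation supported in `O` does
not change the estimator off `O`, and on `O` it can only move it away from `h`, which would decrease
the variance; so by local minimality it does not change the estimator at all
(`estimator_eq_of_Var_le`). Then `A` is constant along the perturbed flows as well, and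
`⟨∇A, w⟩ = 0` for all `w` supported in `O`: thus `O` is empty (`fderiv_estimator_eq_zero`), `A` is constant on
the connected set `Ω`, and its variance is zero.

On a torus no field satisfies `℧(b) = Ω`, because `J_t = G / G ∘ X_t` would then be bounded below by
compactness (`not_hasContinuousIntegrals_torus`).

Existence and `C¹` dependence of the flow are proved from the Picard-Lindelöf theorem. The tangency
of `b` enters only there: a trajectory cannot reach the boundary in finite time
(`exists_tendsto_right`).
-/

noncomputable section

namespace NEIS

/-! ### Flows of autonomous differential equations -/

section AbstractFlow

variable {V : Type*} [NormedAddCommGroup V] [NormedSpace ℝ V]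

/-- `Φ` is a global flow on `Ω` of the vector field `β`: every point of `Ω` has a trajectory that
is defined for all times and stays in `Ω`. -/
structure IsGlobalFlow (β : V → V) (Ω : Set V) (Φ : ℝ → V → V) : Prop where
  zero : ∀ x ∈ Ω, Φ 0 x = x
  mem : ∀ x ∈ Ω, ∀ t, Φ t x ∈ Ω
  deriv : ∀ x ∈ Ω, ∀ t, HasDerivAt (fun s => Φ s x) (β (Φ t x)) t

/-- Grönwall's inequality on both sides of the initial time. -/
lemma norm_le_gronwallBound_abs {f f' : ℝ → V} {δ D M η : ℝ}
    (hf : ∀ t ∈ Ioo (-δ) δ, HasDerivAt f (f' t) t) (h0 : ‖f 0‖ ≤ D)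
    (bound : ∀ t ∈ Ioo (-δ) δ, ‖f' t‖ ≤ M * ‖f t‖ + η) :
    ∀ t ∈ Ioo (-δ) δ, ‖f t‖ ≤ gronwallBound D M η |t| := by
  have key : ∀ (g g' : ℝ → V), (∀ t ∈ Ioo (-δ) δ, HasDerivAt g (g' t) t) → ‖g 0‖ ≤ D →
      (∀ t ∈ Ioo (-δ) δ, ‖g' t‖ ≤ M * ‖g t‖ + η) →
      ∀ t ∈ Ioo (-δ) δ, 0 ≤ t → ‖g t‖ ≤ gronwallBound D M η t := by
    intro g g' hg hg0 hb t ht ht0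
    have hsub : ∀ s ∈ Icc 0 t, s ∈ Ioo (-δ) δ := fun s hs =>
      ⟨by linarith [hs.1, hs.2, ht.1, ht.2], lt_of_le_of_lt hs.2 ht.2⟩
    have := norm_le_gronwallBound_of_norm_deriv_right_le (f := g) (f' := g') (δ := D) (K := M)
      (ε := η) (a := 0) (b := t)
      (fun s hs => (hg s (hsub s hs)).continuousAt.continuousWithinAt)
      (fun s hs => (hg s (hsub s (Ico_subset_Icc_self hs))).hasDerivWithinAt) hg0
      (fun s hs => hb s (hsub s (Ico_subset_Icc_self hs))) t ⟨ht0, le_rfl⟩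
    simpa using this
  intro t ht
  rcases le_total 0 t with h | h
  · rw [abs_of_nonneg h]
    exact key f f' hf h0 bound t ht h
  · rw [abs_of_nonpos h]
    have hneg : ∀ s ∈ Ioo (-δ) δ, -s ∈ Ioo (-δ) δ := fun s hs =>
      ⟨by linarith [hs.2], by linarith [hs.1]⟩
    have := key (fun s => f (-s)) (fun s => -f' (-s))
      (fun s hs => by
        simpa [Function.comp_def] using (hf (-s) (hneg s hs)).scomp s (hasDerivAt_neg s))
      (by simpa using h0)
      (fun s hs => by simpa using bound (-s) (hneg s hs)) (-t) (hneg t ht) (by linarith)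
    simpa using this

/-- Two solutions in `Ω` of a `C¹` differential equation that agree at one time agree on every
connected open set of times. -/
lemma eqOn_of_hasDerivAt {β : V → V} {Ω : Set V} (hΩ : IsOpen Ω) (hβ : ContDiffOn ℝ 1 β Ω)
    {J : Set ℝ} (hJ : IsOpen J) (hJc : IsPreconnected J) {t₀ : ℝ} (ht₀ : t₀ ∈ J) {γ η : ℝ → V}
    (hγ : ∀ t ∈ J, γ t ∈ Ω ∧ HasDerivAt γ (β (γ t)) t)
    (hη : ∀ t ∈ J, η t ∈ Ω ∧ HasDerivAt η (β (η t)) t) (h0 : γ t₀ = η t₀) :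
    EqOn γ η J := by
  have loc : ∀ t ∈ J, γ t = η t → γ =ᶠ[𝓝 t] η := by
    intro t ht hte
    obtain ⟨K, s, hs, hl⟩ := (hβ.contDiffAt (hΩ.mem_nhds (hγ t ht).1)).exists_lipschitzOnWith
    refine ODE_solution_unique_of_eventually (v := fun _ => β) (s := fun _ => s) (K := K)
      (Eventually.of_forall fun _ => hl) ?_ ?_ hte
    · filter_upwards [hJ.mem_nhds ht, (hγ t ht).2.continuousAt hs] with r hr hrs
      exact ⟨(hγ r hr).2, hrs⟩
    · rw [hte] at hs
      filter_upwards [hJ.mem_nhds ht, (hη t ht).2.continuousAt hs] with r hr hrs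
      exact ⟨(hη r hr).2, hrs⟩
  have hsub : J ⊆ {t | γ =ᶠ[𝓝 t] η} := by
    refine hJc.subset_of_closure_inter_subset isOpen_setOfPred_eventually_nhds
      ⟨t₀, ht₀, loc t₀ ht₀ h0⟩ ?_
    rintro t ⟨htc, ht⟩
    refine loc t ht ?_
    have hfr : ∃ᶠ s in 𝓝 t, γ s = η s :=
      (mem_closure_iff_frequently.1 htc).mono fun s hs => hs.self_of_nhds
    exact tendsto_nhds_unique_of_frequently_eq (hγ t ht).2.continuousAt (hη t ht).2.continuousAt hfr
  exact fun t ht => (hsub ht).self_of_nhds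

namespace IsGlobalFlow

variable {β : V → V} {Ω : Set V} {Φ : ℝ → V → V}

lemma continuous_time (h : IsGlobalFlow β Ω Φ) {x : V} (hx : x ∈ Ω) :
    Continuous fun t => Φ t x :=
  continuous_iff_continuousAt.2 fun t => (h.deriv x hx t).continuousAt

/-- The group law, from the uniqueness of trajectories. -/
lemma add (h : IsGlobalFlow β Ω Φ) (hΩ : IsOpen Ω) (hβ : ContDiffOn ℝ 1 β Ω) {x : V} (hx : x ∈ Ω)
    (t s : ℝ) : Φ (t + s) x = Φ t (Φ s x) := by
  refine eqOn_of_hasDerivAt hΩ hβ isOpen_univ isPreconnected_univ (mem_univ (0 : ℝ))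
    (γ := fun t => Φ (t + s) x) (η := fun t => Φ t (Φ s x))
    (fun r _ => ⟨h.mem x hx _, (h.deriv x hx (r + s)).comp_add_const r s⟩)
    (fun r _ => ⟨h.mem _ (h.mem x hx s) _, h.deriv _ (h.mem x hx s) r⟩) ?_ (mem_univ t)
  simp [h.zero _ (h.mem x hx s)]

/-- Local dependence on the initial point: the derivative of the flow in the initial point is the
solution `Y` of the variational equation `Y' = Dβ(Φ) ∘ Y`. A local flow of the augmented
system for `(Φ, Y)` supplies a continuous `Y`, and Grönwall's inequality bounds the error of the
first-order approximation quadratically. -/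
lemma contDiffAt_zero [CompleteSpace V] (h : IsGlobalFlow β Ω Φ) (hΩ : IsOpen Ω)
    (hβ : ContDiffOn ℝ 2 β Ω) {x₀ : V} (hx₀ : x₀ ∈ Ω) :
    ContDiffAt ℝ 1 (fun p : ℝ × V => Φ p.1 p.2) (0, x₀) := by
  have hβ2 : ContDiffAt ℝ 2 β x₀ := hβ.contDiffAt (hΩ.mem_nhds hx₀)
  have hβ1 : ContDiffOn ℝ 1 β Ω := hβ.of_le (by norm_num)
  have hDβ : ContDiffAt ℝ 1 (fderiv ℝ β) x₀ := hβ2.fderiv_right (by norm_num)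
  -- the augmented system
  set Ψ : V × (V →L[ℝ] V) → V × (V →L[ℝ] V) := fun p => (β p.1, (fderiv ℝ β p.1).comp p.2) with hΨ
  have hΨ1 : ContDiffAt ℝ 1 Ψ (x₀, ContinuousLinearMap.id ℝ V) := by
    refine ContDiffAt.prodMk ?_ ?_
    · exact ContDiffAt.comp (x₀, ContinuousLinearMap.id ℝ V)
        (hβ2.of_le (by norm_num)) contDiffAt_fst
    · exact ContDiffAt.clm_comp
        (ContDiffAt.comp (x₀, ContinuousLinearMap.id ℝ V) hDβ contDiffAt_fst) contDiffAt_snd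
  obtain ⟨ε, hε, a, r, L, K, hr, hPL⟩ := IsPicardLindelof.of_contDiffAt_one hΨ1
  obtain ⟨α, hα, L', hL'⟩ :=
    (hPL 0).exists_forall_mem_closedBall_eq_hasDerivWithinAt_lipschitzOnWith
  simp only [zero_sub, zero_add] at hα hL'
  have hαc : ContinuousOn (Function.uncurry α)
      (Metric.closedBall (x₀, ContinuousLinearMap.id ℝ V) r ×ˢ Icc (-ε) ε) :=
    continuousOn_prod_of_continuousOn_lipschitzOnWith _ L'
      (fun p hp => HasDerivWithinAt.continuousOn (hα p hp).2) hL'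
  -- a ball on which `β` is differentiable with bounded, Lipschitz derivative
  obtain ⟨C, s, hs, hC⟩ := hDβ.exists_lipschitzOnWith
  obtain ⟨M, hM0, hM⟩ : ∃ M : ℝ, 0 < M ∧ ∀ᶠ y in 𝓝 x₀, ‖fderiv ℝ β y‖ ≤ M := by
    refine ⟨‖fderiv ℝ β x₀‖ + 1, by positivity, ?_⟩
    exact hDβ.continuousAt.norm.eventually_le_const (lt_add_one _)
  obtain ⟨ρ, hρ, hball⟩ := Metric.eventually_nhds_iff_ball.1
    ((hΩ.eventually_mem hx₀).and ((eventually_mem_set.2 hs).and hM))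
  have hid : (x₀, ContinuousLinearMap.id ℝ V) ∈
      Metric.closedBall (x₀, ContinuousLinearMap.id ℝ V) (r : ℝ) :=
    Metric.mem_closedBall_self r.2
  have hcont0 : ContinuousAt (Function.uncurry α) ((x₀, ContinuousLinearMap.id ℝ V), 0) :=
    hαc.continuousAt (prod_mem_nhds (Metric.closedBall_mem_nhds _ (by exact_mod_cast hr))
      (Icc_mem_nhds (by linarith) hε))
  have hfst : ∀ᶠ p : ℝ × V in 𝓝 (0, x₀),
      (α (p.2, ContinuousLinearMap.id ℝ V) p.1).1 ∈ Metric.ball x₀ ρ := by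
    have h1 : ContinuousAt (fun p : ℝ × V => (((p.2, ContinuousLinearMap.id ℝ V), p.1) :
        (V × (V →L[ℝ] V)) × ℝ)) (0, x₀) := by fun_prop
    have h2 : ContinuousAt (fun p : ℝ × V => (α (p.2, ContinuousLinearMap.id ℝ V) p.1).1) (0, x₀) :=
      (ContinuousAt.comp (x := ((0 : ℝ), x₀)) (g := Function.uncurry α) hcont0 h1).fst
    refine h2 (Metric.isOpen_ball.mem_nhds ?_)
    simp [(hα _ hid).1, hρ]
  obtain ⟨δ₀, hδ₀, hδball⟩ := Metric.eventually_nhds_iff_ball.1 hfst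
  set δ := min (min δ₀ ε) r with hδdef
  have hδ : 0 < δ := lt_min (lt_min hδ₀ hε) (by exact_mod_cast hr)
  have hδε : ∀ t ∈ Ioo (-δ) δ, t ∈ Icc (-ε) ε ∧ |t| < δ₀ ∧ Icc (-ε) ε ∈ 𝓝 t := by
    intro t ht
    have h1 : δ ≤ ε := (min_le_left _ _).trans (min_le_right _ _)
    have h2 : δ ≤ δ₀ := (min_le_left _ _).trans (min_le_left _ _)
    exact ⟨⟨by linarith [ht.1], by linarith [ht.2]⟩,
      abs_lt.2 ⟨by linarith [ht.1], by linarith [ht.2]⟩,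
      Icc_mem_nhds (by linarith [ht.1]) (by linarith [ht.2])⟩
  have hyball : ∀ y ∈ Metric.ball x₀ δ, (y, ContinuousLinearMap.id ℝ V) ∈
      Metric.closedBall (x₀, ContinuousLinearMap.id ℝ V) (r : ℝ) := by
    intro y hy
    rw [Metric.mem_closedBall, Prod.dist_eq]
    simp only [dist_self]
    exact max_le ((Metric.mem_ball.1 hy).le.trans (min_le_right _ _)) r.2
  have hyρ : ∀ y ∈ Metric.ball x₀ δ, ∀ t ∈ Ioo (-δ) δ,
      (α (y, ContinuousLinearMap.id ℝ V) t).1 ∈ Metric.ball x₀ ρ := by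
    intro y hy t ht
    refine hδball (t, y) ?_
    rw [Metric.mem_ball, Prod.dist_eq, max_lt_iff]
    exact ⟨by simpa using (hδε t ht).2.1,
      lt_of_lt_of_le hy ((min_le_left _ _).trans (min_le_left _ _))⟩
  have hαd : ∀ y ∈ Metric.ball x₀ δ, ∀ t ∈ Ioo (-δ) δ,
      HasDerivAt (α (y, ContinuousLinearMap.id ℝ V)) (Ψ (α (y, ContinuousLinearMap.id ℝ V) t)) t :=
    fun y hy t ht => ((hα _ (hyball y hy)).2 t (hδε t ht).1).hasDerivAt (hδε t ht).2.2
  have hδΩ : ∀ y ∈ Metric.ball x₀ δ, y ∈ Ω := by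
    intro y hy
    have := hyρ y hy 0 ⟨by linarith, hδ⟩
    rw [(hα _ (hyball y hy)).1] at this
    exact (hball _ this).1
  -- the first component of the augmented solution is the flow
  have hΦα : ∀ y ∈ Metric.ball x₀ δ, ∀ t ∈ Ioo (-δ) δ,
      Φ t y = (α (y, ContinuousLinearMap.id ℝ V) t).1 := by
    intro y hy t ht
    refine eqOn_of_hasDerivAt hΩ hβ1 isOpen_Ioo isPreconnected_Ioo
      (show (0 : ℝ) ∈ Ioo (-δ) δ from ⟨by linarith, hδ⟩) (γ := fun t => Φ t y)
      (η := fun t => (α (y, ContinuousLinearMap.id ℝ V) t).1)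
      (fun s _ => ⟨h.mem y (hδΩ y hy) s, h.deriv y (hδΩ y hy) s⟩)
      (fun s hs => ⟨(hball _ (hyρ y hy s hs)).1, ?_⟩) ?_ ht
    · have h1 : HasDerivAt (fun t => (α (y, ContinuousLinearMap.id ℝ V) t).1)
          (Ψ (α (y, ContinuousLinearMap.id ℝ V) s)).1 s :=
        (hasFDerivAt_fst (𝕜 := ℝ) (p := α (y, ContinuousLinearMap.id ℝ V) s)).comp_hasDerivAt s
          (hαd y hy s hs)
      exact h1
    · simp [h.zero y (hδΩ y hy), (hα _ (hyball y hy)).1]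
  set Y : ℝ → V → (V →L[ℝ] V) := fun t y => (α (y, ContinuousLinearMap.id ℝ V) t).2 with hY
  have hY0 : ∀ y ∈ Metric.ball x₀ δ, Y 0 y = ContinuousLinearMap.id ℝ V := by
    intro y hy; simp [hY, (hα _ (hyball y hy)).1]
  have hYd : ∀ y ∈ Metric.ball x₀ δ, ∀ t ∈ Ioo (-δ) δ,
      HasDerivAt (fun t => Y t y) ((fderiv ℝ β (Φ t y)).comp (Y t y)) t := by
    intro y hy t ht
    rw [hΦα y hy t ht]
    exact (hasFDerivAt_snd (𝕜 := ℝ) (p := α (y, ContinuousLinearMap.id ℝ V) t)).comp_hasDerivAt t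
          (hαd y hy t ht)
  have hΦρ : ∀ y ∈ Metric.ball x₀ δ, ∀ t ∈ Ioo (-δ) δ, Φ t y ∈ Metric.ball x₀ ρ := by
    intro y hy t ht
    rw [hΦα y hy t ht]; exact hyρ y hy t ht
  have hLip : ∀ y ∈ Metric.ball x₀ δ, ∀ z ∈ Metric.ball x₀ δ, ∀ t ∈ Ioo (-δ) δ,
      ‖Φ t z - Φ t y‖ ≤ L' * ‖z - y‖ := by
    intro y hy z hz t ht
    rw [hΦα y hy t ht, hΦα z hz t ht]
    have := (hL' t (hδε t ht).1).dist_le_mul _ (hyball z hz) _ (hyball y hy)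
    rw [dist_eq_norm, Prod.dist_eq, dist_self, dist_eq_norm, max_eq_left (norm_nonneg _)] at this
    exact (norm_fst_le _).trans this
  -- quadratic bound on the error of the linear approximation
  have hquad : ∀ t ∈ Ioo (-δ) δ, ∃ B : ℝ, ∀ y ∈ Metric.ball x₀ δ, ∀ z ∈ Metric.ball x₀ δ,
      ‖Φ t z - Φ t y - Y t y (z - y)‖ ≤ B * ‖z - y‖ ^ 2 := by
    intro t ht
    refine ⟨C * L' ^ 2 / M * (Real.exp (M * |t|) - 1), fun y hy z hz => ?_⟩
    have hgr := norm_le_gronwallBound_abs (δ := δ) (D := 0) (M := M)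
      (η := C * (L' * ‖z - y‖) ^ 2)
      (f := fun s => Φ s z - Φ s y - Y s y (z - y))
      (f' := fun s => β (Φ s z) - β (Φ s y) - (fderiv ℝ β (Φ s y)) (Y s y (z - y)))
      (fun s hs => ((h.deriv z (hδΩ z hz) s).sub (h.deriv y (hδΩ y hy) s)).sub
        (by simpa using (hYd y hy s hs).clm_apply (hasDerivAt_const s (z - y))))
      (by simp [h.zero y (hδΩ y hy), h.zero z (hδΩ z hz), hY0 y hy]) ?_ t ht
    · refine hgr.trans (le_of_eq ?_)
      rw [gronwallBound_of_K_ne_0 hM0.ne']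
      ring
    · intro s hs
      have hΦy := hball _ (hΦρ y hy s hs)
      have hseg : segment ℝ (Φ s y) (Φ s z) ⊆ Metric.ball x₀ ρ :=
        (convex_ball x₀ ρ).segment_subset (hΦρ y hy s hs) (hΦρ z hz s hs)
      have hmv := Convex.norm_image_sub_le_of_norm_hasFDerivWithin_le' (𝕜 := ℝ) (f := β)
        (f' := fderiv ℝ β) (φ := fderiv ℝ β (Φ s y)) (C := C * ‖Φ s z - Φ s y‖)
        (s := segment ℝ (Φ s y) (Φ s z))
        (fun p hp => ((hβ1.contDiffAt (hΩ.mem_nhds (hball p (hseg hp)).1)).differentiableAt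
          (by norm_num)).hasFDerivAt.hasFDerivWithinAt)
        (fun p hp => by
          have := hC.dist_le_mul p (hball p (hseg hp)).2.1 _ hΦy.2.1
          rw [dist_eq_norm, dist_eq_norm] at this
          refine this.trans (mul_le_mul_of_nonneg_left ?_ C.2)
          exact norm_sub_le_of_mem_segment hp)
        (convex_segment _ _) (left_mem_segment ℝ _ _) (right_mem_segment ℝ _ _)
      have hsplit : β (Φ s z) - β (Φ s y) - (fderiv ℝ β (Φ s y)) (Y s y (z - y)) =
          fderiv ℝ β (Φ s y) (Φ s z - Φ s y - Y s y (z - y)) +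
          (β (Φ s z) - β (Φ s y) - fderiv ℝ β (Φ s y) (Φ s z - Φ s y)) := by
        simp only [map_sub]; abel
      rw [hsplit]
      refine (norm_add_le _ _).trans (add_le_add ?_ (hmv.trans ?_))
      · exact (ContinuousLinearMap.le_opNorm _ _).trans
          (mul_le_mul_of_nonneg_right hΦy.2.2 (norm_nonneg _))
      · have := hLip y hy z hz s hs
        calc C * ‖Φ s z - Φ s y‖ * ‖Φ s z - Φ s y‖ = C * ‖Φ s z - Φ s y‖ ^ 2 := by ring
          _ ≤ C * (L' * ‖z - y‖) ^ 2 := by gcongr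
  have hfd : ∀ t ∈ Ioo (-δ) δ, ∀ y ∈ Metric.ball x₀ δ, HasFDerivAt (Φ t) (Y t y) y := by
    intro t ht y hy
    obtain ⟨B, hB⟩ := hquad t ht
    rw [hasFDerivAt_iff_isLittleO]
    have hO : (fun z => Φ t z - Φ t y - Y t y (z - y)) =O[𝓝 y] fun z => ‖z - y‖ ^ 2 := by
      refine Asymptotics.IsBigO.of_bound B ?_
      filter_upwards [Metric.isOpen_ball.mem_nhds hy] with z hz
      simpa using hB y hy z hz
    exact hO.trans_isLittleO (Asymptotics.isLittleO_pow_sub_sub y (by norm_num))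
  -- both partial derivatives are continuous near `(0, x₀)`
  have hYc : ContinuousOn (fun p : ℝ × V => Y p.1 p.2) (Ioo (-δ) δ ×ˢ Metric.ball x₀ δ) := by
    refine continuous_snd.comp_continuousOn (hαc.comp (f := fun p : ℝ × V =>
      (((p.2, ContinuousLinearMap.id ℝ V), p.1) : (V × (V →L[ℝ] V)) × ℝ)) (by fun_prop) ?_)
    exact fun p hp => ⟨hyball _ hp.2, (hδε _ hp.1).1⟩
  have hΦc : ContinuousOn (fun p : ℝ × V => Φ p.1 p.2) (Ioo (-δ) δ ×ˢ Metric.ball x₀ δ) := by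
    have : ContinuousOn (fun p : ℝ × V => (α (p.2, ContinuousLinearMap.id ℝ V) p.1).1)
        (Ioo (-δ) δ ×ˢ Metric.ball x₀ δ) := by
      refine continuous_fst.comp_continuousOn (hαc.comp (f := fun p : ℝ × V =>
        (((p.2, ContinuousLinearMap.id ℝ V), p.1) : (V × (V →L[ℝ] V)) × ℝ)) (by fun_prop) ?_)
      exact fun p hp => ⟨hyball _ hp.2, (hδε _ hp.1).1⟩
    exact this.congr fun p hp => hΦα _ hp.2 _ hp.1
  have hopen : IsOpen (Ioo (-δ) δ ×ˢ Metric.ball x₀ δ) := isOpen_Ioo.prod Metric.isOpen_ball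
  have hβc : ContinuousOn (fun p : ℝ × V => β (Φ p.1 p.2)) (Ioo (-δ) δ ×ˢ Metric.ball x₀ δ) :=
    hβ1.continuousOn.comp hΦc fun p hp => h.mem _ (hδΩ _ hp.2) _
  rw [contDiffAt_one_iff]
  refine ⟨fun p => (ContinuousLinearMap.smulRight (1 : ℝ →L[ℝ] ℝ)
      (β (Φ p.1 p.2))).coprod (Y p.1 p.2),
    Ioo (-δ) δ ×ˢ Metric.ball x₀ δ, hopen.mem_nhds ⟨⟨by linarith, hδ⟩, Metric.mem_ball_self hδ⟩,
    ?_, ?_⟩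
  · refine ContinuousOn.congr (f := fun p => (ContinuousLinearMap.smulRight (1 : ℝ →L[ℝ] ℝ)
      (β (Φ p.1 p.2))).comp (ContinuousLinearMap.fst ℝ ℝ V) +
      (Y p.1 p.2).comp (ContinuousLinearMap.snd ℝ ℝ V)) ?_ ?_
    · refine ContinuousOn.add (ContinuousOn.clm_comp ?_ continuousOn_const)
        (hYc.clm_comp continuousOn_const)
      exact (ContinuousLinearMap.smulRightL ℝ ℝ V
        (1 : ℝ →L[ℝ] ℝ)).continuous.comp_continuousOn hβc
    · intro p _
      ext <;> simp
  · intro p hp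
    have hnear := hopen.mem_nhds hp
    refine (hasStrictFDerivAt_uncurry_coprod (f := Φ)
      (f₁ := fun t y => ContinuousLinearMap.smulRight (1 : ℝ →L[ℝ] ℝ) (β (Φ t y)))
      (f₂ := Y) ?_ ?_ ?_ ?_).hasFDerivAt
    · filter_upwards [hnear] with q hq
      exact (h.deriv _ (hδΩ _ hq.2) _).hasFDerivAt
    · filter_upwards [hnear] with q hq
      exact hfd _ hq.1 _ hq.2
    · exact ((ContinuousLinearMap.smulRightL ℝ ℝ V (1 : ℝ →L[ℝ] ℝ)).continuous.continuousAt.comp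
        (hβc.continuousAt hnear))
    · exact hYc.continuousAt hnear

/-- The flow of a `C²` vector field is jointly `C¹`. The set of times near which this holds along a
given trajectory is open, and closed by the group law and the local result. -/
theorem contDiffAt [CompleteSpace V] (h : IsGlobalFlow β Ω Φ) (hΩ : IsOpen Ω)
    (hβ : ContDiffOn ℝ 2 β Ω) {x : V} (hx : x ∈ Ω) (t : ℝ) :
    ContDiffAt ℝ 1 (fun p : ℝ × V => Φ p.1 p.2) (t, x) := by
  have hβ1 : ContDiffOn ℝ 1 β Ω := hβ.of_le (by norm_num)
  set S : Set ℝ := {t | ∀ᶠ s in 𝓝 t, ContDiffAt ℝ 1 (fun p : ℝ × V => Φ p.1 p.2) (s, x)} with hS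
  have hev : ∀ y ∈ Ω, ∀ t, ContDiffAt ℝ 1 (fun p : ℝ × V => Φ p.1 p.2) (t, y) →
      ∀ᶠ s in 𝓝 t, ContDiffAt ℝ 1 (fun p : ℝ × V => Φ p.1 p.2) (s, y) := by
    intro y _ t ht
    have hc : ContinuousAt (fun s : ℝ => (s, y)) t := by fun_prop
    exact hc.eventually (ht.eventually (by simp))
  have hcomp : ∀ t s, ContDiffAt ℝ 1 (fun p : ℝ × V => Φ p.1 p.2) (s, x) →
      ContDiffAt ℝ 1 (fun p : ℝ × V => Φ p.1 p.2) (t - s, Φ s x) →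
      ContDiffAt ℝ 1 (fun p : ℝ × V => Φ p.1 p.2) (t, x) := by
    intro t s h1 h2
    have h3 : ContDiffAt ℝ 1 (fun p : ℝ × V => Φ s p.2) (t, x) :=
      ContDiffAt.comp (t, x) (g := fun p : ℝ × V => Φ p.1 p.2) (f := fun p : ℝ × V => (s, p.2)) h1
        (contDiffAt_const.prodMk contDiffAt_snd)
    have h4 : ContDiffAt ℝ 1 (fun p : ℝ × V => Φ (p.1 - s) (Φ s p.2)) (t, x) :=
      ContDiffAt.comp (t, x) (g := fun p : ℝ × V => Φ p.1 p.2)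
        (f := fun p : ℝ × V => (p.1 - s, Φ s p.2)) h2
        ((contDiffAt_fst.sub contDiffAt_const).prodMk h3)
    refine h4.congr_of_eventuallyEq ?_
    have : ∀ᶠ p : ℝ × V in 𝓝 (t, x), p.2 ∈ Ω := continuousAt_snd (hΩ.mem_nhds hx)
    filter_upwards [this] with p hp
    rw [← h.add hΩ hβ1 hp, sub_add_cancel]
  have hSuniv : univ ⊆ S := by
    refine isPreconnected_univ.subset_of_closure_inter_subset isOpen_setOfPred_eventually_nhds
      ⟨0, mem_univ _, hev x hx 0 (h.contDiffAt_zero hΩ hβ hx)⟩ ?_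
    rintro t ⟨ht, -⟩
    have h0 := h.contDiffAt_zero hΩ hβ (h.mem x hx t)
    have hc : ContinuousAt (fun s : ℝ => (t - s, Φ s x)) t :=
      (by fun_prop : ContinuousAt (fun s : ℝ => t - s) t).prodMk (h.continuous_time hx).continuousAt
    have hnear : ∀ᶠ s in 𝓝 t, ContDiffAt ℝ 1 (fun p : ℝ × V => Φ p.1 p.2) (t - s, Φ s x) := by
      refine hc.eventually ?_
      simp only [sub_self]
      exact h0.eventually (by simp)
    obtain ⟨s, hs1, hs2⟩ := ((mem_closure_iff_frequently.1 ht).and_eventually hnear).exists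
    exact hev x hx t (hcomp t s hs1.self_of_nhds hs2)
  exact (hSuniv (mem_univ t)).self_of_nhds

end IsGlobalFlow

end AbstractFlow

/-! ### Global trajectories of tangent fields with bounded gradient -/

section Existence

variable {d : ℕ} {Ω : Set (E d)} {b : E d → E d}

lemma fderiv_eq_zero_of_inner_gradient {φ : E d → ℝ} {y v : E d} (h0 : gradient φ y ≠ 0)
    (h : inner ℝ v (‖gradient φ y‖⁻¹ • gradient φ y) = 0) : fderiv ℝ φ y v = 0 := by
  rw [inner_smul_right, mul_eq_zero, or_iff_right (inv_ne_zero (norm_ne_zero_iff.2 h0))] at h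
  rw [← inner_gradient_left, real_inner_comm]
  exact h

/-- Near a boundary point, the derivative of a defining function `φ` along a tangent field is
bounded by a multiple of `|φ|`: both vanish on the boundary, and going from `y` in the direction
of the outer normal the boundary is reached within a distance comparable to `|φ y|`. -/
lemma exists_abs_fderiv_le_mul_abs (hΩ : IsOpen Ω) (hb : ContinuousOn b (closure Ω))
    (hd : DifferentiableOn ℝ b Ω)
    (htan : ∀ p ∈ frontier Ω, ∀ n, IsOutwardNormal Ω p n → inner ℝ (b p) n = 0) {C : ℝ}
    (hC : ∀ x ∈ Ω, ‖fderiv ℝ b x‖ ≤ C) {p : E d} (hp : p ∈ frontier Ω) {φ : E d → ℝ}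
    (hφ : IsLocalDefiningFunction Ω p φ) :
    ∃ K : ℝ, ∀ᶠ y in 𝓝 p, y ∈ Ω → |fderiv ℝ φ y (b y)| ≤ K * |φ y| := by
  obtain ⟨hφs, hφp, hφg, hφΩ⟩ := hφ
  set n := gradient φ p with hn
  have hν : 0 < ‖n‖ := norm_pos_iff.2 hφg
  have hφc : Continuous φ := hφs.continuous
  have hφd : Differentiable ℝ φ := hφs.differentiable (by simp)
  have hDφ : ContDiff ℝ 1 (fderiv ℝ φ) := hφs.fderiv_right (m := 1) (by norm_cast)
  obtain ⟨C₁, s, hs, hC₁⟩ := (hDφ.contDiffAt (x := p)).exists_lipschitzOnWith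
  have hCnn : 0 ≤ C ∨ Ω = ∅ := by
    rcases Ω.eq_empty_or_nonempty with h | ⟨x, hx⟩
    · exact Or.inr h
    · exact Or.inl ((norm_nonneg _).trans (hC x hx))
  rcases hCnn with hC0 | hempty
  swap
  · exact ⟨0, Eventually.of_forall fun y hy => by simp [hempty] at hy⟩
  set c := ‖n‖ ^ 2 / 2 with hc
  have hcpos : 0 < c := by positivity
  have e1 : ∀ᶠ y in 𝓝 p, c < fderiv ℝ φ y n := by
    have : ContinuousAt (fun y => fderiv ℝ φ y n) p :=
      (hDφ.continuous.clm_apply continuous_const).continuousAt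
    refine this.eventually_const_lt ?_
    change c < fderiv ℝ φ p n
    rw [← inner_gradient_left, ← hn, real_inner_self_eq_norm_sq]
    rw [hc]; linarith [pow_pos hν 2]
  have e2 : ∀ᶠ y in 𝓝 p, ‖fderiv ℝ φ y‖ < ‖fderiv ℝ φ p‖ + 1 :=
    hDφ.continuous.continuousAt.norm.eventually_lt_const (lt_add_one _)
  have e3 : ∀ᶠ y in 𝓝 p, y ∈ closure Ω → ‖b y‖ < ‖b p‖ + 1 :=
    eventually_nhdsWithin_iff.1 ((hb p hp.1).norm.eventually_lt_const (lt_add_one _))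
  obtain ⟨ρ, hρ, hball⟩ := Metric.eventually_nhds_iff_ball.1
    (e1.and (e2.and (e3.and ((eventually_mem_set.2 hs).and hφΩ.eventually_nhds))))
  have e4 : ∀ᶠ y in 𝓝 p, |φ y| / c * ‖n‖ < ρ / 2 := by
    have : ContinuousAt (fun y => |φ y| / c * ‖n‖) p := by fun_prop
    refine this.eventually_lt_const ?_
    simp [hφp, hρ]
  refine ⟨(C₁ * ‖n‖ * (‖b p‖ + 1) + (‖fderiv ℝ φ p‖ + 1) * (C * ‖n‖)) / c, ?_⟩
  filter_upwards [e4, Metric.ball_mem_nhds p (half_pos hρ)] with y hy4 hyb hyΩ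
  -- the ray from `y` in the normal direction
  set s₀ := |φ y| / c with hs₀
  have hs₀0 : 0 ≤ s₀ := by positivity
  have hray : ∀ r ∈ Icc 0 s₀, y + r • n ∈ Metric.ball p ρ := by
    intro r hr
    rw [Metric.mem_ball] at hyb ⊢
    calc dist (y + r • n) p ≤ dist (y + r • n) y + dist y p := dist_triangle _ _ _
      _ = r * ‖n‖ + dist y p := by simp [norm_smul, abs_of_nonneg hr.1]
      _ ≤ s₀ * ‖n‖ + dist y p := by gcongr; exact hr.2
      _ < ρ := by linarith
  have hrayd : ∀ r : ℝ, HasDerivAt (fun r : ℝ => y + r • n) n r := fun r => by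
    simpa using ((hasDerivAt_id r).smul_const n).const_add y
  have hfd : ∀ r : ℝ, HasDerivAt (fun r : ℝ => φ (y + r • n)) (fderiv ℝ φ (y + r • n) n) r :=
    fun r => (hφd _).hasFDerivAt.comp_hasDerivAt r (hrayd r)
  have hmono : ∀ r₁ ∈ Icc 0 s₀, ∀ r₂ ∈ Icc 0 s₀, r₁ ≤ r₂ →
      c * (r₂ - r₁) ≤ φ (y + r₂ • n) - φ (y + r₁ • n) := by
    refine Convex.mul_sub_le_image_sub_of_le_deriv (convex_Icc 0 s₀)
      (fun r _ => (hfd r).continuousAt.continuousWithinAt)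
      (fun r _ => (hfd r).differentiableAt.differentiableWithinAt) ?_
    intro r hr
    rw [(hfd r).deriv]
    exact (hball _ (hray r (interior_subset hr))).1.le
  have hyΩ' : ∀ z ∈ Metric.ball p ρ, (z ∈ Ω ↔ φ z < 0) :=
    fun z hz => (hball z hz).2.2.2.2.self_of_nhds
  have h0mem : (0 : ℝ) ∈ Icc 0 s₀ := ⟨le_rfl, hs₀0⟩
  have hs₀mem : s₀ ∈ Icc 0 s₀ := ⟨hs₀0, le_rfl⟩
  have hφy : φ y < 0 := by
    have := (hyΩ' _ (hray 0 h0mem)).1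
    simpa using this (by simpa using hyΩ)
  have hend : 0 ≤ φ (y + s₀ • n) := by
    have := hmono 0 h0mem s₀ hs₀mem hs₀0
    rw [zero_smul, add_zero, sub_zero, hs₀, abs_of_neg hφy] at this
    rw [hs₀, abs_of_neg hφy]
    have h2 : c * (-φ y / c) = -φ y := by field_simp
    linarith
  obtain ⟨s₁, hs₁, hs₁0⟩ : ∃ s₁ ∈ Icc 0 s₀, φ (y + s₁ • n) = 0 := by
    have := intermediate_value_Icc hs₀0
      (f := fun r : ℝ => φ (y + r • n)) (fun r _ => (hfd r).continuousAt.continuousWithinAt)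
    exact this ⟨by simpa using hφy.le, hend⟩
  have hbefore : ∀ r ∈ Ico 0 s₁, y + r • n ∈ Ω := by
    intro r hr
    have hr' : r ∈ Icc 0 s₀ := ⟨hr.1, hr.2.le.trans hs₁.2⟩
    have := hmono r hr' s₁ hs₁ hr.2.le
    rw [hs₁0] at this
    exact (hyΩ' _ (hray r hr')).2 (by nlinarith [hr.2])
  have hs₁pos : 0 < s₁ := by
    refine lt_of_le_of_ne hs₁.1 fun h => ?_
    rw [← h, zero_smul, add_zero] at hs₁0
    linarith
  set z := y + s₁ • n with hz
  have hzball := hball z (hray s₁ hs₁)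
  have hzΩ : z ∉ Ω := fun h => by
    have := (hyΩ' z (hray s₁ hs₁)).1 h
    linarith
  have hzcl : z ∈ closure Ω := by
    have hc : ContinuousWithinAt (fun r : ℝ => y + r • n) (Ico 0 s₁) s₁ :=
      (hrayd s₁).continuousAt.continuousWithinAt
    refine hc.mem_closure ?_ hbefore
    rw [closure_Ico hs₁pos.ne]
    exact ⟨hs₁pos.le, le_rfl⟩
  have hzfr : z ∈ frontier Ω := by
    rw [hΩ.frontier_eq]; exact ⟨hzcl, hzΩ⟩
  have hztan : fderiv ℝ φ z (b z) = 0 := by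
    have hg : gradient φ z ≠ 0 := by
      intro h
      have h1 := hzball.1
      rw [← inner_gradient_left, h, inner_zero_left] at h1
      linarith
    exact fderiv_eq_zero_of_inner_gradient hg
      (htan z hzfr _ ⟨φ, ⟨hφs, hs₁0, hg, hzball.2.2.2.2⟩, rfl⟩)
  have hbyz : ‖b z - b y‖ ≤ C * ‖n‖ * s₁ := by
    have := norm_image_sub_le_of_norm_deriv_right_le_segment (f := fun r : ℝ => b (y + r • n))
      (f' := fun r => fderiv ℝ b (y + r • n) n) (C := C * ‖n‖) (a := 0) (b := s₁) ?_ ?_ ?_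
      s₁ ⟨hs₁.1, le_rfl⟩
    · simpa using this
    · refine hb.comp (fun r _ => (hrayd r).continuousAt.continuousWithinAt) ?_
      intro r hr
      rcases hr.2.eq_or_lt with h | h
      · rw [h]; exact hzcl
      · exact subset_closure (hbefore r ⟨hr.1, h⟩)
    · intro r hr
      have hbd : DifferentiableAt ℝ b (y + r • n) :=
        hd.differentiableAt (hΩ.mem_nhds (hbefore r hr))
      exact (hbd.hasFDerivAt.comp_hasDerivAt r (hrayd r)).hasDerivWithinAt
    · intro r hr
      exact (ContinuousLinearMap.le_opNorm _ _).trans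
        (mul_le_mul_of_nonneg_right (hC _ (hbefore r hr)) (norm_nonneg _))
  have hyball := hball y (by simpa using hray 0 h0mem)
  have hDyz : ‖fderiv ℝ φ y - fderiv ℝ φ z‖ ≤ C₁ * (s₁ * ‖n‖) := by
    have := hC₁.dist_le_mul y hyball.2.2.2.1 z hzball.2.2.2.1
    rw [dist_eq_norm, dist_eq_norm] at this
    refine this.trans (le_of_eq ?_)
    rw [hz, sub_add_cancel_left, norm_neg, norm_smul, Real.norm_eq_abs, abs_of_nonneg hs₁.1]
  have hsplit : fderiv ℝ φ y (b y) =
      (fderiv ℝ φ y - fderiv ℝ φ z) (b y) - fderiv ℝ φ z (b z - b y) := by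
    rw [map_sub, hztan, sub_apply]; abel
  calc |fderiv ℝ φ y (b y)|
      ≤ ‖(fderiv ℝ φ y - fderiv ℝ φ z) (b y)‖ + ‖fderiv ℝ φ z (b z - b y)‖ := by
        rw [hsplit, ← Real.norm_eq_abs]; exact norm_sub_le _ _
    _ ≤ C₁ * (s₁ * ‖n‖) * (‖b p‖ + 1) + (‖fderiv ℝ φ p‖ + 1) * (C * ‖n‖ * s₁) := by
        refine add_le_add ?_ ?_
        · refine (ContinuousLinearMap.le_opNorm _ _).trans
            (mul_le_mul hDyz (hyball.2.2.1 (subset_closure hyΩ)).le (norm_nonneg _) ?_)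
          have := hs₁.1
          positivity
        · exact (ContinuousLinearMap.le_opNorm _ _).trans
            (mul_le_mul hzball.2.1.le hbyz (norm_nonneg _) (by positivity))
    _ = (C₁ * ‖n‖ * (‖b p‖ + 1) + (‖fderiv ℝ φ p‖ + 1) * (C * ‖n‖)) * s₁ := by ring
    _ ≤ (C₁ * ‖n‖ * (‖b p‖ + 1) + (‖fderiv ℝ φ p‖ + 1) * (C * ‖n‖)) * s₀ := by
        gcongr
        exact hs₁.2
    _ = _ := by rw [hs₀]; ring

/-- A trajectory in `Ω` on a bounded time interval converges inside `Ω` at the right end point: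
it has bounded speed, and the tangency of the field keeps it from reaching the boundary. -/
lemma exists_tendsto_right (hΩ : IsOpen Ω) (hsm : HasSmoothBoundary Ω)
    (hb : ContinuousOn b (closure Ω)) (hd : DifferentiableOn ℝ b Ω)
    (htan : ∀ p ∈ frontier Ω, ∀ n, IsOutwardNormal Ω p n → inner ℝ (b p) n = 0) {C : ℝ}
    (hC : ∀ x ∈ Ω, ‖fderiv ℝ b x‖ ≤ C) {γ : ℝ → E d} {a : ℝ} (ha : 0 < a)
    (hγ : ∀ t ∈ Ioo (-a) a, γ t ∈ Ω ∧ HasDerivAt γ (b (γ t)) t) :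
    ∃ p ∈ Ω, Tendsto γ (𝓝[<] a) (𝓝 p) := by
  have h0 : (0 : ℝ) ∈ Ioo (-a) a := ⟨by linarith, ha⟩
  have hC0 : 0 ≤ C := (norm_nonneg _).trans (hC _ (hγ 0 h0).1)
  -- the speed is bounded
  obtain ⟨M, hM⟩ : ∃ M : ℝ, ∀ t ∈ Ioo (-a) a, ‖b (γ t)‖ ≤ M := by
    refine ⟨gronwallBound ‖b (γ 0)‖ C 0 a, fun t ht => ?_⟩
    refine (norm_le_gronwallBound_abs (f := fun t => b (γ t)) (δ := a) (D := ‖b (γ 0)‖) (M := C)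
      (η := 0) (f' := fun t => fderiv ℝ b (γ t) (b (γ t))) ?_ le_rfl ?_ t ht).trans ?_
    · intro s hs
      exact (hd.differentiableAt
        (hΩ.mem_nhds (hγ s hs).1)).hasFDerivAt.comp_hasDerivAt s (hγ s hs).2
    · intro s hs
      rw [add_zero]
      exact (ContinuousLinearMap.le_opNorm _ _).trans
        (mul_le_mul_of_nonneg_right (hC _ (hγ s hs).1) (norm_nonneg _))
    · exact gronwallBound_mono (norm_nonneg _) le_rfl hC0 (abs_lt.2 ht).le
  have hM0 : 0 ≤ M := (norm_nonneg _).trans (hM 0 h0)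
  have hlip : LipschitzOnWith M.toNNReal γ (Ioo (-a) a) := by
    refine (convex_Ioo _ _).lipschitzOnWith_of_nnnorm_hasDerivWithin_le
      (f' := fun t => b (γ t)) (fun t ht => (hγ t ht).2.hasDerivWithinAt) fun t ht => ?_
    rw [← NNReal.coe_le_coe, coe_nnnorm, Real.coe_toNNReal _ hM0]
    exact hM t ht
  obtain ⟨g, hg, hgγ⟩ := hlip.extend_finite_dimension
  have hev : ∀ᶠ t in 𝓝[<] a, t ∈ Ioo (-a) a := Ioo_mem_nhdsLT (by linarith)
  have hlim : Tendsto γ (𝓝[<] a) (𝓝 (g a)) := by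
    refine Tendsto.congr' ?_ (hg.continuous.continuousAt.tendsto.mono_left nhdsWithin_le_nhds)
    filter_upwards [hev] with t ht using (hgγ ht).symm
  have hcl : g a ∈ closure Ω :=
    mem_closure_of_tendsto hlim (hev.mono fun t ht => (hγ t ht).1)
  by_contra! hcon
  have hfr : g a ∈ frontier Ω := by
    rw [hΩ.frontier_eq]
    exact ⟨hcl, fun h => hcon _ h hlim⟩
  obtain ⟨φ, hφ⟩ := hsm _ hfr
  obtain ⟨K, hK⟩ := exists_abs_fderiv_le_mul_abs hΩ hb hd htan hC hfr hφ
  obtain ⟨hφs, hφp, -, hφΩ⟩ := hφ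
  obtain ⟨t₁, ht₁, hnear⟩ : ∃ t₁ < a, ∀ t ∈ Ioo t₁ a, t ∈ Ioo (-a) a ∧
      (γ t ∈ Ω → |fderiv ℝ φ (γ t) (b (γ t))| ≤ K * |φ (γ t)|) ∧ (γ t ∈ Ω ↔ φ (γ t) < 0) :=
    (mem_nhdsLT_iff_exists_Ioo_subset).1
      (hev.and ((hlim.eventually hK).and (hlim.eventually hφΩ)))
  -- `φ ∘ γ` is negative and `t ↦ φ (γ t) exp (K t)` decreases, so `φ ∘ γ` cannot tend to `0`
  set u : ℝ → ℝ := fun t => φ (γ t) * Real.exp (K * t) with hu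
  have hud : ∀ t ∈ Ioo t₁ a, HasDerivAt u (fderiv ℝ φ (γ t) (b (γ t)) * Real.exp (K * t) +
      φ (γ t) * (Real.exp (K * t) * K)) t := by
    intro t ht
    have h1 : HasDerivAt (fun t => φ (γ t)) (fderiv ℝ φ (γ t) (b (γ t))) t :=
      ((hφs.differentiable (by simp)) _).hasFDerivAt.comp_hasDerivAt t (hγ t (hnear t ht).1).2
    have h2 : HasDerivAt (fun t : ℝ => Real.exp (K * t)) (Real.exp (K * t) * K) t := by
      simpa using ((hasDerivAt_id t).const_mul K).exp
    exact h1.mul h2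
  have hanti : AntitoneOn u (Ioo t₁ a) := by
    refine antitoneOn_of_deriv_nonpos (convex_Ioo _ _)
      (fun t ht => (hud t ht).continuousAt.continuousWithinAt)
      (fun t ht => (hud t (interior_subset ht)).differentiableAt.differentiableWithinAt) ?_
    intro t ht
    replace ht := interior_subset ht
    rw [(hud t ht).deriv]
    obtain ⟨h1, h2, h3⟩ := hnear t ht
    have h4 := h2 (hγ t h1).1
    have h5 := h3.1 (hγ t h1).1
    rw [abs_of_neg h5] at h4
    have h6 := (le_abs_self _).trans h4
    have h7 := Real.exp_pos (K * t)
    nlinarith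
  obtain ⟨t₂, ht₂⟩ : (Ioo t₁ a).Nonempty := nonempty_Ioo.2 ht₁
  have hulim : Tendsto u (𝓝[<] a) (𝓝 0) := by
    have h1 : Tendsto (fun t => φ (γ t)) (𝓝[<] a) (𝓝 (φ (g a))) :=
      (hφs.continuous.tendsto _).comp hlim
    have h2 : Tendsto (fun t : ℝ => Real.exp (K * t)) (𝓝[<] a) (𝓝 (Real.exp (K * a))) :=
      ((by fun_prop : Continuous fun t : ℝ => Real.exp (K * t)).tendsto a).mono_left
        nhdsWithin_le_nhds
    simpa [hφp] using h1.mul h2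
  have hle : (0 : ℝ) ≤ u t₂ := by
    refine le_of_tendsto hulim ?_
    filter_upwards [Ioo_mem_nhdsLT ht₂.2] with t ht
    exact hanti ht₂ ⟨ht₂.1.trans ht.1, ht.2⟩ ht.1.le
  have hneg : u t₂ < 0 :=
    mul_neg_of_neg_of_pos ((hnear t₂ ht₂).2.2.1 (hγ t₂ (hnear t₂ ht₂).1).1) (Real.exp_pos _)
  linarith

/-- A compactly supported `C¹` field that agrees with `b` near a given compact set. -/
lemma exists_hasCompactSupport_eventuallyEq (hΩ : IsOpen Ω) (hb : ContDiffOn ℝ 1 b Ω)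
    {K : Set (E d)} (hK : IsCompact K) (hKΩ : K ⊆ Ω) :
    ∃ β : E d → E d, ContDiff ℝ 1 β ∧ HasCompactSupport β ∧ ∀ᶠ x in 𝓝ˢ K, β x = b x := by
  obtain ⟨L, hL, hKL, hLΩ⟩ := exists_compact_between hK hΩ hKΩ
  obtain ⟨χ, hχ1, hχ0, -⟩ := exists_contMDiffMap_one_nhds_of_subset_interior
    (n := 1) (modelWithCornersSelf ℝ (E d)) hK.isClosed hKL
  have hχs : ContDiff ℝ 1 χ := χ.contMDiff.contDiff
  refine ⟨fun x => χ x • b x, contDiff_iff_contDiffAt.2 fun x => ?_, ?_, ?_⟩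
  · by_cases hx : x ∈ Ω
    · exact hχs.contDiffAt.smul (hb.contDiffAt (hΩ.mem_nhds hx))
    · have : (fun x => χ x • b x) =ᶠ[𝓝 x] fun _ => 0 := by
        filter_upwards [hL.isClosed.isOpen_compl.mem_nhds fun h => hx (hLΩ h)] with y hy
        rw [hχ0 y hy, zero_smul]
      exact contDiffAt_const.congr_of_eventuallyEq this
  · refine HasCompactSupport.intro hL fun x hx => ?_
    rw [hχ0 x hx, zero_smul]
  · filter_upwards [hχ1] with x hx
    rw [hx, one_smul]

lemma exists_hasDerivAt_of_hasCompactSupport {β : E d → E d} (hβ : ContDiff ℝ 1 β)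
    (hβc : HasCompactSupport β) (x : E d) {T : ℝ} (hT : 0 < T) :
    ∃ γ : ℝ → E d, γ 0 = x ∧ ∀ t ∈ Ioo (-T) T, HasDerivAt γ (β (γ t)) t := by
  obtain ⟨K, hK⟩ := hβ.lipschitzWith_of_hasCompactSupport hβc one_ne_zero
  obtain ⟨L, hL⟩ := hβc.exists_bound_of_continuous hβ.continuous
  have hL0 : 0 ≤ L := (norm_nonneg _).trans (hL x)
  have hPL : IsPicardLindelof (fun _ => β) (tmin := -T) (tmax := T) ⟨0, by simp [hT.le]⟩ x
      (⟨L, hL0⟩ * ⟨T, hT.le⟩) 0 ⟨L, hL0⟩ K := by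
    refine IsPicardLindelof.of_time_independent (fun y _ => hL y) hK.lipschitzOnWith ?_
    simp only [sub_zero, zero_sub, neg_neg, max_self, NNReal.coe_zero]
    exact le_rfl
  obtain ⟨γ, hγ0, hγ⟩ := hPL.exists_eq_forall_mem_Icc_hasDerivWithinAt₀
  exact ⟨γ, hγ0, fun t ht => (hγ t (Ioo_subset_Icc_self ht)).hasDerivAt (Icc_mem_nhds ht.1 ht.2)⟩

/-- Trajectories from the same point on symmetric time intervals can be glued. -/
lemma exists_glued (hΩ : IsOpen Ω) (hb : ContDiffOn ℝ 1 b Ω) {x : E d} {S : Set ℝ}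
    (hS : ∀ a ∈ S, ∃ γ : ℝ → E d, γ 0 = x ∧
      ∀ t ∈ Ioo (-a) a, γ t ∈ Ω ∧ HasDerivAt γ (b (γ t)) t) :
    ∃ γ : ℝ → E d, γ 0 = x ∧ ∀ a ∈ S, ∀ t ∈ Ioo (-a) a, γ t ∈ Ω ∧ HasDerivAt γ (b (γ t)) t := by
  classical
  choose! η hη0 hη using hS
  set γ : ℝ → E d := fun t => if h : ∃ a ∈ S, |t| < a then η h.choose t else x with hγ
  have heq : ∀ a ∈ S, EqOn γ (η a) (Ioo (-a) a) := by
    intro a ha t ht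
    have hex : ∃ a ∈ S, |t| < a := ⟨a, ha, abs_lt.2 ht⟩
    have hc := hex.choose_spec
    simp only [hγ, dif_pos hex]
    set c := hex.choose
    have htm : t ∈ Ioo (-min a c) (min a c) := abs_lt.1 (lt_min (abs_lt.2 ht) hc.2)
    have hpos : 0 < min a c := (abs_nonneg t).trans_lt (abs_lt.2 htm)
    refine eqOn_of_hasDerivAt hΩ hb isOpen_Ioo isPreconnected_Ioo (t₀ := 0) ⟨by linarith, hpos⟩
      (fun s hs => hη c hc.1 s
        ⟨by linarith [hs.1, min_le_right a c], hs.2.trans_le (min_le_right _ _)⟩)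
      (fun s hs => hη a ha s ⟨by linarith [hs.1, min_le_left a c], hs.2.trans_le (min_le_left _ _)⟩)
      (by rw [hη0 c hc.1, hη0 a ha]) htm
  refine ⟨γ, ?_, fun a ha t ht => ?_⟩
  · by_cases h : ∃ a ∈ S, |(0 : ℝ)| < a
    · simp only [hγ, dif_pos h]
      exact hη0 _ h.choose_spec.1
    · simp only [hγ, dif_neg h]
  · have h1 := hη a ha t ht
    rw [heq a ha ht]
    refine ⟨h1.1, h1.2.congr_of_eventuallyEq ?_⟩
    filter_upwards [isOpen_Ioo.mem_nhds ht] with s hs using heq a ha hs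

/-- A trajectory on a bounded time interval that is relatively compact in `Ω` can be continued. -/
lemma exists_extension (hΩ : IsOpen Ω) (hb : ContDiffOn ℝ 1 b Ω) {γ : ℝ → E d} {a : ℝ}
    (ha : 0 < a) (hγ : ∀ t ∈ Ioo (-a) a, γ t ∈ Ω ∧ HasDerivAt γ (b (γ t)) t) {K : Set (E d)}
    (hK : IsCompact K) (hKΩ : K ⊆ Ω) (hγK : ∀ t ∈ Ioo (-a) a, γ t ∈ K) :
    ∃ c > a, ∃ η : ℝ → E d, η 0 = γ 0 ∧
      ∀ t ∈ Ioo (-c) c, η t ∈ Ω ∧ HasDerivAt η (b (η t)) t := by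
  obtain ⟨β, hβ, hβc, hβb⟩ := exists_hasCompactSupport_eventuallyEq hΩ hb hK hKΩ
  obtain ⟨W, hW, hKW, hWβ⟩ := eventually_nhdsSet_iff_exists.1 hβb
  obtain ⟨η, hη0, hη⟩ := exists_hasDerivAt_of_hasCompactSupport hβ hβc (γ 0)
    (show (0 : ℝ) < 2 * a by linarith)
  have heq : EqOn η γ (Ioo (-a) a) := by
    refine eqOn_of_hasDerivAt isOpen_univ hβ.contDiffOn isOpen_Ioo isPreconnected_Ioo (t₀ := 0)
      ⟨by linarith, ha⟩ (fun t ht => ⟨mem_univ _, hη t ⟨by linarith [ht.1], by linarith [ht.2]⟩⟩)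
      (fun t ht => ⟨mem_univ _, ?_⟩) hη0
    rw [hWβ _ (hKW (hγK t ht))]
    exact (hγ t ht).2
  have hηK : ∀ t ∈ Icc (-a) a, η t ∈ K := by
    intro t ht
    have hc : ContinuousWithinAt η (Ioo (-a) a) t :=
      (hη t ⟨by linarith [ht.1], by linarith [ht.2]⟩).continuousAt.continuousWithinAt
    have := hc.mem_closure (by rwa [closure_Ioo (by linarith)])
      (fun s hs => (heq hs) ▸ hγK s hs : MapsTo η (Ioo (-a) a) K)
    rwa [hK.isClosed.closure_eq] at this
  have hnear : ∀ t ∈ Icc (-a) a, ∀ᶠ s in 𝓝 t, η s ∈ W ∩ Ω := by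
    intro t ht
    exact (hη t ⟨by linarith [ht.1], by linarith [ht.2]⟩).continuousAt
      ((hW.inter hΩ).mem_nhds ⟨hKW (hηK t ht), hKΩ (hηK t ht)⟩)
  obtain ⟨δ₁, hδ₁, h₁⟩ := Metric.eventually_nhds_iff.1 (hnear a ⟨by linarith, le_rfl⟩)
  obtain ⟨δ₂, hδ₂, h₂⟩ := Metric.eventually_nhds_iff.1 (hnear (-a) ⟨le_rfl, by linarith⟩)
  set c := min (min (a + δ₁) (a + δ₂)) (2 * a) with hc
  have hc1 : c ≤ a + δ₁ := (min_le_left _ _).trans (min_le_left _ _)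
  have hc2 : c ≤ a + δ₂ := (min_le_left _ _).trans (min_le_right _ _)
  have hc3 : c ≤ 2 * a := min_le_right _ _
  refine ⟨c, lt_min (lt_min (by linarith) (by linarith)) (by linarith), η, hη0, fun t ht => ?_⟩
  have hmem : η t ∈ W ∩ Ω := by
    rcases le_or_gt t (-a) with h | h
    · refine h₂ ?_
      rw [Real.dist_eq, abs_lt]
      constructor <;> linarith [ht.1]
    rcases le_or_gt a t with h' | h'
    · refine h₁ ?_
      rw [Real.dist_eq, abs_lt]
      constructor <;> linarith [ht.2]
    · have := hηK t ⟨h.le, h'.le⟩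
      exact ⟨hKW this, hKΩ this⟩
  refine ⟨hmem.2, ?_⟩
  have h3 := hη t ⟨by linarith [ht.1], by linarith [ht.2]⟩
  rwa [hWβ _ hmem.1] at h3

/-- Every point of a domain with smooth boundary has a global trajectory of a tangent vector field
with bounded gradient. -/
theorem exists_global_trajectory (hΩ : IsOpen Ω) (hsm : HasSmoothBoundary Ω)
    (hb : ContDiffOn ℝ ∞ b (closure Ω))
    (htan : ∀ p ∈ frontier Ω, ∀ n, IsOutwardNormal Ω p n → inner ℝ (b p) n = 0) {C : ℝ}
    (hC : ∀ x ∈ Ω, ‖fderiv ℝ b x‖ ≤ C) {x : E d} (hx : x ∈ Ω) :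
    ∃ γ : ℝ → E d, γ 0 = x ∧ ∀ t, γ t ∈ Ω ∧ HasDerivAt γ (b (γ t)) t := by
  have hb1 : ContDiffOn ℝ 1 b Ω := (hb.mono subset_closure).of_le (by simp)
  have hd : DifferentiableOn ℝ b Ω := hb1.differentiableOn one_ne_zero
  set S : Set ℝ := {a | ∃ γ : ℝ → E d, γ 0 = x ∧
    ∀ t ∈ Ioo (-a) a, γ t ∈ Ω ∧ HasDerivAt γ (b (γ t)) t} with hS
  obtain ⟨γ, hγ0, hγ⟩ := exists_glued hΩ hb1 (S := S) fun a ha => ha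
  have hunb : ¬ BddAbove S := by
    intro hbdd
    have hSpos : ∃ a ∈ S, 0 < a := by
      obtain ⟨η, hη, ε, hε, hη'⟩ := (hb1.contDiffAt
        (hΩ.mem_nhds hx)).exists_forall_mem_closedBall_exists_eq_forall_mem_Ioo_hasDerivAt₀ 0
      have hc : ∀ᶠ t in 𝓝 (0 : ℝ), η t ∈ Ω := by
        refine (hη' 0 (by simp [hε])).continuousAt (hΩ.mem_nhds ?_)
        rwa [hη]
      obtain ⟨δ, hδ, hδΩ⟩ := Metric.eventually_nhds_iff.1 hc
      refine ⟨min δ ε, ⟨η, hη, fun t ht => ⟨hδΩ ?_, hη' t ?_⟩⟩, lt_min hδ hε⟩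
      · rw [Real.dist_eq, sub_zero]
        exact (abs_lt.2 ht).trans_le (min_le_left _ _)
      · have := abs_lt.1 ((abs_lt.2 ht).trans_le (min_le_right _ _))
        exact ⟨by linarith [this.1], by linarith [this.2]⟩
    obtain ⟨a₀, ha₀, ha₀pos⟩ := hSpos
    set a := sSup S with ha
    have hapos : 0 < a := ha₀pos.trans_le (le_csSup hbdd ha₀)
    have hγa : ∀ t ∈ Ioo (-a) a, γ t ∈ Ω ∧ HasDerivAt γ (b (γ t)) t := by
      intro t ht
      obtain ⟨c, hc, htc⟩ := exists_lt_of_lt_csSup ⟨a₀, ha₀⟩ (abs_lt.2 ht)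
      exact hγ c hc t (abs_lt.1 htc)
    obtain ⟨p, hp, hplim⟩ := exists_tendsto_right hΩ hsm hb.continuousOn hd htan hC hapos hγa
    obtain ⟨q, hq, hqlim⟩ := exists_tendsto_right (b := fun y => -b y) (γ := fun t => γ (-t)) hΩ hsm
      hb.continuousOn.neg hd.neg (fun p hp n hn => by rw [inner_neg_left, htan p hp n hn, neg_zero])
      (C := C) (fun y hy => by rw [fderiv_fun_neg, norm_neg]; exact hC y hy) hapos
      (fun t ht => by
        have h1 := hγa (-t) ⟨by linarith [ht.2], by linarith [ht.1]⟩
        refine ⟨h1.1, ?_⟩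
        simpa [Function.comp_def] using h1.2.scomp t (hasDerivAt_neg t))
    have hqlim' : Tendsto γ (𝓝[>] (-a)) (𝓝 q) := by
      have h1 : Tendsto (fun t : ℝ => -t) (𝓝[>] (-a)) (𝓝[<] a) := by
        simpa using tendsto_neg_nhdsGT (a := -a)
      simpa [Function.comp_def] using hqlim.comp h1
    -- extended to the end points of the interval, the trajectory has compact image
    set g : ℝ → E d := extendFrom (Ioo (-a) a) γ with hg
    have hlt : -a < a := by linarith
    have hgc : ContinuousOn g (Icc (-a) a) :=
      continuousOn_Icc_extendFrom_Ioo
        (fun t ht => (hγa t ht).2.continuousAt.continuousWithinAt) hqlim' hplim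
    have hgγ : ∀ t ∈ Ioo (-a) a, g t = γ t := fun t ht =>
      extendFrom_extends (fun s hs => (hγa s hs).2.continuousAt.continuousWithinAt) t ht
    have hga : g a = p := eq_lim_at_right_extendFrom_Ioo hlt hplim
    have hgna : g (-a) = q := eq_lim_at_left_extendFrom_Ioo hlt hqlim'
    obtain ⟨c, hc, η, hη0, hη⟩ := exists_extension hΩ hb1 hapos hγa
      (isCompact_Icc.image_of_continuousOn hgc)
      (by
        rintro _ ⟨t, ht, rfl⟩
        rcases ht.1.eq_or_lt with h | h
        · rw [← h, hgna]; exact hq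
        rcases ht.2.eq_or_lt with h' | h'
        · rw [h', hga]; exact hp
        · rw [hgγ t ⟨h, h'⟩]; exact (hγa t ⟨h, h'⟩).1)
      (fun t ht => ⟨t, Ioo_subset_Icc_self ht, hgγ t ht⟩)
    have : c ∈ S := ⟨η, hη0.trans hγ0, hη⟩
    linarith [le_csSup hbdd this]
  refine ⟨γ, hγ0, fun t => ?_⟩
  obtain ⟨a, ha, hta⟩ := not_bddAbove_iff.1 hunb |t|
  exact hγ a ha t (abs_lt.1 hta)

end Existence

/-! ### The flow of a velocity field and its Jacobian -/

section Flow

variable {d : ℕ} {𝒟 : Domain d} {U : Fin 2 → E d → ℝ} {b : E d → E d}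

lemma Domain.isOpen_pts (𝒟 : Domain d) : IsOpen 𝒟.pts := by
  cases 𝒟 with
  | euclidean Ω h _ _ => exact h
  | torus β => exact isOpen_univ

lemma Domain.hasSmoothBoundary_pts (𝒟 : Domain d) : HasSmoothBoundary 𝒟.pts := by
  cases 𝒟 with
  | euclidean Ω _ _ h => exact h
  | torus β =>
    intro p hp
    simp [Domain.pts] at hp

lemma contDiffOn_pts (hb : b ∈ velocityFields 𝒟) : ContDiffOn ℝ ∞ b 𝒟.pts :=
  hb.1.mono subset_closure

lemma contDiffOn_one_pts (hb : b ∈ velocityFields 𝒟) : ContDiffOn ℝ 1 b 𝒟.pts :=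
  (contDiffOn_pts hb).of_le (by simp)

lemma isGlobalFlow_flow (hb : b ∈ velocityFields 𝒟) : IsGlobalFlow b 𝒟.pts (flow 𝒟 b) := by
  have key : ∀ x ∈ 𝒟.pts, IsTrajectory 𝒟 b x (fun t => flow 𝒟 b t x) := by
    intro x hx
    obtain ⟨hb1, -, htan, C, hC⟩ := hb
    have hex : ∃ γ : ℝ → E d, IsTrajectory 𝒟 b x γ :=
      exists_global_trajectory 𝒟.isOpen_pts 𝒟.hasSmoothBoundary_pts hb1 htan hC hx
    have : (fun t => flow 𝒟 b t x) = hex.choose := by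
      funext t
      simp only [flow, dif_pos hex]
    rw [this]
    exact hex.choose_spec
  exact ⟨fun x hx => (key x hx).1, fun x hx t => ((key x hx).2 t).1,
    fun x hx t => ((key x hx).2 t).2⟩

lemma flow_zero (hb : b ∈ velocityFields 𝒟) {x : E d} (hx : x ∈ 𝒟.pts) : flow 𝒟 b 0 x = x :=
  (isGlobalFlow_flow hb).zero x hx

lemma flow_mem (hb : b ∈ velocityFields 𝒟) {x : E d} (hx : x ∈ 𝒟.pts) (t : ℝ) :
    flow 𝒟 b t x ∈ 𝒟.pts :=
  (isGlobalFlow_flow hb).mem x hx t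

lemma hasDerivAt_flow (hb : b ∈ velocityFields 𝒟) {x : E d} (hx : x ∈ 𝒟.pts) (t : ℝ) :
    HasDerivAt (fun s => flow 𝒟 b s x) (b (flow 𝒟 b t x)) t :=
  (isGlobalFlow_flow hb).deriv x hx t

lemma flow_add (hb : b ∈ velocityFields 𝒟) {x : E d} (hx : x ∈ 𝒟.pts) (t s : ℝ) :
    flow 𝒟 b (t + s) x = flow 𝒟 b t (flow 𝒟 b s x) :=
  (isGlobalFlow_flow hb).add 𝒟.isOpen_pts (contDiffOn_one_pts hb) hx t s

lemma flow_neg_flow (hb : b ∈ velocityFields 𝒟) {x : E d} (hx : x ∈ 𝒟.pts) (t : ℝ) :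
    flow 𝒟 b (-t) (flow 𝒟 b t x) = x := by
  rw [← flow_add hb hx, neg_add_cancel, flow_zero hb hx]

lemma flow_flow_neg (hb : b ∈ velocityFields 𝒟) {x : E d} (hx : x ∈ 𝒟.pts) (t : ℝ) :
    flow 𝒟 b t (flow 𝒟 b (-t) x) = x := by
  rw [← flow_add hb hx, add_neg_cancel, flow_zero hb hx]

lemma contDiffAt_flow (hb : b ∈ velocityFields 𝒟) {x : E d} (hx : x ∈ 𝒟.pts) (t : ℝ) :
    ContDiffAt ℝ 1 (fun p : ℝ × E d => flow 𝒟 b p.1 p.2) (t, x) :=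
  (isGlobalFlow_flow hb).contDiffAt 𝒟.isOpen_pts ((contDiffOn_pts hb).of_le (by norm_cast)) hx t

lemma isOpen_univ_prod_pts (𝒟 : Domain d) : IsOpen ((univ : Set ℝ) ×ˢ 𝒟.pts) :=
  isOpen_univ.prod 𝒟.isOpen_pts

lemma continuousOn_flow (hb : b ∈ velocityFields 𝒟) :
    ContinuousOn (fun p : ℝ × E d => flow 𝒟 b p.1 p.2) (univ ×ˢ 𝒟.pts) :=
  fun p hp => (contDiffAt_flow hb hp.2 p.1).continuousAt.continuousWithinAt

lemma continuousAt_flow (hb : b ∈ velocityFields 𝒟) {x : E d} (hx : x ∈ 𝒟.pts) (t : ℝ) :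
    ContinuousAt (fun p : ℝ × E d => flow 𝒟 b p.1 p.2) (t, x) :=
  (contDiffAt_flow hb hx t).continuousAt

lemma continuous_flow_time (hb : b ∈ velocityFields 𝒟) {x : E d} (hx : x ∈ 𝒟.pts) :
    Continuous fun t => flow 𝒟 b t x :=
  (isGlobalFlow_flow hb).continuous_time hx

lemma continuousOn_flow_space (hb : b ∈ velocityFields 𝒟) (t : ℝ) :
    ContinuousOn (flow 𝒟 b t) 𝒟.pts := fun x hx =>
  (ContinuousAt.comp (x := x) (g := fun p : ℝ × E d => flow 𝒟 b p.1 p.2) (f := fun y => (t, y))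
    (continuousAt_flow hb hx t) (by fun_prop)).continuousWithinAt

lemma differentiableAt_flow (hb : b ∈ velocityFields 𝒟) {x : E d} (hx : x ∈ 𝒟.pts) (t : ℝ) :
    DifferentiableAt ℝ (flow 𝒟 b t) x :=
  DifferentiableAt.comp x (g := fun p : ℝ × E d => flow 𝒟 b p.1 p.2) (f := fun y => (t, y))
    ((contDiffAt_flow hb hx t).differentiableAt one_ne_zero) (by fun_prop)

lemma image_flow (hb : b ∈ velocityFields 𝒟) (t : ℝ) : flow 𝒟 b t '' 𝒟.pts = 𝒟.pts := by
  refine Subset.antisymm ?_ fun y hy => ⟨flow 𝒟 b (-t) y, flow_mem hb hy _, flow_flow_neg hb hy t⟩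
  rintro _ ⟨x, hx, rfl⟩
  exact flow_mem hb hx t

lemma injOn_flow (hb : b ∈ velocityFields 𝒟) (t : ℝ) : InjOn (flow 𝒟 b t) 𝒟.pts := by
  intro x hx y hy hxy
  rw [← flow_neg_flow hb hx t, hxy, flow_neg_flow hb hy t]

lemma fderiv_flow_add (hb : b ∈ velocityFields 𝒟) {x : E d} (hx : x ∈ 𝒟.pts) (t s : ℝ) :
    fderiv ℝ (flow 𝒟 b (t + s)) x =
      (fderiv ℝ (flow 𝒟 b t) (flow 𝒟 b s x)).comp (fderiv ℝ (flow 𝒟 b s) x) := by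
  rw [← fderiv_comp x (differentiableAt_flow hb (flow_mem hb hx s) t)
    (differentiableAt_flow hb hx s)]
  refine Filter.EventuallyEq.fderiv_eq ?_
  filter_upwards [𝒟.isOpen_pts.mem_nhds hx] with y hy using flow_add hb hy t s

lemma jac_add (hb : b ∈ velocityFields 𝒟) {x : E d} (hx : x ∈ 𝒟.pts) (t s : ℝ) :
    jac 𝒟 b (t + s) x = jac 𝒟 b t (flow 𝒟 b s x) * jac 𝒟 b s x := by
  simp only [jac]
  rw [← abs_mul, show (fun y => flow 𝒟 b (t + s) y) = flow 𝒟 b (t + s) from rfl,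
    fderiv_flow_add hb hx]
  exact congrArg abs (LinearMap.det_comp _ _)

lemma jac_zero (hb : b ∈ velocityFields 𝒟) {x : E d} (hx : x ∈ 𝒟.pts) : jac 𝒟 b 0 x = 1 := by
  have : fderiv ℝ (fun y => flow 𝒟 b 0 y) x = ContinuousLinearMap.id ℝ (E d) := by
    rw [← fderiv_id (𝕜 := ℝ) (x := x)]
    refine Filter.EventuallyEq.fderiv_eq ?_
    filter_upwards [𝒟.isOpen_pts.mem_nhds hx] with y hy using flow_zero hb hy
  rw [jac, this, ContinuousLinearMap.det, ContinuousLinearMap.coe_id, LinearMap.det_id, abs_one]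

lemma jac_pos (hb : b ∈ velocityFields 𝒟) {x : E d} (hx : x ∈ 𝒟.pts) (t : ℝ) :
    0 < jac 𝒟 b t x := by
  refine (abs_nonneg _).lt_of_ne fun h => ?_
  have h1 := jac_add hb hx (-t) t
  rw [neg_add_cancel, jac_zero hb hx, show jac 𝒟 b t x = 0 from h.symm, mul_zero] at h1
  exact one_ne_zero h1

lemma continuousOn_jac (hb : b ∈ velocityFields 𝒟) :
    ContinuousOn (fun p : ℝ × E d => jac 𝒟 b p.1 p.2) (univ ×ˢ 𝒟.pts) := by
  have hc : ContDiffOn ℝ 1 (fun p : ℝ × E d => flow 𝒟 b p.1 p.2) (univ ×ˢ 𝒟.pts) :=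
    fun p hp => (contDiffAt_flow hb hp.2 p.1).contDiffWithinAt
  have h1 := hc.continuousOn_fderiv_of_isOpen (isOpen_univ_prod_pts 𝒟) le_rfl
  have h2 : ContinuousOn (fun p : ℝ × E d => |((fderiv ℝ
      (fun p : ℝ × E d => flow 𝒟 b p.1 p.2) p).comp
      (ContinuousLinearMap.inr ℝ ℝ (E d))).det|) (univ ×ˢ 𝒟.pts) :=
    (ContinuousLinearMap.continuous_det.comp_continuousOn (h1.clm_comp continuousOn_const)).abs
  refine h2.congr fun p hp => ?_
  have h3 : HasFDerivAt (fun y : E d => ((p.1, y) : ℝ × E d))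
      (ContinuousLinearMap.inr ℝ ℝ (E d)) p.2 :=
    hasFDerivAt_prodMk_right p.1 p.2
  have h4 := ((contDiffAt_flow hb hp.2 p.1).differentiableAt one_ne_zero).hasFDerivAt.comp p.2 h3
  simp only [jac]
  rw [← h4.fderiv]
  rfl

lemma F_pos (hb : b ∈ velocityFields 𝒟) {x : E d} (hx : x ∈ 𝒟.pts) (k : Fin 2) (t : ℝ) :
    0 < F 𝒟 U b k t x :=
  mul_pos (Real.exp_pos _) (jac_pos hb hx t)

lemma F_zero (hb : b ∈ velocityFields 𝒟) {x : E d} (hx : x ∈ 𝒟.pts) (k : Fin 2) :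
    F 𝒟 U b k 0 x = Real.exp (-U k x) := by
  rw [F, jac_zero hb hx, flow_zero hb hx, mul_one]

/-- The cocycle property of the weights. -/
lemma F_add (hb : b ∈ velocityFields 𝒟) {x : E d} (hx : x ∈ 𝒟.pts) (k : Fin 2) (t s : ℝ) :
    F 𝒟 U b k (t + s) x = F 𝒟 U b k t (flow 𝒟 b s x) * jac 𝒟 b s x := by
  rw [F, F, jac_add hb hx, flow_add hb hx, mul_assoc]

lemma continuousOn_F (hU : ∀ k, ContinuousOn (U k) 𝒟.pts) (hb : b ∈ velocityFields 𝒟)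
    (k : Fin 2) : ContinuousOn (fun p : ℝ × E d => F 𝒟 U b k p.1 p.2) (univ ×ˢ 𝒟.pts) := by
  refine ContinuousOn.mul (Real.continuous_exp.comp_continuousOn ?_) (continuousOn_jac hb)
  exact ((hU k).comp (continuousOn_flow hb) fun p hp => flow_mem hb hp.2 _).neg

lemma continuous_F_time (hU : ∀ k, ContinuousOn (U k) 𝒟.pts) (hb : b ∈ velocityFields 𝒟)
    (k : Fin 2) {x : E d} (hx : x ∈ 𝒟.pts) : Continuous fun t => F 𝒟 U b k t x :=
  (continuousOn_F hU hb k).comp_continuous (by fun_prop : Continuous fun t : ℝ => (t, x))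
    fun t => ⟨mem_univ _, hx⟩

/-- If two velocity fields agree off a closed set `K` which the trajectory of `x` avoids up to time
`t`, then their flows at time `t` agree near `x`. -/
lemma eventually_flow_eq {b' : E d → E d} (hb : b ∈ velocityFields 𝒟) (hb' : b' ∈ velocityFields 𝒟)
    {K : Set (E d)} (hK : IsClosed K) (hbK : ∀ x ∉ K, b' x = b x) {x : E d} (hx : x ∈ 𝒟.pts) {t : ℝ}
    (ht : ∀ s ∈ uIcc 0 t, flow 𝒟 b s x ∉ K) :
    ∀ᶠ z in 𝓝 x, flow 𝒟 b' t z = flow 𝒟 b t z := by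
  have hN : ∀ᶠ z in 𝓝 x, ∀ s ∈ uIcc 0 t, flow 𝒟 b s z ∉ K := by
    refine isCompact_uIcc.eventually_forall_of_forall_eventually fun s hs => ?_
    have hc : ContinuousAt (fun p : E d × ℝ => flow 𝒟 b p.2 p.1) (x, s) :=
      ContinuousAt.comp (x := (x, s)) (g := fun p : ℝ × E d => flow 𝒟 b p.1 p.2)
        (f := fun p : E d × ℝ => (p.2, p.1)) (continuousAt_flow hb hx s) (by fun_prop)
    exact hc (hK.isOpen_compl.mem_nhds (ht s hs))
  filter_upwards [hN, 𝒟.isOpen_pts.mem_nhds hx] with z hz hzp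
  have hopen : IsOpen {s : ℝ | flow 𝒟 b s z ∉ K} :=
    hK.isOpen_compl.preimage (continuous_flow_time hb hzp)
  have hsub : uIcc 0 t ⊆ connectedComponentIn {s : ℝ | flow 𝒟 b s z ∉ K} 0 :=
    (isPreconnected_uIcc).subset_connectedComponentIn left_mem_uIcc hz
  refine (eqOn_of_hasDerivAt 𝒟.isOpen_pts (contDiffOn_one_pts hb')
    hopen.connectedComponentIn isPreconnected_connectedComponentIn (hsub left_mem_uIcc)
    (γ := fun s => flow 𝒟 b' s z) (η := fun s => flow 𝒟 b s z)
    (fun s _ => ⟨flow_mem hb' hzp s, hasDerivAt_flow hb' hzp s⟩) (fun s hs =>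
      ⟨flow_mem hb hzp s, ?_⟩) ?_) (hsub right_mem_uIcc)
  · rw [hbK _ (connectedComponentIn_subset _ _ hs)]
    exact hasDerivAt_flow hb hzp s
  · simp only [flow_zero hb hzp, flow_zero hb' hzp]

lemma flow_eq_of_avoid {b' : E d → E d} (hb : b ∈ velocityFields 𝒟) (hb' : b' ∈ velocityFields 𝒟)
    {K : Set (E d)} (hK : IsClosed K) (hbK : ∀ x ∉ K, b' x = b x) {x : E d} (hx : x ∈ 𝒟.pts) {t : ℝ}
    (ht : ∀ s ∈ uIcc 0 t, flow 𝒟 b s x ∉ K) : flow 𝒟 b' t x = flow 𝒟 b t x :=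
  (eventually_flow_eq hb hb' hK hbK hx ht).self_of_nhds

/-- The Jacobian, which enters the weight, involves the flow from nearby points as well; it is for
its sake that `eventually_flow_eq` holds near `x`. -/
lemma F_eq_of_avoid {b' : E d → E d} (hb : b ∈ velocityFields 𝒟) (hb' : b' ∈ velocityFields 𝒟)
    {K : Set (E d)} (hK : IsClosed K) (hbK : ∀ x ∉ K, b' x = b x) {x : E d} (hx : x ∈ 𝒟.pts) {t : ℝ}
    (ht : ∀ s ∈ uIcc 0 t, flow 𝒟 b s x ∉ K) (k : Fin 2) : F 𝒟 U b' k t x = F 𝒟 U b k t x := by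
  have h := eventually_flow_eq hb hb' hK hbK hx ht
  rw [F, F, h.self_of_nhds, jac, jac, Filter.EventuallyEq.fderiv_eq h]

/-- Joint continuity of the flow of `b + ε w` in the time, the initial point and `ε`: the parameter
is treated as an additional, constant, coordinate of the state. -/
lemma continuousAt_flow_param {w : E d → E d} (hw : ContDiff ℝ ∞ w)
    (hb : ∀ ε : ℝ, b + ε • w ∈ velocityFields 𝒟) {x : E d} (hx : x ∈ 𝒟.pts) (t ε : ℝ) :
    ContinuousAt (fun p : ℝ × E d × ℝ => flow 𝒟 (b + p.2.2 • w) p.1 p.2.1) (t, x, ε) := by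
  have hb0 : ContDiffOn ℝ ∞ b 𝒟.pts := by simpa using contDiffOn_pts (hb 0)
  have hΦ : IsGlobalFlow (fun q : E d × ℝ => (b q.1 + q.2 • w q.1, (0 : ℝ))) (𝒟.pts ×ˢ univ)
      (fun t q => (flow 𝒟 (b + q.2 • w) t q.1, q.2)) := by
    refine ⟨fun q hq => ?_, fun q hq t => ⟨flow_mem (hb _) hq.1 t, mem_univ _⟩, fun q hq t => ?_⟩
    · rw [flow_zero (hb _) hq.1]
    · exact (hasDerivAt_flow (hb q.2) hq.1 t).prodMk (hasDerivAt_const t q.2)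
  have hβ : ContDiffOn ℝ 2 (fun q : E d × ℝ => (b q.1 + q.2 • w q.1, (0 : ℝ))) (𝒟.pts ×ˢ univ) := by
    have : ContDiffOn ℝ ∞ (fun q : E d × ℝ => (b q.1 + q.2 • w q.1, (0 : ℝ))) (𝒟.pts ×ˢ univ) := by
      refine ContDiffOn.prodMk (ContDiffOn.add (hb0.comp contDiffOn_fst fun q hq => hq.1) ?_)
        contDiffOn_const
      exact contDiffOn_snd.smul (hw.comp_contDiffOn contDiffOn_fst)
    exact this.of_le (by norm_cast)
  exact continuousAt_fst.comp
    (hΦ.contDiffAt (𝒟.isOpen_pts.prod isOpen_univ) hβ (x := (x, ε)) ⟨hx, mem_univ _⟩ t).continuousAt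

end Flow

/-! ### Infinite-time integrals along the flow, and properness -/

section Properness

lemma setIntegral_Ioi_comp_add_right (f : ℝ → ℝ) (t : ℝ) :
    ∫ s in Ioi 0, f (s + t) = ∫ s in Ioi t, f s := by
  have := (measurePreserving_add_right volume t).setIntegral_preimage_emb
    (measurableEmbedding_addRight t) f (Ioi t)
  simpa using this

lemma integrableOn_Ioi_comp_add_right_iff (f : ℝ → ℝ) (t : ℝ) :
    IntegrableOn (fun s => f (s + t)) (Ioi 0) ↔ IntegrableOn f (Ioi t) := by
  have := (measurePreserving_add_right volume t).integrableOn_comp_preimage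
    (measurableEmbedding_addRight t) (f := f) (s := Ioi t)
  simpa [Function.comp_def] using this

variable {d : ℕ} {𝒟 : Domain d} {U : Fin 2 → E d → ℝ} {b : E d → E d}

/-- At every point of the domain, the integrals of `F^{(k)}` over the past and over the future are
finite, and they depend continuously on the point. This is the condition that `℧(b)` is the whole
domain, in a form that does not mention neighbourhoods. -/
structure HasContinuousIntegrals (𝒟 : Domain d) (U : Fin 2 → E d → ℝ) (b : E d → E d) : Prop where
  integrable : ∀ k, ∀ x ∈ 𝒟.pts, Integrable fun t => F 𝒟 U b k t x
  continuousOn_Ioi : ∀ k, ContinuousOn (fun z => ∫ t in Ioi 0, F 𝒟 U b k t z) 𝒟.pts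
  continuousOn_Iio : ∀ k, ContinuousOn (fun z => ∫ t in Iio 0, F 𝒟 U b k t z) 𝒟.pts

lemma integrable_of_Ioi_of_Iio {f : ℝ → ℝ} (h1 : IntegrableOn f (Ioi 0))
    (h2 : IntegrableOn f (Iio 0)) :
    Integrable f := by
  rw [← integrableOn_univ, ← Iio_union_Ici (a := (0 : ℝ))]
  exact h2.union (by rwa [integrableOn_Ici_iff_integrableOn_Ioi])

lemma integrable_of_mem_mho {x : E d} (hx : x ∈ mho 𝒟 U b) (k : Fin 2) :
    Integrable fun t => F 𝒟 U b k t x := by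
  obtain ⟨-, V, hV, -, h⟩ := hx
  exact integrable_of_Ioi_of_Iio ((h k).1 x (mem_of_mem_nhds hV)) ((h k).2.1 x (mem_of_mem_nhds hV))

lemma hasContinuousIntegrals_of_mho_eq (h : mho 𝒟 U b = 𝒟.pts) : HasContinuousIntegrals 𝒟 U b := by
  refine ⟨fun k x hx => integrable_of_mem_mho (h ▸ hx) k, fun k x hx => ?_, fun k x hx => ?_⟩
  all_goals
    rw [← h] at hx
    obtain ⟨-, V, hV, -, hk⟩ := hx
  · exact ((hk k).2.2.1.continuousAt hV).continuousWithinAt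
  · exact ((hk k).2.2.2.continuousAt hV).continuousWithinAt

lemma HasContinuousIntegrals.mho_eq (h : HasContinuousIntegrals 𝒟 U b) : mho 𝒟 U b = 𝒟.pts :=
  Subset.antisymm (fun _ hx => hx.1) fun _ hx => ⟨hx, 𝒟.pts, 𝒟.isOpen_pts.mem_nhds hx, subset_rfl,
    fun k => ⟨fun z hz => (h.integrable k z hz).integrableOn,
      fun z hz => (h.integrable k z hz).integrableOn, h.continuousOn_Ioi k, h.continuousOn_Iio k⟩⟩

lemma integral_eq_Iio_add_Ioi {f : ℝ → ℝ} (hf : Integrable f) :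
    ∫ t, f t = (∫ t in Iio 0, f t) + ∫ t in Ioi 0, f t := by
  rw [← integral_Ici_eq_integral_Ioi,
    ← setIntegral_union (by simp [Set.disjoint_left]) measurableSet_Ici
      hf.integrableOn hf.integrableOn,
    Iio_union_Ici, setIntegral_univ]

lemma HasContinuousIntegrals.continuousOn_integral (h : HasContinuousIntegrals 𝒟 U b) (k : Fin 2) :
    ContinuousOn (fun z => ∫ t, F 𝒟 U b k t z) 𝒟.pts :=
  ((h.continuousOn_Iio k).add (h.continuousOn_Ioi k)).congr fun z hz =>
    integral_eq_Iio_add_Ioi (h.integrable k z hz)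

lemma setIntegral_F_pos (hb : b ∈ velocityFields 𝒟) {x : E d} (hx : x ∈ 𝒟.pts) {k : Fin 2}
    {s : Set ℝ} (hi : IntegrableOn (fun t => F 𝒟 U b k t x) s) (hs : 0 < volume s) :
    0 < ∫ t in s, F 𝒟 U b k t x := by
  rw [setIntegral_pos_iff_support_of_nonneg_ae
    (Eventually.of_forall fun t => (F_pos hb hx k t).le) hi]
  have : Function.support (fun t => F 𝒟 U b k t x) = univ :=
    eq_univ_of_forall fun t => (F_pos hb hx k t).ne'
  rwa [this, univ_inter]

lemma integral_F_pos (hb : b ∈ velocityFields 𝒟) {x : E d} (hx : x ∈ 𝒟.pts) {k : Fin 2}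
    (hi : Integrable fun t => F 𝒟 U b k t x) : 0 < ∫ t, F 𝒟 U b k t x := by
  rw [← setIntegral_univ]
  exact setIntegral_F_pos hb hx hi.integrableOn (by simp)

/-- Moving along the trajectory scales the total weight by the Jacobian. -/
lemma integral_F_flow (hb : b ∈ velocityFields 𝒟) {x : E d} (hx : x ∈ 𝒟.pts) (k : Fin 2) (t : ℝ) :
    (∫ s, F 𝒟 U b k s (flow 𝒟 b t x)) * jac 𝒟 b t x = ∫ s, F 𝒟 U b k s x := by
  rw [← integral_add_right_eq_self (fun s => F 𝒟 U b k s x) t, ← integral_mul_const]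
  simp only [F_add hb hx]

lemma setIntegral_Ioi_F_flow (hb : b ∈ velocityFields 𝒟) {x : E d} (hx : x ∈ 𝒟.pts) (k : Fin 2)
    (t : ℝ) : (∫ s in Ioi 0, F 𝒟 U b k s (flow 𝒟 b t x)) * jac 𝒟 b t x =
      ∫ s in Ioi t, F 𝒟 U b k s x := by
  rw [← setIntegral_Ioi_comp_add_right (fun s => F 𝒟 U b k s x) t, ← integral_mul_const]
  simp only [F_add hb hx]

/-- The estimator is constant along trajectories. -/
lemma estimator_flow (hb : b ∈ velocityFields 𝒟) {x : E d} (hx : x ∈ 𝒟.pts) (t : ℝ) :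
    estimator 𝒟 U b (flow 𝒟 b t x) = estimator 𝒟 U b x := by
  rw [estimator, estimator, ← integral_F_flow hb hx 0 t, ← integral_F_flow hb hx 1 t,
    mul_div_mul_right _ _ (jac_pos hb hx t).ne']

lemma estimator_nonneg (hb : b ∈ velocityFields 𝒟) {x : E d} (hx : x ∈ 𝒟.pts) :
    0 ≤ estimator 𝒟 U b x :=
  div_nonneg (integral_nonneg fun t => (F_pos hb hx 1 t).le)
    (integral_nonneg fun t => (F_pos hb hx 0 t).le)

lemma HasContinuousIntegrals.continuousOn_estimator (h : HasContinuousIntegrals 𝒟 U b)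
    (hb : b ∈ velocityFields 𝒟) : ContinuousOn (estimator 𝒟 U b) 𝒟.pts :=
  (h.continuousOn_integral 1).div (h.continuousOn_integral 0) fun x hx =>
    (integral_F_pos hb hx (h.integrable 0 x hx)).ne'

lemma continuousOn_jac_space (hb : b ∈ velocityFields 𝒟) (t : ℝ) :
    ContinuousOn (jac 𝒟 b t) 𝒟.pts :=
  (continuousOn_jac hb).comp (f := fun x => (t, x)) (by fun_prop) fun _ hx => ⟨mem_univ _, hx⟩

/-- The total weights of trajectories being finite and continuous makes the flow proper: a compact
set is carried off itself by all large times. If `x` and `y = X_t x` are both in `K`, then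
`J_t x = G x / G y` is bounded below, where `G` is the total weight, and hence so is the tail
`∫_t^∞ F_s x ds`, which is `J_t x` times the future weight of `y`; but by Dini's argument the tails
go to zero uniformly on `K`. -/
theorem HasContinuousIntegrals.exists_flow_notMem (h : HasContinuousIntegrals 𝒟 U b)
    (hb : b ∈ velocityFields 𝒟) {K : Set (E d)} (hK : IsCompact K) (hKp : K ⊆ 𝒟.pts) :
    ∃ T > 0, ∀ x ∈ K, ∀ t, T ≤ |t| → flow 𝒟 b t x ∉ K := by
  rcases K.eq_empty_or_nonempty with rfl | hne
  · exact ⟨1, one_pos, fun x hx => absurd hx (notMem_empty x)⟩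
  obtain ⟨x₁, hx₁, hm⟩ := hK.exists_isMinOn hne ((h.continuousOn_integral 0).mono hKp)
  obtain ⟨x₂, hx₂, hM⟩ := hK.exists_isMaxOn hne ((h.continuousOn_integral 0).mono hKp)
  obtain ⟨x₃, hx₃, hβ⟩ := hK.exists_isMinOn hne ((h.continuousOn_Ioi 0).mono hKp)
  have hm0 := integral_F_pos (U := U) hb (hKp hx₁) (h.integrable 0 x₁ (hKp hx₁))
  have hM0 := integral_F_pos (U := U) hb (hKp hx₂) (h.integrable 0 x₂ (hKp hx₂))
  have hβ0 := setIntegral_F_pos (U := U) hb (hKp hx₃) (h.integrable 0 x₃ (hKp hx₃)).integrableOn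
    (s := Ioi 0) (by simp)
  set m := ∫ t, F 𝒟 U b 0 t x₁
  set M := ∫ t, F 𝒟 U b 0 t x₂
  set β := ∫ t in Ioi 0, F 𝒟 U b 0 t x₃
  have hmono : ∀ x ∈ 𝒟.pts, ∀ r s : ℝ, r ≤ s →
      ∫ t in Ioi s, F 𝒟 U b 0 t x ≤ ∫ t in Ioi r, F 𝒟 U b 0 t x := by
    intro x hx r s hrs
    exact setIntegral_mono_set (h.integrable 0 x hx).integrableOn
      (Eventually.of_forall fun t => (F_pos hb hx 0 t).le) (Ioi_subset_Ioi hrs).eventuallyLE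
  -- the tails are uniformly small on `K`
  obtain ⟨n, hn⟩ : ∃ n : ℕ, ∀ x ∈ K, ∫ t in Ioi (n : ℝ), F 𝒟 U b 0 t x < m / M * β := by
    have hc : 0 < m / M * β := by positivity
    suffices ∃ n : ℕ, ∀ x ∈ K, x ∈ K → ∫ t in Ioi (n : ℝ), F 𝒟 U b 0 t x < m / M * β from
      this.imp fun n hn x hx => hn x hx hx
    refine hK.induction_on (p := fun s => ∃ n : ℕ, ∀ x ∈ s, x ∈ K →
      ∫ t in Ioi (n : ℝ), F 𝒟 U b 0 t x < m / M * β) ⟨0, by simp⟩ ?_ ?_ ?_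
    · rintro s t hst ⟨n, hn⟩
      exact ⟨n, fun x hx => hn x (hst hx)⟩
    · rintro s t ⟨n, hn⟩ ⟨n', hn'⟩
      refine ⟨max n n', fun x hx hxK => ?_⟩
      rcases hx with hx | hx
      · exact (hmono x (hKp hxK) _ _ (by simp)).trans_lt (hn x hx hxK)
      · exact (hmono x (hKp hxK) _ _ (by simp)).trans_lt (hn' x hx hxK)
    · intro x hx
      have hlim : Tendsto (fun n : ℕ => ∫ t in Ioi (n : ℝ), F 𝒟 U b 0 t x) atTop (𝓝 0) := by
        have h1 := tendsto_setIntegral_of_antitone (μ := volume) (s := fun n : ℕ => Ioi (n : ℝ))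
          (f := fun t => F 𝒟 U b 0 t x) (fun _ => measurableSet_Ioi)
          (fun i j hij => Ioi_subset_Ioi (by exact_mod_cast hij))
          ⟨0, (h.integrable 0 x (hKp hx)).integrableOn⟩
        have h2 : ⋂ n : ℕ, Ioi (n : ℝ) = ∅ := by
          refine eq_empty_of_forall_notMem fun t ht => ?_
          obtain ⟨n, hn⟩ := exists_nat_ge t
          exact absurd (mem_iInter.1 ht n) (not_lt.2 hn)
        rwa [h2, setIntegral_empty] at h1
      obtain ⟨n, hn⟩ := (hlim.eventually_lt_const hc).exists
      have hcont : ContinuousOn (fun x => ∫ t in Ioi (n : ℝ), F 𝒟 U b 0 t x) 𝒟.pts := by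
        refine ContinuousOn.congr (f := fun x => (∫ s in Ioi 0, F 𝒟 U b 0 s (flow 𝒟 b n x)) *
          jac 𝒟 b n x) ?_ fun x hx => (setIntegral_Ioi_F_flow hb hx 0 _).symm
        exact ((h.continuousOn_Ioi 0).comp (continuousOn_flow_space hb n)
          fun y hy => flow_mem hb hy n).mul (continuousOn_jac_space hb n)
      have hnear : ∀ᶠ y in 𝓝 x, ∫ t in Ioi (n : ℝ), F 𝒟 U b 0 t y < m / M * β :=
        (hcont.continuousAt (𝒟.isOpen_pts.mem_nhds (hKp hx))).eventually_lt_const hn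
      exact ⟨_, mem_nhdsWithin_of_mem_nhds hnear, n, fun y hy _ => hy⟩
  have key : ∀ x ∈ K, ∀ t : ℝ, (n : ℝ) + 1 ≤ t → flow 𝒟 b t x ∉ K := by
    intro x hx t ht hy
    have h1 := integral_F_flow (U := U) hb (hKp hx) 0 t
    have h2 := setIntegral_Ioi_F_flow (U := U) hb (hKp hx) 0 t
    have h3 := (hmono x (hKp hx) n t (by linarith)).trans_lt (hn x hx)
    have h4 : m ≤ ∫ s, F 𝒟 U b 0 s x := hm hx
    have h5 : (∫ s, F 𝒟 U b 0 s (flow 𝒟 b t x)) ≤ M := hM hy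
    have h6 : β ≤ ∫ s in Ioi 0, F 𝒟 U b 0 s (flow 𝒟 b t x) := hβ hy
    have hJ := jac_pos hb (hKp hx) t
    have h7 : m / M ≤ jac 𝒟 b t x := by
      rw [div_le_iff₀ hM0]
      nlinarith
    have h8 : m / M * β ≤ ∫ s in Ioi t, F 𝒟 U b 0 s x := by
      rw [← h2, mul_comm]
      exact mul_le_mul h6 h7 (by positivity) (hβ0.le.trans h6)
    linarith
  refine ⟨n + 1, by positivity, fun x hx t ht hy => ?_⟩
  rcases le_total 0 t with h0 | h0
  · rw [abs_of_nonneg h0] at ht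
    exact key x hx t ht hy
  · rw [abs_of_nonpos h0] at ht
    exact key _ hy (-t) ht (by rwa [flow_neg_flow hb (hKp hx)])

lemma continuousOn_intervalIntegral_F (hU : ∀ k, ContinuousOn (U k) 𝒟.pts)
    (hb : b ∈ velocityFields 𝒟) (k : Fin 2) (s t : ℝ) :
    ContinuousOn (fun x => ∫ r in s..t, F 𝒟 U b k r x) 𝒟.pts := by
  rw [continuousOn_iff_continuous_domRestrict]
  refine intervalIntegral.continuous_parametric_intervalIntegral_of_continuous'
    (f := fun (x : 𝒟.pts) r => F 𝒟 U b k r x) ?_ s t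
  exact (continuousOn_F hU hb k).comp_continuous
    (f := fun p : 𝒟.pts × ℝ => (p.2, (p.1 : E d))) (by fun_prop) fun p => ⟨mem_univ _, p.1.2⟩

end Properness

/-! ### Time reversal -/

section Reversal

variable {d : ℕ} {𝒟 : Domain d} {U : Fin 2 → E d → ℝ} {b : E d → E d}

lemma neg_mem_velocityFields (hb : b ∈ velocityFields 𝒟) : -b ∈ velocityFields 𝒟 := by
  obtain ⟨h1, h2, h3, C, hC⟩ := hb
  refine ⟨h1.neg, fun v hv x => by simp [h2 v hv x], fun p hp n hn => by simp [h3 p hp n hn], C,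
    fun x hx => ?_⟩
  rw [fderiv_neg, norm_neg]
  exact hC x hx

lemma flow_neg (hb : b ∈ velocityFields 𝒟) {x : E d} (hx : x ∈ 𝒟.pts) (t : ℝ) :
    flow 𝒟 (-b) t x = flow 𝒟 b (-t) x := by
  have hb' := neg_mem_velocityFields hb
  refine eqOn_of_hasDerivAt 𝒟.isOpen_pts (contDiffOn_one_pts hb') isOpen_univ isPreconnected_univ
    (mem_univ (0 : ℝ)) (γ := fun t => flow 𝒟 (-b) t x) (η := fun t => flow 𝒟 b (-t) x)
    (fun s _ => ⟨flow_mem hb' hx s, hasDerivAt_flow hb' hx s⟩)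
    (fun s _ => ⟨flow_mem hb hx _, ?_⟩) ?_ (mem_univ t)
  · simpa [Function.comp_def] using (hasDerivAt_flow hb hx (-s)).scomp s (hasDerivAt_neg s)
  · simp [flow_zero hb hx, flow_zero hb' hx]

lemma F_neg (hb : b ∈ velocityFields 𝒟) {x : E d} (hx : x ∈ 𝒟.pts) (k : Fin 2) (t : ℝ) :
    F 𝒟 U (-b) k t x = F 𝒟 U b k (-t) x := by
  have h : (fun y => flow 𝒟 (-b) t y) =ᶠ[𝓝 x] fun y => flow 𝒟 b (-t) y := by
    filter_upwards [𝒟.isOpen_pts.mem_nhds hx] with y hy using flow_neg hb hy t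
  rw [F, F, jac, jac, h.fderiv_eq, flow_neg hb hx]

lemma integral_Ioi_F_neg (hb : b ∈ velocityFields 𝒟) {x : E d} (hx : x ∈ 𝒟.pts) (k : Fin 2) :
    ∫ t in Ioi 0, F 𝒟 U (-b) k t x = ∫ t in Iio 0, F 𝒟 U b k t x := by
  simp only [F_neg hb hx]
  rw [integral_comp_neg_Ioi 0 (fun t => F 𝒟 U b k t x), neg_zero, integral_Iic_eq_integral_Iio]

lemma integrableOn_Ioi_F_neg (hb : b ∈ velocityFields 𝒟) {x : E d} (hx : x ∈ 𝒟.pts) (k : Fin 2) :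
    IntegrableOn (fun t => F 𝒟 U (-b) k t x) (Ioi 0) ↔
      IntegrableOn (fun t => F 𝒟 U b k t x) (Iio 0) := by
  simp only [F_neg hb hx]
  have := (Measure.measurePreserving_neg (volume : Measure ℝ)).integrableOn_comp_preimage
    (Homeomorph.neg ℝ).measurableEmbedding (f := fun t => F 𝒟 U b k t x) (s := Iio 0)
  simpa [Function.comp_def] using this

end Reversal

/-! ### Compactly supported perturbations -/

section Perturbation

variable {d : ℕ} {𝒟 : Domain d} {U : Fin 2 → E d → ℝ} {b b' w : E d → E d}
  {K : Set (E d)}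

lemma add_smul_mem_velocityFields (hb : b ∈ velocityFields 𝒟) (hw : ContDiff ℝ ∞ w)
    (hwc : HasCompactSupport w) (hwp : tsupport w ⊆ 𝒟.pts) (hper : 𝒟.IsPeriodic w) (ε : ℝ) :
    b + ε • w ∈ velocityFields 𝒟 := by
  have hbd := hb.1
  obtain ⟨-, h2, h3, C, hC⟩ := hb
  obtain ⟨C', hC'⟩ := (hwc.fderiv ℝ).exists_bound_of_continuous (hw.continuous_fderiv (by simp))
  refine ⟨hbd.add (hw.const_smul ε).contDiffOn, fun v hv x => by simp [h2 v hv x, hper v hv x],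
    fun p hp n hn => ?_, C + |ε| * C', fun x hx => ?_⟩
  · have hwz : w p = 0 := by
      refine image_eq_zero_of_notMem_tsupport fun h => ?_
      rw [𝒟.isOpen_pts.frontier_eq] at hp
      exact hp.2 (hwp h)
    simp [hwz, h3 p hp n hn]
  · have hdb : DifferentiableAt ℝ b x :=
      ((hbd.mono subset_closure).contDiffAt (𝒟.isOpen_pts.mem_nhds hx)).differentiableAt (by simp)
    have hdw : DifferentiableAt ℝ w x := hw.differentiable (by simp) x
    rw [fderiv_add hdb (hdw.const_smul ε), fderiv_const_smul hdw]
    refine (norm_add_le _ _).trans (add_le_add (hC x hx) ?_)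
    rw [norm_smul, Real.norm_eq_abs]
    exact mul_le_mul_of_nonneg_left (hC' x) (abs_nonneg ε)

/-- The trajectories of `β` that meet `K` do so in a time interval of length less than `T`. -/
def HasTransitTime (𝒟 : Domain d) (β : E d → E d) (K : Set (E d)) (T : ℝ) : Prop :=
  ∀ x ∈ K, ∀ t, T ≤ |t| → flow 𝒟 β t x ∉ K

/-- Small perturbations supported in a compact set `K` keep a bounded transit time through `K`. At
time `T` the perturbed trajectory from `K` is close to the unperturbed one, hence lies on the
trajectory of some point of a compact neighbourhood `K'` of `K`, and after time `T` such a
trajectory never meets `K'` again, so it is not affected by the perturbation. -/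
theorem HasContinuousIntegrals.exists_hasTransitTime (h : HasContinuousIntegrals 𝒟 U b)
    (hw : ContDiff ℝ ∞ w) (hwc : HasCompactSupport w) (hwp : tsupport w ⊆ 𝒟.pts)
    (hb : ∀ ε : ℝ, b + ε • w ∈ velocityFields 𝒟) :
    ∃ T > 0, ∀ᶠ ε in 𝓝 (0 : ℝ), HasTransitTime 𝒟 (b + ε • w) (tsupport w) T := by
  have hb0 : b ∈ velocityFields 𝒟 := by simpa using hb 0
  set K := tsupport w with hK
  obtain ⟨K', hK'c, hKK', hK'p⟩ := exists_compact_between hwc.isCompact 𝒟.isOpen_pts hwp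
  obtain ⟨T, hT, hTK⟩ := h.exists_flow_notMem hb0 hK'c hK'p
  refine ⟨T, hT, ?_⟩
  have hev : ∀ᶠ ε in 𝓝 (0 : ℝ), ∀ x ∈ K,
      flow 𝒟 b (-T) (flow 𝒟 (b + ε • w) T x) ∈ interior K' := by
    refine hwc.isCompact.eventually_forall_of_forall_eventually fun x hx => ?_
    have h1 : ContinuousAt (fun p : ℝ × E d => flow 𝒟 (b + p.1 • w) T p.2) (0, x) :=
      ContinuousAt.comp (x := ((0 : ℝ), x))
        (g := fun p : ℝ × E d × ℝ => flow 𝒟 (b + p.2.2 • w) p.1 p.2.1)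
        (f := fun p : ℝ × E d => (T, p.2, p.1)) (continuousAt_flow_param hw hb (hwp hx) T 0)
        (by fun_prop)
    have h2 : ContinuousAt (flow 𝒟 b (-T)) (flow 𝒟 (b + (0 : ℝ) • w) T x) :=
      (continuousOn_flow_space hb0 (-T)).continuousAt
        (𝒟.isOpen_pts.mem_nhds (flow_mem (hb 0) (hwp hx) T))
    have h3 := ContinuousAt.comp (x := ((0 : ℝ), x)) (g := flow 𝒟 b (-T)) h2 h1
    refine h3 (isOpen_interior.mem_nhds ?_)
    simp only [Function.comp_apply, zero_smul, add_zero]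
    rw [flow_neg_flow hb0 (hwp hx)]
    exact hKK' hx
  filter_upwards [hev] with ε hε
  have key : ∀ x ∈ K, ∀ t, T ≤ t → flow 𝒟 (b + ε • w) t x ∉ K := by
    intro x hx t ht
    have hxp := hwp hx
    set y := flow 𝒟 (b + ε • w) T x with hy
    have hyp : y ∈ 𝒟.pts := flow_mem (hb ε) hxp T
    have hz := interior_subset (hε x hx)
    have hfut : ∀ s, 0 ≤ s → flow 𝒟 b s y ∉ K' := by
      intro s hs
      have h1 := hTK _ hz (s + T) (by rw [abs_of_nonneg (by linarith)]; linarith)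
      rwa [flow_add hb0 (hK'p hz), flow_flow_neg hb0 hyp] at h1
    have hKsub : K ⊆ K' := hKK'.trans interior_subset
    have h2 : flow 𝒟 (b + ε • w) (t - T) y = flow 𝒟 b (t - T) y := by
      refine flow_eq_of_avoid hb0 (hb ε) (isClosed_tsupport w)
        (fun x hx => by simp [image_eq_zero_of_notMem_tsupport hx]) hyp fun s hs h => ?_
      rw [uIcc_of_le (by linarith)] at hs
      exact hfut s hs.1 (hKsub h)
    rw [hy, ← flow_add (hb ε) hxp, sub_add_cancel] at h2
    rw [h2]
    exact fun h => hfut (t - T) (by linarith) (hKsub h)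
  intro x hx t ht hy
  rcases le_total 0 t with h0 | h0
  · rw [abs_of_nonneg h0] at ht
    exact key x hx t ht hy
  · rw [abs_of_nonpos h0] at ht
    exact key _ hy (-t) ht (by rwa [flow_neg_flow (hb ε) (hwp hx)])

/-- With a bounded transit time through a compact set `K` outside which the field is unperturbed,
the trajectories from a compact set meet `K` in bounded times only; the bound depends on the
perturbed field only through its transit time. -/
lemma HasContinuousIntegrals.exists_perturbed_flow_notMem (h : HasContinuousIntegrals 𝒟 U b)
    (hK : IsCompact K) (hKp : K ⊆ 𝒟.pts) (hb0 : b ∈ velocityFields 𝒟) {C : Set (E d)}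
    (hC : IsCompact C) (hCp : C ⊆ 𝒟.pts) (T : ℝ) :
    ∃ S > 0, ∀ b' ∈ velocityFields 𝒟, (∀ x ∉ K, b' x = b x) → HasTransitTime 𝒟 b' K T →
      ∀ x ∈ C, ∀ t, S ≤ |t| → flow 𝒟 b' t x ∉ K := by
  obtain ⟨T₁, hT₁, hTK⟩ := h.exists_flow_notMem hb0 (hC.union hK) (union_subset hCp hKp)
  refine ⟨T₁ + |T|, by positivity, fun b' hb1 hbb hT x hx t ht hxt => ?_⟩
  have hxp := hCp hx
  have h1 : ∀ s, |s| ≤ T₁ → flow 𝒟 b' s x ∉ K := by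
    intro s hs hxs
    refine hT _ hxt (s - t) ?_ ?_
    · have := abs_sub_abs_le_abs_sub t s
      rw [abs_sub_comm]
      linarith [le_abs_self T]
    · rwa [← flow_add hb1 hxp, sub_add_cancel]
  have h2 : ∀ s, |s| ≤ T₁ → flow 𝒟 b s x = flow 𝒟 b' s x := by
    intro s hs
    refine flow_eq_of_avoid hb1 hb0 hK.isClosed (fun x hx => (hbb x hx).symm) hxp
      fun r hr => h1 r ?_
    refine le_trans ?_ hs
    simpa using abs_sub_left_of_mem_uIcc hr
  have h3 : ∀ s, flow 𝒟 b s x ∉ K := by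
    intro s
    rcases le_total |s| T₁ with hs | hs
    · rw [h2 s hs]; exact h1 s hs
    · exact fun hh => hTK x (Or.inl hx) s hs (Or.inr hh)
  have h4 : flow 𝒟 b' t x = flow 𝒟 b t x :=
    flow_eq_of_avoid hb0 hb1 hK.isClosed hbb hxp fun s _ => h3 s
  exact h3 t (h4 ▸ hxt)

/-- After a bounded time, the trajectories from a compact set follow the unperturbed flow, so their
future weights are finite and continuous. -/
lemma HasContinuousIntegrals.perturbed_Ioi (h : HasContinuousIntegrals 𝒟 U b)
    (hU : ∀ k, ContinuousOn (U k) 𝒟.pts)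
    (hK : IsCompact K) (hKp : K ⊆ 𝒟.pts) (hb0 : b ∈ velocityFields 𝒟)
    (hb1 : b' ∈ velocityFields 𝒟) (hbb : ∀ x ∉ K, b' x = b x) {T : ℝ}
    (hT : HasTransitTime 𝒟 b' K T) (k : Fin 2) :
    (∀ x ∈ 𝒟.pts, IntegrableOn (fun t => F 𝒟 U b' k t x) (Ioi 0)) ∧
      ContinuousOn (fun x => ∫ t in Ioi 0, F 𝒟 U b' k t x) 𝒟.pts := by
  have loc : ∀ x ∈ 𝒟.pts, ∃ C ∈ 𝓝 x, ∃ S : ℝ, C ⊆ 𝒟.pts ∧ ∀ z ∈ C,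
      IntegrableOn (fun t => F 𝒟 U b' k t z) (Ioi S) ∧
      ∫ t in Ioi S, F 𝒟 U b' k t z =
        (∫ t in Ioi 0, F 𝒟 U b k t (flow 𝒟 b' S z)) * jac 𝒟 b' S z := by
    intro x hx
    obtain ⟨C, hC, hxC, hCp⟩ := exists_compact_subset 𝒟.isOpen_pts hx
    obtain ⟨S, hS, hSC⟩ := h.exists_perturbed_flow_notMem hK hKp hb0 hC hCp T
    have hSC := hSC b' hb1 hbb hT
    refine ⟨C, mem_interior_iff_mem_nhds.1 hxC, S, hCp, fun z hz => ?_⟩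
    have hzp := hCp hz
    have hy := flow_mem hb1 hzp S
    have hF : ∀ s ∈ Ioi (0 : ℝ), F 𝒟 U b' k (s + S) z =
        F 𝒟 U b k s (flow 𝒟 b' S z) * jac 𝒟 b' S z := by
      intro s hs
      rw [F_add hb1 hzp, F_eq_of_avoid hb1 hb0 hK.isClosed (fun x hx => (hbb x hx).symm) hy]
      intro r hr
      rw [uIcc_of_le (le_of_lt hs)] at hr
      rw [← flow_add hb1 hzp]
      exact hSC z hz (r + S) (by rw [abs_of_nonneg (by linarith [hr.1])]; linarith [hr.1])
    constructor
    · rw [← integrableOn_Ioi_comp_add_right_iff]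
      exact IntegrableOn.congr_fun (((h.integrable k _ hy).integrableOn).mul_const _)
        (fun s hs => (hF s hs).symm) measurableSet_Ioi
    · rw [← setIntegral_Ioi_comp_add_right, setIntegral_congr_fun measurableSet_Ioi hF,
        integral_mul_const]
  have hint : ∀ x ∈ 𝒟.pts, IntegrableOn (fun t => F 𝒟 U b' k t x) (Ioi 0) := by
    intro x hx
    obtain ⟨C, hC, S, hCp, hS⟩ := loc x hx
    have h1 := (hS x (mem_of_mem_nhds hC)).1
    have h2 : IntegrableOn (fun t => F 𝒟 U b' k t x) (Icc 0 S) :=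
      (continuous_F_time hU hb1 k hx).continuousOn.integrableOn_Icc
    refine (h2.union h1).mono_set fun t ht => ?_
    rcases le_or_gt t S with hts | hts
    · exact Or.inl ⟨le_of_lt ht, hts⟩
    · exact Or.inr hts
  refine ⟨hint, fun x hx => ?_⟩
  obtain ⟨C, hC, S, hCp, hS⟩ := loc x hx
  have hC' : ContinuousOn (fun z => ∫ t in Ioi 0, F 𝒟 U b' k t z) C := by
    refine ContinuousOn.congr (f := fun z => (∫ t in (0 : ℝ)..S, F 𝒟 U b' k t z) +
      (∫ t in Ioi 0, F 𝒟 U b k t (flow 𝒟 b' S z)) * jac 𝒟 b' S z) ?_ fun z hz => ?_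
    · refine ((continuousOn_intervalIntegral_F hU hb1 k 0 S).mono hCp).add (ContinuousOn.mul ?_
        ((continuousOn_jac_space hb1 S).mono hCp))
      exact (h.continuousOn_Ioi k).comp ((continuousOn_flow_space hb1 S).mono hCp)
        fun z hz => flow_mem hb1 (hCp hz) S
    · dsimp only
      rw [← (hS z hz).2, intervalIntegral.integral_interval_add_Ioi (hint z (hCp hz)) (hS z hz).1]
  exact (hC'.continuousAt hC).continuousWithinAt

lemma HasTransitTime.neg {β : E d → E d} {K : Set (E d)} {T : ℝ} (hβ : β ∈ velocityFields 𝒟)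
    (hK : K ⊆ 𝒟.pts) (h : HasTransitTime 𝒟 β K T) : HasTransitTime 𝒟 (-β) K T := by
  intro x hx t ht
  rw [flow_neg hβ (hK hx)]
  exact h x hx (-t) (by rwa [abs_neg])

lemma HasContinuousIntegrals.neg (h : HasContinuousIntegrals 𝒟 U b) (hb : b ∈ velocityFields 𝒟) :
    HasContinuousIntegrals 𝒟 U (-b) := by
  have hb' := neg_mem_velocityFields hb
  refine ⟨fun k x hx => ?_, fun k => ?_, fun k => ?_⟩
  · simp only [F_neg hb hx]
    exact (h.integrable k x hx).comp_neg
  · exact (h.continuousOn_Iio k).congr fun x hx => integral_Ioi_F_neg hb hx k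
  · refine (h.continuousOn_Ioi k).congr fun x hx => ?_
    dsimp only
    rw [← integral_Ioi_F_neg hb' hx, neg_neg]

/-- A perturbation inside a compact set that keeps a bounded transit time through this set keeps
the integrals of the weights finite and continuous. -/
theorem HasContinuousIntegrals.perturbed (h : HasContinuousIntegrals 𝒟 U b)
    (hU : ∀ k, ContinuousOn (U k) 𝒟.pts)
    (hK : IsCompact K) (hKp : K ⊆ 𝒟.pts) (hb0 : b ∈ velocityFields 𝒟)
    (hb1 : b' ∈ velocityFields 𝒟) (hbb : ∀ x ∉ K, b' x = b x) {T : ℝ}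
    (hT : HasTransitTime 𝒟 b' K T) : HasContinuousIntegrals 𝒟 U b' := by
  have hfut := h.perturbed_Ioi hU hK hKp hb0 hb1 hbb hT
  have hpast := (h.neg hb0).perturbed_Ioi (b' := -b') hU hK hKp (neg_mem_velocityFields hb0)
    (neg_mem_velocityFields hb1) (fun x hx => by simp [hbb x hx]) (hT.neg hb1 hKp)
  refine ⟨fun k x hx => ?_, fun k => (hfut k).2, fun k => ?_⟩
  · exact integrable_of_Ioi_of_Iio ((hfut k).1 x hx)
      ((integrableOn_Ioi_F_neg hb1 hx k).1 ((hpast k).1 x hx))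
  · exact (hpast k).2.congr fun x hx => (integral_Ioi_F_neg hb1 hx k).symm

lemma HasContinuousIntegrals.mem_infiniteTimeFields (h : HasContinuousIntegrals 𝒟 U b)
    (hb : b ∈ velocityFields 𝒟) : b ∈ infiniteTimeFields 𝒟 U := by
  refine ⟨hb, ?_⟩
  rw [h.mho_eq, sdiff_self]
  exact measure_empty

end Perturbation

/-! ### The estimator as a conditional expectation -/

section Averaging

variable {d : ℕ} {𝒟 : Domain d} {U : Fin 2 → E d → ℝ} {b : E d → E d}

lemma integral_sub_sq {α : Type*} [MeasurableSpace α] {μ : Measure α} {f g : α → ℝ}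
    (hf : MemLp f 2 μ) (hg : MemLp g 2 μ) :
    ∫ x, (f x - g x) ^ 2 ∂μ =
      ∫ x, f x ^ 2 ∂μ - 2 * ∫ x, g x * f x ∂μ + ∫ x, g x ^ 2 ∂μ := by
  have hi : Integrable (fun x => g x * f x) μ := hg.integrable_mul hf
  have h1 : ∫ x, (f x - g x) ^ 2 ∂μ = ∫ x, ((f x ^ 2 - 2 * (g x * f x)) + g x ^ 2) ∂μ := by
    congr 1; ext x; ring
  have h2 : Integrable (fun x => f x ^ 2 - 2 * (g x * f x)) μ :=
    hf.integrable_sq.sub (hi.const_mul 2)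
  rw [h1, integral_add h2 hg.integrable_sq,
    integral_sub hf.integrable_sq (hi.const_mul 2), integral_const_mul]

lemma IsPotentialPair.continuousOn (hU : IsPotentialPair 𝒟 U) (k : Fin 2) :
    ContinuousOn (U k) 𝒟.pts := (hU.smooth k).continuousOn

/-- The measure `ρ₀ dx` on the points of the domain, with `ρ₀ = exp(-U₀)`. It is a probability
measure if these points represent the domain without repetition, which is the hypothesis `𝒟.cell =
𝒟.pts` below: it holds for the subsets of `ℝ^d`, not for tori. -/
def refMeasure (𝒟 : Domain d) (U : Fin 2 → E d → ℝ) : Measure (E d) :=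
  (volume.restrict 𝒟.pts).withDensity fun x => ENNReal.ofReal (Real.exp (-U 0 x))

/-- The density ratio `exp(-(U₁ - U₀))` of `ρ₁` with respect to `ρ₀`. -/
def densityRatio (U : Fin 2 → E d → ℝ) (x : E d) : ℝ := Real.exp (-(U 1 x - U 0 x))

lemma densityRatio_mul_exp (x : E d) :
    densityRatio U x * Real.exp (-U 0 x) = Real.exp (-U 1 x) := by
  rw [densityRatio, ← Real.exp_add]; congr 1; ring

lemma densityRatio_pos (x : E d) : 0 < densityRatio U x := Real.exp_pos _

lemma continuousOn_densityRatio (hU : ∀ k, ContinuousOn (U k) 𝒟.pts) :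
    ContinuousOn (densityRatio U) 𝒟.pts :=
  Real.continuous_exp.comp_continuousOn ((hU 1).sub (hU 0)).neg

lemma aemeasurable_ofReal_exp (hU : ∀ k, ContinuousOn (U k) 𝒟.pts) (k : Fin 2) :
    AEMeasurable (fun x => ENNReal.ofReal (Real.exp (-U k x))) (volume.restrict 𝒟.pts) :=
  ((Real.continuous_exp.comp_continuousOn (hU k).neg).aemeasurable
    𝒟.isOpen_pts.measurableSet).ennreal_ofReal

lemma refMeasure_absolutelyContinuous : refMeasure 𝒟 U ≪ volume.restrict 𝒟.pts :=
  withDensity_absolutelyContinuous _ _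

lemma ae_refMeasure_of_forall {p : E d → Prop} (h : ∀ x ∈ 𝒟.pts, p x) :
    ∀ᵐ x ∂refMeasure 𝒟 U, p x := by
  refine refMeasure_absolutelyContinuous.ae_le ?_
  filter_upwards [ae_restrict_mem 𝒟.isOpen_pts.measurableSet] with x hx using h x hx

lemma lintegral_refMeasure (hU : ∀ k, ContinuousOn (U k) 𝒟.pts) (f : E d → ENNReal) :
    ∫⁻ x, f x ∂refMeasure 𝒟 U = ∫⁻ x in 𝒟.pts, ENNReal.ofReal (Real.exp (-U 0 x)) * f x := by
  rw [refMeasure, lintegral_withDensity_eq_lintegral_mul_non_measurable₀ _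
    (aemeasurable_ofReal_exp hU 0) (Eventually.of_forall fun _ => ENNReal.ofReal_lt_top)]
  rfl

lemma integral_refMeasure (hU : ∀ k, ContinuousOn (U k) 𝒟.pts) (f : E d → ℝ) :
    ∫ x, f x ∂refMeasure 𝒟 U = ∫ x in 𝒟.pts, f x * Real.exp (-U 0 x) := by
  rw [refMeasure, integral_withDensity_eq_integral_toReal_smul₀
    (aemeasurable_ofReal_exp hU 0) (Eventually.of_forall fun _ => ENNReal.ofReal_lt_top)]
  refine integral_congr_ae (Eventually.of_forall fun x => ?_)
  simp only [smul_eq_mul]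
  rw [ENNReal.toReal_ofReal (Real.exp_pos _).le, mul_comm]

lemma integrable_refMeasure_iff (hU : ∀ k, ContinuousOn (U k) 𝒟.pts) (f : E d → ℝ) :
    Integrable f (refMeasure 𝒟 U) ↔ IntegrableOn (fun x => f x * Real.exp (-U 0 x)) 𝒟.pts := by
  rw [refMeasure, integrable_withDensity_iff_integrable_smul₀'
    (aemeasurable_ofReal_exp hU 0) (Eventually.of_forall fun _ => ENNReal.ofReal_lt_top)]
  refine integrable_congr (Eventually.of_forall fun x => ?_)
  simp only [smul_eq_mul]
  rw [ENNReal.toReal_ofReal (Real.exp_pos _).le, mul_comm]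

lemma aestronglyMeasurable_refMeasure {f : E d → ℝ} (hf : ContinuousOn f 𝒟.pts) :
    AEStronglyMeasurable f (refMeasure 𝒟 U) :=
  (hf.aestronglyMeasurable 𝒟.isOpen_pts.measurableSet).mono_ac refMeasure_absolutelyContinuous

lemma isProbabilityMeasure_refMeasure (hU : IsPotentialPair 𝒟 U) (hcell : 𝒟.cell = 𝒟.pts) :
    IsProbabilityMeasure (refMeasure 𝒟 U) := by
  have h1 := hU.partition_zero
  have h2 := hU.integrable_zero
  rw [partitionZ] at h1
  rw [hcell] at h1 h2
  refine ⟨?_⟩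
  rw [refMeasure, withDensity_apply _ MeasurableSet.univ, Measure.restrict_univ,
    ← ofReal_integral_eq_lintegral_ofReal h2
      (Eventually.of_forall fun x => (Real.exp_pos _).le), h1,
    ENNReal.ofReal_one]

lemma memLp_densityRatio (hU : IsPotentialPair 𝒟 U) (hcell : 𝒟.cell = 𝒟.pts) :
    MemLp (densityRatio U) 2 (refMeasure 𝒟 U) := by
  rw [memLp_two_iff_integrable_sq
    (aestronglyMeasurable_refMeasure (continuousOn_densityRatio hU.continuousOn)),
    integrable_refMeasure_iff hU.continuousOn]
  have h := hU.integrable_varMax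
  rw [hcell] at h
  refine h.congr_fun (fun x _ => ?_) 𝒟.isOpen_pts.measurableSet
  simp only [densityRatio]
  rw [← Real.exp_nat_mul]
  congr 2; push_cast; ring

/-- Change of variables along the flow. -/
lemma lintegral_comp_flow (hb : b ∈ velocityFields 𝒟) (t : ℝ) (H : E d → ENNReal) :
    ∫⁻ x in 𝒟.pts, ENNReal.ofReal (jac 𝒟 b t x) * H (flow 𝒟 b t x) = ∫⁻ y in 𝒟.pts, H y := by
  have := lintegral_image_eq_lintegral_abs_det_fderiv_mul volume 𝒟.isOpen_pts.measurableSet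
    (fun x hx => (differentiableAt_flow hb hx t).hasFDerivAt.hasFDerivWithinAt)
    (injOn_flow hb t) H
  rw [image_flow hb t] at this
  exact this.symm

lemma integral_comp_flow (hb : b ∈ velocityFields 𝒟) (t : ℝ) (H : E d → ℝ) :
    ∫ x in 𝒟.pts, jac 𝒟 b t x * H (flow 𝒟 b t x) = ∫ y in 𝒟.pts, H y := by
  have := integral_image_eq_integral_abs_det_fderiv_smul volume 𝒟.isOpen_pts.measurableSet
    (fun x hx => (differentiableAt_flow hb hx t).hasFDerivAt.hasFDerivWithinAt)
    (injOn_flow hb t) H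
  rw [image_flow hb t] at this
  exact this.symm

/-- The total weight `∫_ℝ F^{(k)}_t(x) dt`, as an extended nonnegative real. -/
def totalWeight (𝒟 : Domain d) (U : Fin 2 → E d → ℝ) (b : E d → E d) (k : Fin 2) (x : E d) :
    ENNReal := ∫⁻ t, ENNReal.ofReal (F 𝒟 U b k t x)

lemma totalWeight_flow (hU : ∀ k, ContinuousOn (U k) 𝒟.pts) (hb : b ∈ velocityFields 𝒟) {x : E d}
    (hx : x ∈ 𝒟.pts) (k : Fin 2) (t : ℝ) :
    totalWeight 𝒟 U b k (flow 𝒟 b t x) * ENNReal.ofReal (jac 𝒟 b t x) = totalWeight 𝒟 U b k x := by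
  rw [totalWeight, totalWeight, ← lintegral_mul_const,
    ← lintegral_add_right_eq_self (fun s => ENNReal.ofReal (F 𝒟 U b k s x)) t]
  · refine lintegral_congr fun s => ?_
    rw [F_add hb hx, ENNReal.ofReal_mul (F_pos hb (flow_mem hb hx t) k s).le]
  · exact (continuous_F_time hU hb k (flow_mem hb hx t)).measurable.ennreal_ofReal

lemma aestronglyMeasurable_prod_restrict {f : E d → ℝ → ℝ} {s : Set ℝ} (hs : MeasurableSet s)
    (hf : ContinuousOn (fun p : E d × ℝ => f p.1 p.2) (𝒟.pts ×ˢ univ)) :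
    AEStronglyMeasurable (Function.uncurry f)
      ((volume.restrict 𝒟.pts).prod ((volume : Measure ℝ).restrict s)) := by
  rw [Measure.prod_restrict]
  exact (hf.mono (prod_mono_right (subset_univ s))).aestronglyMeasurable
    (𝒟.isOpen_pts.measurableSet.prod hs)

lemma aestronglyMeasurable_prod {f : E d → ℝ → ℝ}
    (hf : ContinuousOn (fun p : E d × ℝ => f p.1 p.2) (𝒟.pts ×ˢ univ)) :
    AEStronglyMeasurable (Function.uncurry f)
      ((volume.restrict 𝒟.pts).prod (volume : Measure ℝ)) := by
  simpa only [Measure.restrict_univ] using aestronglyMeasurable_prod_restrict MeasurableSet.univ hf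

lemma continuousOn_F_swap (hU : ∀ k, ContinuousOn (U k) 𝒟.pts) (hb : b ∈ velocityFields 𝒟)
    (k : Fin 2) : ContinuousOn (fun p : E d × ℝ => F 𝒟 U b k p.2 p.1) (𝒟.pts ×ˢ univ) :=
  (continuousOn_F hU hb k).comp (f := fun p : E d × ℝ => (p.2, p.1)) (by fun_prop)
    fun _ hp => ⟨mem_univ _, hp.1⟩

lemma aemeasurable_F_prod (hU : ∀ k, ContinuousOn (U k) 𝒟.pts) (hb : b ∈ velocityFields 𝒟)
    (k : Fin 2) : AEMeasurable (Function.uncurry fun x t => ENNReal.ofReal (F 𝒟 U b k t x))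
      ((volume.restrict 𝒟.pts).prod (volume : Measure ℝ)) :=
  (aestronglyMeasurable_prod (f := fun x t => F 𝒟 U b k t x)
    (continuousOn_F_swap hU hb k)).aemeasurable.ennreal_ofReal

lemma aemeasurable_totalWeight (hU : ∀ k, ContinuousOn (U k) 𝒟.pts) (hb : b ∈ velocityFields 𝒟)
    (k : Fin 2) : AEMeasurable (totalWeight 𝒟 U b k) (volume.restrict 𝒟.pts) :=
  (aemeasurable_F_prod hU hb k).lintegral_prod_right'

lemma aemeasurable_estimator (hU : ∀ k, ContinuousOn (U k) 𝒟.pts) (hb : b ∈ velocityFields 𝒟) :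
    AEMeasurable (estimator 𝒟 U b) (volume.restrict 𝒟.pts) := by
  have h : ∀ k, AEStronglyMeasurable (fun x => ∫ t, F 𝒟 U b k t x) (volume.restrict 𝒟.pts) :=
    fun k => (aestronglyMeasurable_prod (f := fun x t => F 𝒟 U b k t x)
      (continuousOn_F_swap hU hb k)).integral_prod_right'
  exact (h 1).aemeasurable.div (h 0).aemeasurable

lemma aestronglyMeasurable_estimator (hU : ∀ k, ContinuousOn (U k) 𝒟.pts)
    (hb : b ∈ velocityFields 𝒟) :
    AEStronglyMeasurable (estimator 𝒟 U b) (refMeasure 𝒟 U) :=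
  (aemeasurable_estimator hU hb).aestronglyMeasurable.mono_ac refMeasure_absolutelyContinuous

/-- Averaging along trajectories with the weights of `ρ₀` does not change integrals against
invariant functions: after Fubini's theorem and the change of variables `y = X_t x`, the weights add
up to one. -/
lemma lintegral_mul_totalWeight_div (hU : ∀ k, ContinuousOn (U k) 𝒟.pts)
    (hb : b ∈ velocityFields 𝒟)
    (hfin : ∀ᵐ x ∂volume.restrict 𝒟.pts, totalWeight 𝒟 U b 0 x ≠ 0 ∧ totalWeight 𝒟 U b 0 x ≠ ⊤)
    {f : E d → ENNReal} (hf : AEMeasurable f (volume.restrict 𝒟.pts))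
    (hinv : ∀ x ∈ 𝒟.pts, ∀ t, f (flow 𝒟 b t x) = f x) :
    ∫⁻ x in 𝒟.pts, ENNReal.ofReal (Real.exp (-U 0 x)) *
        (f x * (totalWeight 𝒟 U b 1 x / totalWeight 𝒟 U b 0 x)) =
      ∫⁻ x in 𝒟.pts, f x * ENNReal.ofReal (Real.exp (-U 1 x)) := by
  set g := totalWeight 𝒟 U b with hg
  have hm := 𝒟.isOpen_pts.measurableSet
  set q : E d → ENNReal := fun x => f x * ENNReal.ofReal (Real.exp (-U 0 x)) * (g 0 x)⁻¹ with hq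
  have hqm : AEMeasurable q (volume.restrict 𝒟.pts) :=
    (hf.mul (aemeasurable_ofReal_exp hU 0)).mul (aemeasurable_totalWeight hU hb 0).inv
  set r : E d → ENNReal := fun y => f y * ENNReal.ofReal (Real.exp (-U 1 y)) * (g 0 y)⁻¹ with hr
  have hrm : AEMeasurable r (volume.restrict 𝒟.pts) :=
    (hf.mul (aemeasurable_ofReal_exp hU 1)).mul (aemeasurable_totalWeight hU hb 0).inv
  calc ∫⁻ x in 𝒟.pts, ENNReal.ofReal (Real.exp (-U 0 x)) * (f x * (g 1 x / g 0 x))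
      = ∫⁻ x in 𝒟.pts, ∫⁻ t, q x * ENNReal.ofReal (F 𝒟 U b 1 t x) := by
        refine setLIntegral_congr_fun hm fun x hx => ?_
        rw [lintegral_const_mul _ (continuous_F_time hU hb 1 hx).measurable.ennreal_ofReal]
        change _ = q x * g 1 x
        rw [hq, div_eq_mul_inv]
        ring
    _ = ∫⁻ t, ∫⁻ x in 𝒟.pts, q x * ENNReal.ofReal (F 𝒟 U b 1 t x) :=
        lintegral_lintegral_swap (hqm.comp_fst.mul (aemeasurable_F_prod hU hb 1))
    _ = ∫⁻ t, ∫⁻ y in 𝒟.pts, r y * ENNReal.ofReal (F 𝒟 U b 0 (-t) y) := by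
        refine lintegral_congr fun t => ?_
        rw [← lintegral_comp_flow hb t fun y => r y * ENNReal.ofReal (F 𝒟 U b 0 (-t) y)]
        refine setLIntegral_congr_fun hm fun x hx => ?_
        have hy := flow_mem hb hx t
        have hJ := jac_pos hb hx t
        have hJ' : ENNReal.ofReal (jac 𝒟 b (-t) (flow 𝒟 b t x)) *
            ENNReal.ofReal (jac 𝒟 b t x) = 1 := by
          rw [← ENNReal.ofReal_mul (jac_pos hb hy _).le, ← jac_add hb hx, neg_add_cancel,
            jac_zero hb hx, ENNReal.ofReal_one]
        have hginv : (g 0 x)⁻¹ =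
            (g 0 (flow 𝒟 b t x))⁻¹ * ENNReal.ofReal (jac 𝒟 b (-t) (flow 𝒟 b t x)) := by
          have h1 := totalWeight_flow (U := U) hU hb hx 0 t
          have h2 : (ENNReal.ofReal (jac 𝒟 b t x))⁻¹ =
              ENNReal.ofReal (jac 𝒟 b (-t) (flow 𝒟 b t x)) := by
            rw [eq_comm]
            exact ENNReal.eq_inv_of_mul_eq_one_left hJ'
          rw [hg, ← h1, ENNReal.mul_inv (Or.inr ENNReal.ofReal_ne_top)
            (Or.inr (ENNReal.ofReal_pos.2 hJ).ne'), h2]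
        simp only [hq, hr, F]
        rw [flow_neg_flow hb hx, hinv x hx t, ENNReal.ofReal_mul (Real.exp_pos _).le,
          ENNReal.ofReal_mul (Real.exp_pos _).le, hginv]
        ring
    _ = ∫⁻ y in 𝒟.pts, ∫⁻ t, r y * ENNReal.ofReal (F 𝒟 U b 0 (-t) y) := by
        refine (lintegral_lintegral_swap (hrm.comp_fst.mul ?_)).symm
        refine (aestronglyMeasurable_prod
          (f := fun y t => F 𝒟 U b 0 (-t) y) ?_).aemeasurable.ennreal_ofReal
        exact (continuousOn_F hU hb 0).comp (f := fun p : E d × ℝ => (-p.2, p.1)) (by fun_prop)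
          fun _ hp => ⟨mem_univ _, hp.1⟩
    _ = ∫⁻ y in 𝒟.pts, f y * ENNReal.ofReal (Real.exp (-U 1 y)) := by
        refine lintegral_congr_ae ?_
        filter_upwards [hfin, ae_restrict_mem hm] with y hy hyp
        have h1 := (continuous_F_time hU hb 0 hyp).measurable.ennreal_ofReal
        have h2 : ∫⁻ t, ENNReal.ofReal (F 𝒟 U b 0 (-t) y) = g 0 y :=
          (Measure.measurePreserving_neg (volume : Measure ℝ)).lintegral_comp h1
        have h3 : Measurable fun t => ENNReal.ofReal (F 𝒟 U b 0 (-t) y) := h1.comp measurable_neg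
        rw [lintegral_const_mul _ h3, h2]
        rw [hr, mul_assoc, ENNReal.inv_mul_cancel hy.1 hy.2, mul_one]

lemma totalWeight_eq_ofReal (hb : b ∈ velocityFields 𝒟) {x : E d} (hx : x ∈ mho 𝒟 U b)
    (k : Fin 2) : totalWeight 𝒟 U b k x = ENNReal.ofReal (∫ t, F 𝒟 U b k t x) :=
  (ofReal_integral_eq_lintegral_ofReal (integrable_of_mem_mho hx k)
    (Eventually.of_forall fun t => (F_pos hb hx.1 k t).le)).symm

lemma ae_mem_mho (hb : b ∈ infiniteTimeFields 𝒟 U) :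
    ∀ᵐ x ∂volume.restrict 𝒟.pts, x ∈ mho 𝒟 U b := by
  rw [ae_restrict_iff' 𝒟.isOpen_pts.measurableSet, ae_iff]
  have : {x | ¬(x ∈ 𝒟.pts → x ∈ mho 𝒟 U b)} = 𝒟.pts \ mho 𝒟 U b := by
    ext x; simp
  rw [this]
  exact hb.2

lemma ofReal_estimator (hb : b ∈ velocityFields 𝒟) {x : E d} (hx : x ∈ mho 𝒟 U b) :
    ENNReal.ofReal (estimator 𝒟 U b x) = totalWeight 𝒟 U b 1 x / totalWeight 𝒟 U b 0 x := by
  rw [totalWeight_eq_ofReal hb hx, totalWeight_eq_ofReal hb hx, estimator,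
    ENNReal.ofReal_div_of_pos (integral_F_pos hb hx.1 (integrable_of_mem_mho hx 0))]

/-- The estimator is the conditional expectation of the density ratio given the trajectory,
for nonnegative test functions. -/
lemma lintegral_mul_estimator (hU : ∀ k, ContinuousOn (U k) 𝒟.pts)
    (hb : b ∈ infiniteTimeFields 𝒟 U) {f : E d → ENNReal}
    (hf : AEMeasurable f (volume.restrict 𝒟.pts))
    (hinv : ∀ x ∈ 𝒟.pts, ∀ t, f (flow 𝒟 b t x) = f x) :
    ∫⁻ x, f x * ENNReal.ofReal (estimator 𝒟 U b x) ∂refMeasure 𝒟 U =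
      ∫⁻ x, f x * ENNReal.ofReal (densityRatio U x) ∂refMeasure 𝒟 U := by
  have hfin : ∀ᵐ x ∂volume.restrict 𝒟.pts,
      totalWeight 𝒟 U b 0 x ≠ 0 ∧ totalWeight 𝒟 U b 0 x ≠ ⊤ := by
    filter_upwards [ae_mem_mho hb] with x hx
    rw [totalWeight_eq_ofReal hb.1 hx]
    exact ⟨(ENNReal.ofReal_pos.2 (integral_F_pos hb.1 hx.1 (integrable_of_mem_mho hx 0))).ne',
      ENNReal.ofReal_ne_top⟩
  rw [lintegral_refMeasure hU, lintegral_refMeasure hU]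
  have h1 := lintegral_mul_totalWeight_div hU hb.1 hfin hf hinv
  refine Eq.trans (lintegral_congr_ae ?_) (h1.trans (lintegral_congr fun x => ?_))
  · filter_upwards [ae_mem_mho hb] with x hx
    rw [ofReal_estimator hb.1 hx]
  · rw [← densityRatio_mul_exp, ENNReal.ofReal_mul (densityRatio_pos x).le]
    ring

/-- The estimator is the conditional expectation of the density ratio given the trajectory. -/
lemma integral_mul_estimator (hU : ∀ k, ContinuousOn (U k) 𝒟.pts)
    (hb : b ∈ infiniteTimeFields 𝒟 U) {f : E d → ℝ}
    (hf : AEMeasurable f (volume.restrict 𝒟.pts))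
    (hinv : ∀ x ∈ 𝒟.pts, ∀ t, f (flow 𝒟 b t x) = f x)
    (hi : Integrable (fun x => f x * densityRatio U x) (refMeasure 𝒟 U)) :
    Integrable (fun x => f x * estimator 𝒟 U b x) (refMeasure 𝒟 U) ∧
      ∫ x, f x * estimator 𝒟 U b x ∂refMeasure 𝒟 U =
        ∫ x, f x * densityRatio U x ∂refMeasure 𝒟 U := by
  have hA := aestronglyMeasurable_estimator hU hb.1
  have hf' := hf.mono_ac (refMeasure_absolutelyContinuous (U := U))
  have hA0 : ∀ᵐ x ∂refMeasure 𝒟 U, 0 ≤ estimator 𝒟 U b x :=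
    ae_refMeasure_of_forall fun x hx => estimator_nonneg hb.1 hx
  have key : ∀ c : ℝ → ℝ, Measurable c →
      ∫⁻ x, ENNReal.ofReal (c (f x) * estimator 𝒟 U b x) ∂refMeasure 𝒟 U =
        ∫⁻ x, ENNReal.ofReal (c (f x) * densityRatio U x) ∂refMeasure 𝒟 U := by
    intro c hc
    have h1 := lintegral_mul_estimator hU hb (f := fun x => ENNReal.ofReal (c (f x)))
      (hc.comp_aemeasurable hf).ennreal_ofReal (fun x hx t => by rw [hinv x hx t])
    refine Eq.trans (lintegral_congr_ae ?_) (h1.trans (lintegral_congr fun x => ?_))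
    · filter_upwards [hA0] with x hx
      rw [ENNReal.ofReal_mul' hx]
    · rw [ENNReal.ofReal_mul' (densityRatio_pos x).le]
  have hint : Integrable (fun x => f x * estimator 𝒟 U b x) (refMeasure 𝒟 U) := by
    refine ⟨hf'.aestronglyMeasurable.mul hA, ?_⟩
    have h1 := hi.2
    rw [hasFiniteIntegral_iff_norm] at h1 ⊢
    have h2 := key (fun r => |r|) (by fun_prop)
    refine lt_of_eq_of_lt (Eq.trans (lintegral_congr_ae ?_)
      (h2.trans (lintegral_congr fun x => ?_))) h1
    · filter_upwards [hA0] with x hx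
      rw [Real.norm_eq_abs, abs_mul, abs_of_nonneg hx]
    · rw [Real.norm_eq_abs, abs_mul, abs_of_pos (densityRatio_pos x)]
  refine ⟨hint, ?_⟩
  rw [integral_eq_lintegral_pos_part_sub_lintegral_neg_part hint,
    integral_eq_lintegral_pos_part_sub_lintegral_neg_part hi]
  have h3 := key id measurable_id
  have h4 := key (fun r => -r) measurable_neg
  simp only [id, neg_mul] at h3 h4
  rw [h3, h4]

/-- A conditional expectation does not increase the second moment. The invariant test functions
`min A n` show that `∫ (min A n)² ρ₀` is at most the second moment of the density ratio. -/
lemma memLp_estimator (hU : IsPotentialPair 𝒟 U) (hcell : 𝒟.cell = 𝒟.pts)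
    (hb : b ∈ infiniteTimeFields 𝒟 U) : MemLp (estimator 𝒟 U b) 2 (refMeasure 𝒟 U) := by
  have := isProbabilityMeasure_refMeasure hU hcell
  have hh := memLp_densityRatio hU hcell
  have hA := aestronglyMeasurable_estimator hU.continuousOn hb.1
  have hA0 : ∀ᵐ x ∂refMeasure 𝒟 U, 0 ≤ estimator 𝒟 U b x :=
    ae_refMeasure_of_forall fun x hx => estimator_nonneg hb.1 hx
  have hAr := aemeasurable_estimator hU.continuousOn hb.1
  have hfn : ∀ n : ℕ, MemLp (fun x => min (estimator 𝒟 U b x) n) 2 (refMeasure 𝒟 U) := by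
    intro n
    refine MemLp.of_bound (hA.inf aestronglyMeasurable_const) n ?_
    filter_upwards [hA0] with x hx
    rw [Real.norm_eq_abs, abs_of_nonneg (le_min hx (by positivity))]
    exact min_le_right _ _
  have hle : ∀ n : ℕ, ∫ x, min (estimator 𝒟 U b x) n ^ 2 ∂refMeasure 𝒟 U ≤
      ∫ x, densityRatio U x ^ 2 ∂refMeasure 𝒟 U := by
    intro n
    obtain ⟨h1, h2⟩ := integral_mul_estimator hU.continuousOn hb
      (f := fun x => min (estimator 𝒟 U b x) n) (hAr.min aemeasurable_const)
      (fun x hx t => by rw [estimator_flow hb.1 hx]) ((hfn n).integrable_mul hh)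
    have h3 : ∫ x, min (estimator 𝒟 U b x) n ^ 2 ∂refMeasure 𝒟 U ≤
        ∫ x, min (estimator 𝒟 U b x) n * estimator 𝒟 U b x ∂refMeasure 𝒟 U := by
      refine integral_mono_ae (hfn n).integrable_sq h1 ?_
      filter_upwards [hA0] with x hx
      rw [sq]
      exact mul_le_mul_of_nonneg_left (min_le_left _ _) (le_min hx (by positivity))
    have h4 : 0 ≤ ∫ x, (densityRatio U x - min (estimator 𝒟 U b x) n) ^ 2 ∂refMeasure 𝒟 U :=
      integral_nonneg fun x => sq_nonneg _
    have h5 : ∫ x, (densityRatio U x - min (estimator 𝒟 U b x) n) ^ 2 ∂refMeasure 𝒟 U =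
        ∫ x, densityRatio U x ^ 2 ∂refMeasure 𝒟 U -
          2 * ∫ x, min (estimator 𝒟 U b x) n * densityRatio U x ∂refMeasure 𝒟 U +
          ∫ x, min (estimator 𝒟 U b x) n ^ 2 ∂refMeasure 𝒟 U := integral_sub_sq hh (hfn n)
    linarith
  rw [memLp_two_iff_integrable_sq hA]
  refine ⟨hA.pow 2, ?_⟩
  rw [hasFiniteIntegral_iff_ofReal (Eventually.of_forall fun x => sq_nonneg _)]
  have hlim : Tendsto
      (fun n : ℕ => ∫⁻ x, ENNReal.ofReal (min (estimator 𝒟 U b x) n ^ 2) ∂refMeasure 𝒟 U)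
      atTop (𝓝 (∫⁻ x, ENNReal.ofReal (estimator 𝒟 U b x ^ 2) ∂refMeasure 𝒟 U)) := by
    refine lintegral_tendsto_of_tendsto_of_monotone
      (fun n => (hfn n).integrable_sq.aestronglyMeasurable.aemeasurable.ennreal_ofReal) ?_ ?_
    · filter_upwards [hA0] with x hx n m hnm
      refine ENNReal.ofReal_le_ofReal (pow_le_pow_left₀ (le_min hx (by positivity)) ?_ 2)
      exact min_le_min_left _ (by exact_mod_cast hnm)
    · refine Eventually.of_forall fun x => ?_
      obtain ⟨N, hN⟩ := exists_nat_ge (estimator 𝒟 U b x)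
      refine tendsto_const_nhds.congr' ?_
      filter_upwards [eventually_ge_atTop N] with n hn
      rw [min_eq_left (hN.trans (by exact_mod_cast hn))]
  refine lt_of_le_of_lt (le_of_tendsto' hlim fun n => ?_)
    (ENNReal.ofReal_lt_top (r := ∫ x, densityRatio U x ^ 2 ∂refMeasure 𝒟 U))
  rw [← ofReal_integral_eq_lintegral_ofReal (hfn n).integrable_sq
    (Eventually.of_forall fun x => sq_nonneg _)]
  exact ENNReal.ofReal_le_ofReal (hle n)

lemma partitionZ_one_eq (hU : IsPotentialPair 𝒟 U) (hcell : 𝒟.cell = 𝒟.pts) :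
    partitionZ 𝒟 U 1 = ∫ x, densityRatio U x ∂refMeasure 𝒟 U := by
  rw [integral_refMeasure hU.continuousOn, partitionZ, hcell]
  simp only [densityRatio_mul_exp]

lemma secondMoment_eq (hU : IsPotentialPair 𝒟 U) (hcell : 𝒟.cell = 𝒟.pts) :
    secondMoment 𝒟 U b = ∫ x, estimator 𝒟 U b x ^ 2 ∂refMeasure 𝒟 U := by
  rw [integral_refMeasure hU.continuousOn, secondMoment, hcell]
  simp only [sq_abs]

/-- Unbiasedness of the estimator. -/
lemma integral_estimator (hU : IsPotentialPair 𝒟 U) (hcell : 𝒟.cell = 𝒟.pts)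
    (hb : b ∈ infiniteTimeFields 𝒟 U) :
    ∫ x, estimator 𝒟 U b x ∂refMeasure 𝒟 U = partitionZ 𝒟 U 1 := by
  have := isProbabilityMeasure_refMeasure hU hcell
  have h := (integral_mul_estimator hU.continuousOn hb (f := fun _ => 1) aemeasurable_const
    (fun _ _ _ => rfl) (by
      simpa using (memLp_densityRatio hU hcell).integrable one_le_two)).2
  rw [partitionZ_one_eq hU hcell]
  simpa using h

/-- The variance of the estimator is the mean square of its distance from its mean `𝒵₁`. -/
lemma Var_nonneg (hU : IsPotentialPair 𝒟 U) (hcell : 𝒟.cell = 𝒟.pts)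
    (hb : b ∈ infiniteTimeFields 𝒟 U) : 0 ≤ Var 𝒟 U b := by
  have := isProbabilityMeasure_refMeasure hU hcell
  have hA := memLp_estimator hU hcell hb
  have hZ := integral_estimator hU hcell hb
  have h1 : 0 ≤ ∫ x, (estimator 𝒟 U b x - partitionZ 𝒟 U 1) ^ 2 ∂refMeasure 𝒟 U :=
    integral_nonneg fun x => sq_nonneg _
  rw [integral_sub_sq hA (memLp_const _), integral_const_mul, hZ] at h1
  simp only [integral_const, probReal_univ, one_smul] at h1
  rw [Var, secondMoment_eq hU hcell]
  nlinarith

/-- Pythagoras: the second moment of the density ratio exceeds that of the estimator by the mean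
square distance between them. -/
lemma secondMoment_add_integral_sq (hU : IsPotentialPair 𝒟 U) (hcell : 𝒟.cell = 𝒟.pts)
    (hb : b ∈ infiniteTimeFields 𝒟 U) :
    secondMoment 𝒟 U b + ∫ x, (densityRatio U x - estimator 𝒟 U b x) ^ 2 ∂refMeasure 𝒟 U =
      ∫ x, densityRatio U x ^ 2 ∂refMeasure 𝒟 U := by
  have hA := memLp_estimator hU hcell hb
  have hh := memLp_densityRatio hU hcell
  have h1 := (integral_mul_estimator hU.continuousOn hb
    (aemeasurable_estimator hU.continuousOn hb.1)
    (fun x hx t => estimator_flow hb.1 hx t) (hA.integrable_mul hh)).2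
  have h3 : ∫ x, estimator 𝒟 U b x * estimator 𝒟 U b x ∂refMeasure 𝒟 U =
      ∫ x, estimator 𝒟 U b x ^ 2 ∂refMeasure 𝒟 U := by simp only [sq]
  rw [secondMoment_eq hU hcell, integral_sub_sq hh hA, ← h1, h3]
  ring

/-- Among the square-integrable functions that are invariant along the flow, the estimator is the
closest to the density ratio. -/
lemma integral_sq_sub_estimator_le (hU : IsPotentialPair 𝒟 U) (hcell : 𝒟.cell = 𝒟.pts)
    (hb : b ∈ infiniteTimeFields 𝒟 U) {f : E d → ℝ}
    (hf : AEMeasurable f (volume.restrict 𝒟.pts)) (hf2 : MemLp f 2 (refMeasure 𝒟 U))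
    (hinv : ∀ x ∈ 𝒟.pts, ∀ t, f (flow 𝒟 b t x) = f x) :
    ∫ x, (densityRatio U x - estimator 𝒟 U b x) ^ 2 ∂refMeasure 𝒟 U ≤
      ∫ x, (densityRatio U x - f x) ^ 2 ∂refMeasure 𝒟 U := by
  have hA := memLp_estimator hU hcell hb
  have hh := memLp_densityRatio hU hcell
  have h1 := (integral_mul_estimator hU.continuousOn hb hf hinv (hf2.integrable_mul hh)).2
  have h2 : 0 ≤ ∫ x, (estimator 𝒟 U b x - f x) ^ 2 ∂refMeasure 𝒟 U :=
    integral_nonneg fun x => sq_nonneg _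
  have h3 := secondMoment_add_integral_sq hU hcell hb
  rw [integral_sub_sq hA hf2] at h2
  rw [secondMoment_eq hU hcell] at h3
  rw [integral_sub_sq hh hf2, ← h1]
  linarith

end Averaging

/-! ### Integrals of a localized function along trajectories -/

section PastIntegral

variable {d : ℕ} {𝒟 : Domain d} {U : Fin 2 → E d → ℝ} {b β w : E d → E d} {K : Set (E d)}
  {ψ : E d → ℝ} {T C : ℝ}

/-- The integral of `ψ` over the past of the trajectory of `x`. -/
def pastIntegral (𝒟 : Domain d) (β : E d → E d) (ψ : E d → ℝ) (x : E d) : ℝ :=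
  ∫ t in Iic 0, ψ (flow 𝒟 β t x)

/-- The times at which a trajectory is in `K` lie within the transit time of any one of them. -/
lemma HasTransitTime.exists_abs_sub_lt (hT : HasTransitTime 𝒟 β K T) (hβ : β ∈ velocityFields 𝒟)
    {x : E d} (hx : x ∈ 𝒟.pts) : ∃ t₀, ∀ t, flow 𝒟 β t x ∈ K → |t - t₀| < T := by
  by_cases h : ∃ t₀, flow 𝒟 β t₀ x ∈ K
  · obtain ⟨t₀, ht₀⟩ := h
    refine ⟨t₀, fun t ht => ?_⟩
    by_contra! hc
    refine hT _ ht₀ _ hc ?_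
    rwa [← flow_add hβ hx, sub_add_cancel]
  · push Not at h
    exact ⟨0, fun t ht => absurd ht (h t)⟩

lemma HasTransitTime.integrable (hT : HasTransitTime 𝒟 β K T) (hβ : β ∈ velocityFields 𝒟)
    (hψ : ContinuousOn ψ 𝒟.pts) (hψK : ∀ x ∉ K, ψ x = 0) {x : E d} (hx : x ∈ 𝒟.pts) :
    Integrable fun t => ψ (flow 𝒟 β t x) := by
  obtain ⟨t₀, ht₀⟩ := hT.exists_abs_sub_lt hβ hx
  refine (hψ.comp_continuous (continuous_flow_time hβ hx)
    fun t => flow_mem hβ hx t).integrable_of_hasCompactSupport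
    (HasCompactSupport.intro (isCompact_closedBall t₀ T) fun t ht => hψK _ fun h => ht ?_)
  rw [Metric.mem_closedBall, Real.dist_eq]
  exact (ht₀ t h).le

lemma HasTransitTime.integral_abs_le (hT : HasTransitTime 𝒟 β K T) (hβ : β ∈ velocityFields 𝒟)
    (hT0 : 0 ≤ T) (hψK : ∀ x ∉ K, ψ x = 0) (hC : ∀ x, |ψ x| ≤ C) {x : E d} (hx : x ∈ 𝒟.pts) :
    ∫ t, |ψ (flow 𝒟 β t x)| ≤ C * (2 * T) := by
  obtain ⟨t₀, ht₀⟩ := hT.exists_abs_sub_lt hβ hx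
  have h1 : ∫ t in Metric.closedBall t₀ T, |ψ (flow 𝒟 β t x)| = ∫ t, |ψ (flow 𝒟 β t x)| := by
    refine setIntegral_eq_integral_of_forall_compl_eq_zero fun t ht => ?_
    rw [hψK _ fun h => ht ?_, abs_zero]
    rw [Metric.mem_closedBall, Real.dist_eq]
    exact (ht₀ t h).le
  have h2 := norm_setIntegral_le_of_norm_le_const (μ := volume) (s := Metric.closedBall t₀ T)
    (f := fun t => |ψ (flow 𝒟 β t x)|) (C := C) (isCompact_closedBall t₀ T).measure_lt_top
    fun t _ => by rw [Real.norm_eq_abs, abs_abs]; exact hC _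
  rw [h1, measureReal_def, Real.volume_closedBall, ENNReal.toReal_ofReal (by positivity)] at h2
  exact (le_abs_self _).trans h2

lemma HasTransitTime.abs_pastIntegral_le (hT : HasTransitTime 𝒟 β K T)
    (hβ : β ∈ velocityFields 𝒟) (hT0 : 0 ≤ T) (hψ : ContinuousOn ψ 𝒟.pts)
    (hψK : ∀ x ∉ K, ψ x = 0) (hC : ∀ x, |ψ x| ≤ C) {x : E d} (hx : x ∈ 𝒟.pts) :
    |pastIntegral 𝒟 β ψ x| ≤ C * (2 * T) := by
  refine (abs_integral_le_integral_abs).trans (le_trans ?_ (hT.integral_abs_le hβ hT0 hψK hC hx))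
  exact setIntegral_le_integral (hT.integrable hβ hψ hψK hx).abs
    (Eventually.of_forall fun t => abs_nonneg _)

lemma HasTransitTime.pastIntegral_flow (hT : HasTransitTime 𝒟 β K T) (hβ : β ∈ velocityFields 𝒟)
    (hψ : ContinuousOn ψ 𝒟.pts) (hψK : ∀ x ∉ K, ψ x = 0) {x : E d} (hx : x ∈ 𝒟.pts) (s : ℝ) :
    pastIntegral 𝒟 β ψ (flow 𝒟 β s x) =
      pastIntegral 𝒟 β ψ x + ∫ t in (0 : ℝ)..s, ψ (flow 𝒟 β t x) := by
  have hi := hT.integrable hβ hψ hψK hx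
  have h1 : ∫ t in Iic 0, ψ (flow 𝒟 β (t + s) x) = ∫ t in Iic s, ψ (flow 𝒟 β t x) := by
    have := (measurePreserving_add_right volume s).setIntegral_preimage_emb
      (measurableEmbedding_addRight s) (fun t => ψ (flow 𝒟 β t x)) (Iic s)
    simpa using this
  have h2 := intervalIntegral.integral_Iic_sub_Iic (a := (0 : ℝ)) (b := s) hi.integrableOn
    hi.integrableOn
  simp only [pastIntegral, ← flow_add hβ hx]
  rw [h1]
  linarith

lemma continuousOn_comp_flow (hβ : β ∈ velocityFields 𝒟) (hψ : ContinuousOn ψ 𝒟.pts) :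
    ContinuousOn (fun p : E d × ℝ => ψ (flow 𝒟 β p.2 p.1)) (𝒟.pts ×ˢ univ) := by
  refine hψ.comp (f := fun p : E d × ℝ => flow 𝒟 β p.2 p.1) ?_ fun p hp => flow_mem hβ hp.1 p.2
  exact (continuousOn_flow hβ).comp (f := fun p : E d × ℝ => (p.2, p.1)) (by fun_prop)
    fun _ hp => ⟨mem_univ _, hp.1⟩

lemma aestronglyMeasurable_pastIntegral (hβ : β ∈ velocityFields 𝒟) (hψ : ContinuousOn ψ 𝒟.pts) :
    AEStronglyMeasurable (pastIntegral 𝒟 β ψ) (volume.restrict 𝒟.pts) :=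
  (aestronglyMeasurable_prod_restrict (f := fun x t => ψ (flow 𝒟 β t x)) measurableSet_Iic
    (continuousOn_comp_flow hβ hψ)).integral_prod_right'

/-- The integrals over the past of the perturbed trajectories depend continuously on the
perturbation, because the perturbed trajectories of a point meet the support of `ψ` in uniformly
bounded times. -/
lemma tendsto_pastIntegral (h : HasContinuousIntegrals 𝒟 U b) (hw : ContDiff ℝ ∞ w)
    (hwc : HasCompactSupport w) (hwp : tsupport w ⊆ 𝒟.pts)
    (hb : ∀ ε : ℝ, b + ε • w ∈ velocityFields 𝒟)
    (hT : ∀ᶠ ε in 𝓝 (0 : ℝ), HasTransitTime 𝒟 (b + ε • w) (tsupport w) T)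
    (hψ : ContinuousOn ψ 𝒟.pts) (hψK : ∀ x ∉ tsupport w, ψ x = 0) (hC : ∀ x, |ψ x| ≤ C)
    {x : E d} (hx : x ∈ 𝒟.pts) :
    Tendsto (fun ε : ℝ => pastIntegral 𝒟 (b + ε • w) ψ x) (𝓝 0) (𝓝 (pastIntegral 𝒟 b ψ x)) := by
  have hb0 : b ∈ velocityFields 𝒟 := by simpa using hb 0
  obtain ⟨S, hS, hSx⟩ := h.exists_perturbed_flow_notMem hwc.isCompact hwp hb0
    (isCompact_singleton (x := x)) (singleton_subset_iff.2 hx) T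
  refine tendsto_integral_filter_of_dominated_convergence
    (fun t => (Metric.closedBall (0 : ℝ) S).indicator (fun _ => C) t) ?_ ?_ ?_ ?_
  · refine Eventually.of_forall fun ε => Continuous.aestronglyMeasurable ?_
    exact hψ.comp_continuous (continuous_flow_time (hb ε) hx) fun t => flow_mem (hb ε) hx t
  · filter_upwards [hT] with ε hε
    refine Eventually.of_forall fun t => ?_
    by_cases ht : t ∈ Metric.closedBall (0 : ℝ) S
    · rw [indicator_of_mem ht]; exact hC _
    · rw [indicator_of_notMem ht, hψK, norm_zero]
      refine hSx _ (hb ε) (fun y hy => by simp [image_eq_zero_of_notMem_tsupport hy]) hε x rfl t ?_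
      rw [Metric.mem_closedBall, dist_zero_right, Real.norm_eq_abs] at ht
      exact (not_le.1 ht).le
  · refine (IntegrableOn.integrable_indicator ?_
      Metric.isClosed_closedBall.measurableSet).integrableOn
    exact integrableOn_const (isCompact_closedBall (0 : ℝ) S).measure_lt_top.ne
  · refine Eventually.of_forall fun t => ?_
    have h1 : ContinuousAt (fun ε : ℝ => flow 𝒟 (b + ε • w) t x) 0 :=
      ContinuousAt.comp (x := (0 : ℝ))
        (g := fun p : ℝ × E d × ℝ => flow 𝒟 (b + p.2.2 • w) p.1 p.2.1)
        (f := fun ε : ℝ => (t, x, ε)) (continuousAt_flow_param hw hb hx t 0) (by fun_prop)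
    have h2 : ContinuousAt ψ (flow 𝒟 (b + (0 : ℝ) • w) t x) :=
      hψ.continuousAt (𝒟.isOpen_pts.mem_nhds (flow_mem (hb 0) hx t))
    have h3 := ContinuousAt.comp (x := (0 : ℝ)) (g := ψ) h2 h1
    simpa [ContinuousAt, Function.comp_def] using h3

end PastIntegral

/-! ### First variation of the variance -/

section FirstVariation

variable {d : ℕ} {𝒟 : Domain d} {U : Fin 2 → E d → ℝ} {b w : E d → E d} {T C ε : ℝ}

/-- If `D` has zero derivative at `0` and lies below `D 0 + ε a(ε) + O(ε²)`, then `a` vanishes at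
`0`: the bound controls the right and the left difference quotients of `D` from opposite sides. -/
lemma eq_zero_of_le_add_mul {D a : ℝ → ℝ} {a₀ B : ℝ} (hD : HasDerivAt D 0 0)
    (ha : Tendsto a (𝓝 0) (𝓝 a₀))
    (h : ∀ᶠ ε in 𝓝 (0 : ℝ), D ε ≤ D 0 + ε * a ε + ε ^ 2 * B) : a₀ = 0 := by
  have ha' : Tendsto (fun ε => a ε + ε * B) (𝓝 0) (𝓝 a₀) := by
    simpa using ha.add (tendsto_id.mul_const B)
  refine le_antisymm ?_ ?_
  · refine le_of_tendsto_of_tendsto (ha'.mono_left nhdsWithin_le_nhds)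
      hD.tendsto_slope_zero_left ?_
    filter_upwards [h.filter_mono nhdsWithin_le_nhds, self_mem_nhdsWithin] with ε hε hlt
    have hlt : ε < 0 := hlt
    rw [zero_add, smul_eq_mul, inv_mul_eq_div, le_div_iff_of_neg hlt]
    linarith
  · refine le_of_tendsto_of_tendsto hD.tendsto_slope_zero_right
      (ha'.mono_left nhdsWithin_le_nhds) ?_
    filter_upwards [h.filter_mono nhdsWithin_le_nhds, self_mem_nhdsWithin] with ε hε hlt
    have hlt : 0 < ε := hlt
    rw [zero_add, smul_eq_mul, inv_mul_eq_div, div_le_iff₀ hlt]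
    linarith

/-- The derivative of the estimator of `b` along the field `w`. -/
def estimatorDeriv (𝒟 : Domain d) (U : Fin 2 → E d → ℝ) (b w : E d → E d) (x : E d) : ℝ :=
  fderiv ℝ (estimator 𝒟 U b) x (w x)

lemma hasDerivAt_estimator_flow {β : E d → E d} (hβ : β ∈ velocityFields 𝒟)
    (hA : ∀ x ∈ 𝒟.pts, DifferentiableAt ℝ (estimator 𝒟 U b) x) {x : E d} (hx : x ∈ 𝒟.pts) (t : ℝ) :
    HasDerivAt (fun s => estimator 𝒟 U b (flow 𝒟 β s x))
      (estimatorDeriv 𝒟 U b β (flow 𝒟 β t x)) t :=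
  HasFDerivAt.comp_hasDerivAt (l := estimator 𝒟 U b) (f := fun s => flow 𝒟 β s x) t
    (hA _ (flow_mem hβ hx t)).hasFDerivAt (hasDerivAt_flow hβ hx t)

lemma estimatorDeriv_self (hb : b ∈ velocityFields 𝒟)
    (hA : ∀ x ∈ 𝒟.pts, DifferentiableAt ℝ (estimator 𝒟 U b) x) {x : E d} (hx : x ∈ 𝒟.pts) :
    estimatorDeriv 𝒟 U b b x = 0 := by
  have h1 := hasDerivAt_estimator_flow hb hA hx 0
  simp only [estimator_flow hb hx, flow_zero hb hx] at h1
  exact h1.unique (hasDerivAt_const _ _)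

lemma estimatorDeriv_add_smul (hb : b ∈ velocityFields 𝒟)
    (hA : ∀ x ∈ 𝒟.pts, DifferentiableAt ℝ (estimator 𝒟 U b) x) {x : E d} (hx : x ∈ 𝒟.pts) (ε : ℝ) :
    estimatorDeriv 𝒟 U b (b + ε • w) x = ε * estimatorDeriv 𝒟 U b w x := by
  have h := estimatorDeriv_self hb hA hx
  rw [estimatorDeriv] at h
  simp [estimatorDeriv, h]

lemma continuousOn_estimatorDeriv (hA' : ContinuousOn (fderiv ℝ (estimator 𝒟 U b)) 𝒟.pts)
    (hw : Continuous w) : ContinuousOn (estimatorDeriv 𝒟 U b w) 𝒟.pts :=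
  hA'.clm_apply hw.continuousOn

lemma estimatorDeriv_eq_zero {x : E d} (hx : x ∉ tsupport w) : estimatorDeriv 𝒟 U b w x = 0 := by
  simp [estimatorDeriv, image_eq_zero_of_notMem_tsupport hx]

lemma exists_abs_estimatorDeriv_le (hA' : ContinuousOn (fderiv ℝ (estimator 𝒟 U b)) 𝒟.pts)
    (hw : Continuous w) (hwc : HasCompactSupport w) (hwp : tsupport w ⊆ 𝒟.pts) :
    ∃ C, ∀ x, |estimatorDeriv 𝒟 U b w x| ≤ C := by
  obtain ⟨C, hC⟩ := hwc.isCompact.exists_bound_of_continuousOn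
    ((continuousOn_estimatorDeriv hA' hw).mono hwp)
  refine ⟨max C 0, fun x => ?_⟩
  by_cases hx : x ∈ tsupport w
  · exact (hC x hx).trans (le_max_left _ _)
  · rw [estimatorDeriv_eq_zero hx, abs_zero]
    exact le_max_right _ _

/-- Subtracting the integral of its derivative over the past makes the estimator of `b` invariant
along the perturbed flow. -/
lemma estimator_sub_pastIntegral_flow
    (hb0 : b ∈ velocityFields 𝒟) (hb : b + ε • w ∈ velocityFields 𝒟)
    (hT : HasTransitTime 𝒟 (b + ε • w) (tsupport w) T) (hw : Continuous w)
    (hA : ∀ x ∈ 𝒟.pts, DifferentiableAt ℝ (estimator 𝒟 U b) x)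
    (hA' : ContinuousOn (fderiv ℝ (estimator 𝒟 U b)) 𝒟.pts) {x : E d} (hx : x ∈ 𝒟.pts) (s : ℝ) :
    estimator 𝒟 U b (flow 𝒟 (b + ε • w) s x) -
        ε * pastIntegral 𝒟 (b + ε • w) (estimatorDeriv 𝒟 U b w) (flow 𝒟 (b + ε • w) s x) =
      estimator 𝒟 U b x - ε * pastIntegral 𝒟 (b + ε • w) (estimatorDeriv 𝒟 U b w) x := by
  have hψ := continuousOn_estimatorDeriv hA' hw
  have h1 := intervalIntegral.integral_eq_sub_of_hasDerivAt (a := 0) (b := s)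
    (f := fun s => estimator 𝒟 U b (flow 𝒟 (b + ε • w) s x))
    (f' := fun t => ε * estimatorDeriv 𝒟 U b w (flow 𝒟 (b + ε • w) t x)) (fun t _ => by
      rw [← estimatorDeriv_add_smul hb0 hA (flow_mem hb hx t)]
      exact hasDerivAt_estimator_flow hb hA hx t)
    (((hψ.comp_continuous (continuous_flow_time hb hx)
      fun t => flow_mem hb hx t).const_mul ε).intervalIntegrable _ _)
  rw [intervalIntegral.integral_const_mul, flow_zero hb hx] at h1
  rw [hT.pastIntegral_flow hb hψ (fun x hx => estimatorDeriv_eq_zero hx) hx s]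
  linarith

/-- The variance and the mean square distance of the estimator from the density ratio have a
constant sum. -/
lemma integral_sq_sub_estimator_eq (hU : IsPotentialPair 𝒟 U) (hcell : 𝒟.cell = 𝒟.pts)
    (hb : b ∈ infiniteTimeFields 𝒟 U) :
    ∫ x, (densityRatio U x - estimator 𝒟 U b x) ^ 2 ∂refMeasure 𝒟 U =
      ∫ x, densityRatio U x ^ 2 ∂refMeasure 𝒟 U - partitionZ 𝒟 U 1 ^ 2 - Var 𝒟 U b := by
  rw [Var]
  linarith [secondMoment_add_integral_sq hU hcell hb]

/-- At a stationary point of the variance, the first variation of the estimator is orthogonal to the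
distance of the estimator from the density ratio. The competitor
`A - ε ∫_{-∞}^0 ∂_w A (X^ε_t) dt`, invariant along the perturbed flow, bounds the variance of the
perturbed field from below to first order in `ε`. -/
theorem integral_pastIntegral_mul_eq_zero (hU : IsPotentialPair 𝒟 U) (hcell : 𝒟.cell = 𝒟.pts)
    (h : HasContinuousIntegrals 𝒟 U b) (hw : ContDiff ℝ ∞ w) (hwc : HasCompactSupport w)
    (hwp : tsupport w ⊆ 𝒟.pts) (hb : ∀ ε : ℝ, b + ε • w ∈ velocityFields 𝒟)
    (hA : ∀ x ∈ 𝒟.pts, DifferentiableAt ℝ (estimator 𝒟 U b) x)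
    (hA' : ContinuousOn (fderiv ℝ (estimator 𝒟 U b)) 𝒟.pts)
    (hVar : HasDerivAt (fun ε : ℝ => Var 𝒟 U (b + ε • w)) 0 0) :
    ∫ x, pastIntegral 𝒟 b (estimatorDeriv 𝒟 U b w) x *
      (densityRatio U x - estimator 𝒟 U b x) ∂refMeasure 𝒟 U = 0 := by
  have := isProbabilityMeasure_refMeasure hU hcell
  have hb0 : b ∈ velocityFields 𝒟 := by simpa using hb 0
  obtain ⟨T, hT0, hT⟩ := h.exists_hasTransitTime hw hwc hwp hb
  have hψ := continuousOn_estimatorDeriv hA' hw.continuous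
  have hψK : ∀ x ∉ tsupport w, estimatorDeriv 𝒟 U b w x = 0 := fun x hx => estimatorDeriv_eq_zero hx
  obtain ⟨C, hC⟩ := exists_abs_estimatorDeriv_le hA' hw.continuous hwc hwp
  have hinf : ∀ᶠ ε in 𝓝 (0 : ℝ), b + ε • w ∈ infiniteTimeFields 𝒟 U := by
    filter_upwards [hT] with ε hε
    exact (h.perturbed hU.continuousOn hwc.isCompact hwp hb0 (hb ε)
      (fun x hx => by simp [image_eq_zero_of_notMem_tsupport hx]) hε).mem_infiniteTimeFields (hb ε)
  have hh := memLp_densityRatio hU hcell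
  have hA2 := memLp_estimator hU hcell (h.mem_infiniteTimeFields hb0)
  set r : E d → ℝ := fun x => densityRatio U x - estimator 𝒟 U b x with hr
  have hr2 : MemLp r 2 (refMeasure 𝒟 U) := hh.sub hA2
  set u : ℝ → E d → ℝ := fun ε => pastIntegral 𝒟 (b + ε • w) (estimatorDeriv 𝒟 U b w) with hu
  have hum : ∀ ε, AEStronglyMeasurable (u ε) (volume.restrict 𝒟.pts) :=
    fun ε => aestronglyMeasurable_pastIntegral (hb ε) hψ
  have hub : ∀ᶠ ε in 𝓝 (0 : ℝ), ∀ᵐ x ∂refMeasure 𝒟 U, ‖u ε x‖ ≤ C * (2 * T) := by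
    filter_upwards [hT] with ε hε
    exact ae_refMeasure_of_forall fun x hx =>
      hε.abs_pastIntegral_le (hb ε) hT0.le hψ hψK hC hx
  have hu2 : ∀ᶠ ε in 𝓝 (0 : ℝ), MemLp (u ε) 2 (refMeasure 𝒟 U) := by
    filter_upwards [hub] with ε hε
    exact MemLp.of_bound ((hum ε).mono_ac refMeasure_absolutelyContinuous) _ hε
  have hlim : Tendsto (fun ε => 2 * ∫ x, u ε x * r x ∂refMeasure 𝒟 U) (𝓝 0)
      (𝓝 (2 * ∫ x, pastIntegral 𝒟 b (estimatorDeriv 𝒟 U b w) x * r x ∂refMeasure 𝒟 U)) := by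
    refine Tendsto.const_mul 2 ?_
    refine tendsto_integral_filter_of_dominated_convergence (fun x => C * (2 * T) * ‖r x‖) ?_ ?_
      ((hr2.integrable one_le_two).norm.const_mul _) ?_
    · exact Eventually.of_forall fun ε =>
        ((hum ε).mono_ac refMeasure_absolutelyContinuous).mul hr2.aestronglyMeasurable
    · filter_upwards [hub] with ε hε
      filter_upwards [hε] with x hx
      rw [norm_mul]
      exact mul_le_mul_of_nonneg_right hx (norm_nonneg _)
    · exact ae_refMeasure_of_forall fun x hx =>
        (tendsto_pastIntegral h hw hwc hwp hb hT hψ hψK hC hx).mul_const _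
  have hle : ∀ᶠ ε in 𝓝 (0 : ℝ), -Var 𝒟 U (b + ε • w) ≤ -Var 𝒟 U (b + (0 : ℝ) • w) +
      ε * (2 * ∫ x, u ε x * r x ∂refMeasure 𝒟 U) + ε ^ 2 * (C * (2 * T)) ^ 2 := by
    filter_upwards [hT, hinf, hub, hu2] with ε hεT hε huε hu2ε
    have h1 := integral_sq_sub_estimator_le hU hcell hε
      (f := fun x => estimator 𝒟 U b x - ε * u ε x)
      ((aemeasurable_estimator hU.continuousOn hb0).sub ((hum ε).aemeasurable.const_mul ε))
      (hA2.sub (hu2ε.const_mul ε))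
      (fun x hx s => estimator_sub_pastIntegral_flow hb0 (hb ε) hεT hw.continuous hA hA' hx s)
    have h2 : ∫ x, (densityRatio U x - (estimator 𝒟 U b x - ε * u ε x)) ^ 2 ∂refMeasure 𝒟 U =
        ∫ x, (r x - (-ε) * u ε x) ^ 2 ∂refMeasure 𝒟 U := by
      congr 1; ext x; rw [hr]; ring
    have h3 : ∫ x, ((-ε) * u ε x) ^ 2 ∂refMeasure 𝒟 U ≤ ε ^ 2 * (C * (2 * T)) ^ 2 := by
      have h4 : ∫ x, ((-ε) * u ε x) ^ 2 ∂refMeasure 𝒟 U ≤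
          ∫ _, ε ^ 2 * (C * (2 * T)) ^ 2 ∂refMeasure 𝒟 U := by
        refine integral_mono_ae (hu2ε.const_mul (-ε)).integrable_sq (integrable_const _) ?_
        filter_upwards [huε] with x hx
        rw [mul_pow, neg_sq, ← sq_abs (u ε x), ← Real.norm_eq_abs]
        exact mul_le_mul_of_nonneg_left (pow_le_pow_left₀ (norm_nonneg _) hx 2) (sq_nonneg ε)
      simpa using h4
    have h5 : ∫ x, (-ε) * u ε x * r x ∂refMeasure 𝒟 U = -ε * ∫ x, u ε x * r x ∂refMeasure 𝒟 U := by
      rw [← integral_const_mul]; congr 1; ext x; ring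
    rw [h2, integral_sub_sq hr2 (hu2ε.const_mul (-ε)), h5, integral_sq_sub_estimator_eq hU hcell hε,
      integral_sq_sub_estimator_eq hU hcell (h.mem_infiniteTimeFields hb0)] at h1
    rw [zero_smul, add_zero]
    linarith
  have := eq_zero_of_le_add_mul (by simpa using hVar.fun_neg) hlim hle
  simpa using this

end FirstVariation

/-! ### The first variation as an integral over the domain -/

section Stationarity

variable {d : ℕ} {𝒟 : Domain d} {U : Fin 2 → E d → ℝ} {b w : E d → E d} {K : Set (E d)}
  {ψ : E d → ℝ}

/-- The difference `∫_0^∞ (F^{(1)}_t - A F^{(0)}_t) dt` over the future; the integral over all times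
vanishes by definition of the estimator `A`. -/
def futureExcess (𝒟 : Domain d) (U : Fin 2 → E d → ℝ) (b : E d → E d) (x : E d) : ℝ :=
  (∫ t in Ioi 0, F 𝒟 U b 1 t x) - estimator 𝒟 U b x * ∫ t in Ioi 0, F 𝒟 U b 0 t x

lemma HasContinuousIntegrals.continuousOn_futureExcess (h : HasContinuousIntegrals 𝒟 U b)
    (hb : b ∈ velocityFields 𝒟) : ContinuousOn (futureExcess 𝒟 U b) 𝒟.pts :=
  (h.continuousOn_Ioi 1).sub ((h.continuousOn_estimator hb).mul (h.continuousOn_Ioi 0))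

lemma integrableOn_of_continuousOn_of_compact {f : E d → ℝ} (hf : ContinuousOn f 𝒟.pts)
    (hK : IsCompact K) (hKp : K ⊆ 𝒟.pts) (hfK : ∀ x ∉ K, f x = 0) : IntegrableOn f 𝒟.pts :=
  ((hf.mono hKp).integrableOn_compact hK).of_forall_sdiff_eq_zero 𝒟.isOpen_pts.measurableSet
    fun x hx => hfK x hx.2

/-- Fubini's theorem and the change of variables `y = X_t x` turn the integral of a function `ψ`
over past trajectories, weighted by `ρ₁ - A ρ₀`, into the integral of `ψ` weighted by the future. -/
theorem integral_pastIntegral_mul_eq (hU : IsPotentialPair 𝒟 U) (hcell : 𝒟.cell = 𝒟.pts)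
    (h : HasContinuousIntegrals 𝒟 U b) (hb : b ∈ velocityFields 𝒟)
    (hψ : ContinuousOn ψ 𝒟.pts) (hK : IsCompact K) (hKp : K ⊆ 𝒟.pts) (hψK : ∀ x ∉ K, ψ x = 0) :
    ∫ x, pastIntegral 𝒟 b ψ x * (densityRatio U x - estimator 𝒟 U b x) ∂refMeasure 𝒟 U =
      ∫ y in 𝒟.pts, ψ y * futureExcess 𝒟 U b y := by
  have := isProbabilityMeasure_refMeasure hU hcell
  have hUc := hU.continuousOn
  have hm := 𝒟.isOpen_pts.measurableSet
  obtain ⟨T, hT0, hT⟩ : ∃ T > 0, HasTransitTime 𝒟 b K T := h.exists_flow_notMem hb hK hKp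
  obtain ⟨C, hC⟩ : ∃ C, ∀ x, |ψ x| ≤ C := by
    obtain ⟨C, hC⟩ := hK.exists_bound_of_continuousOn (hψ.mono hKp)
    refine ⟨max C 0, fun x => ?_⟩
    by_cases hx : x ∈ K
    · exact (hC x hx).trans (le_max_left _ _)
    · rw [hψK x hx, abs_zero]
      exact le_max_right _ _
  have hAc := h.continuousOn_estimator hb
  set A := estimator 𝒟 U b with hA
  set c : E d → ℝ := fun x => (densityRatio U x - A x) * Real.exp (-U 0 x) with hc
  have hcc : ContinuousOn c 𝒟.pts :=
    ((continuousOn_densityRatio hUc).sub hAc).mul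
      (Real.continuous_exp.comp_continuousOn (hUc 0).neg)
  have hci : IntegrableOn c 𝒟.pts := (integrable_refMeasure_iff hUc _).1
    (((memLp_densityRatio hU hcell).sub
      (memLp_estimator hU hcell (h.mem_infiniteTimeFields hb))).integrable one_le_two)
  have hint1 : Integrable (Function.uncurry fun x t => ψ (flow 𝒟 b t x) * c x)
      ((volume.restrict 𝒟.pts).prod (volume.restrict (Iic (0 : ℝ)))) := by
    have hmeas := aestronglyMeasurable_prod_restrict (f := fun x t => ψ (flow 𝒟 b t x) * c x)
      (measurableSet_Iic (a := (0 : ℝ))) ((continuousOn_comp_flow hb hψ).mul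
        (hcc.comp continuousOn_fst fun p hp => hp.1))
    refine (integrable_prod_iff hmeas).2 ⟨?_, (hci.norm.const_mul (C * (2 * T))).mono'
      hmeas.norm.integral_prod_right' ?_⟩
    · filter_upwards [ae_restrict_mem hm] with x hx
      exact ((hT.integrable hb hψ hψK hx).mul_const (c x)).integrableOn
    · filter_upwards [ae_restrict_mem hm] with x hx
      simp only [Function.uncurry, norm_mul]
      rw [integral_mul_const, norm_mul, norm_norm]
      refine mul_le_mul_of_nonneg_right ?_ (norm_nonneg _)
      rw [Real.norm_of_nonneg (integral_nonneg fun t => norm_nonneg _)]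
      exact (setIntegral_le_integral (hT.integrable hb hψ hψK hx).norm
        (Eventually.of_forall fun t => norm_nonneg _)).trans
        (hT.integral_abs_le hb hT0.le hψK hC hx)
  -- the past weights of `y`, as functions of the negative time `t`
  have hFneg : ∀ k, ∀ y ∈ 𝒟.pts, IntegrableOn (fun t => F 𝒟 U b k (-t) y) (Iic 0) :=
    fun k y hy => (h.integrable k y hy).comp_neg.integrableOn
  have hFint : ∀ k y, ∫ t in Iic 0, F 𝒟 U b k (-t) y = ∫ t in Ioi 0, F 𝒟 U b k t y := by
    intro k y
    simpa using integral_comp_neg_Iic 0 fun t => F 𝒟 U b k t y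
  have hFc : ∀ k, ContinuousOn (fun p : E d × ℝ => F 𝒟 U b k (-p.2) p.1) (𝒟.pts ×ˢ univ) :=
    fun k => (continuousOn_F hUc hb k).comp (f := fun p : E d × ℝ => (-p.2, p.1)) (by fun_prop)
      fun _ hp => ⟨mem_univ _, hp.1⟩
  have hint2 : Integrable (Function.uncurry fun y t =>
      ψ y * (F 𝒟 U b 1 (-t) y - A y * F 𝒟 U b 0 (-t) y))
      ((volume.restrict 𝒟.pts).prod (volume.restrict (Iic (0 : ℝ)))) := by
    have hfst : ∀ {f : E d → ℝ}, ContinuousOn f 𝒟.pts →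
        ContinuousOn (fun p : E d × ℝ => f p.1) (𝒟.pts ×ˢ univ) :=
      fun hf => hf.comp continuousOn_fst fun p hp => hp.1
    have hmeas := aestronglyMeasurable_prod_restrict (f := fun y t =>
      ψ y * (F 𝒟 U b 1 (-t) y - A y * F 𝒟 U b 0 (-t) y))
      (measurableSet_Iic (a := (0 : ℝ))) ((hfst hψ).mul ((hFc 1).sub ((hfst hAc).mul (hFc 0))))
    have hdom : IntegrableOn (fun y => |ψ y| * ((∫ t in Ioi 0, F 𝒟 U b 1 t y) +
        A y * ∫ t in Ioi 0, F 𝒟 U b 0 t y)) 𝒟.pts :=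
      integrableOn_of_continuousOn_of_compact (hψ.abs.mul ((h.continuousOn_Ioi 1).add
        (hAc.mul (h.continuousOn_Ioi 0)))) hK hKp fun x hx => by simp [hψK x hx]
    refine (integrable_prod_iff hmeas).2 ⟨?_, hdom.mono' hmeas.norm.integral_prod_right' ?_⟩
    · filter_upwards [ae_restrict_mem hm] with y hy
      exact ((hFneg 1 y hy).sub ((hFneg 0 y hy).const_mul (A y))).const_mul (ψ y)
    · filter_upwards [ae_restrict_mem hm] with y hy
      simp only [Function.uncurry, norm_mul]
      rw [integral_const_mul, norm_mul, norm_norm,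
        Real.norm_of_nonneg (integral_nonneg fun t => norm_nonneg _)]
      refine mul_le_mul_of_nonneg_left ?_ (norm_nonneg _)
      rw [← hFint, ← hFint, ← integral_const_mul,
        ← integral_add (hFneg 1 y hy) ((hFneg 0 y hy).const_mul _)]
      refine integral_mono_of_nonneg (Eventually.of_forall fun t => norm_nonneg _)
        ((hFneg 1 y hy).add ((hFneg 0 y hy).const_mul _)) (Eventually.of_forall fun t => ?_)
      refine (norm_sub_le _ _).trans (le_of_eq ?_)
      rw [Real.norm_of_nonneg (F_pos hb hy 1 _).le, Real.norm_of_nonneg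
        (mul_nonneg (estimator_nonneg hb hy) (F_pos hb hy 0 _).le)]
  calc ∫ x, pastIntegral 𝒟 b ψ x * (densityRatio U x - A x) ∂refMeasure 𝒟 U
      = ∫ x in 𝒟.pts, ∫ t in Iic 0, ψ (flow 𝒟 b t x) * c x := by
        rw [integral_refMeasure hUc]
        refine integral_congr_ae (Eventually.of_forall fun x => ?_)
        simp only [integral_mul_const, pastIntegral, hc, mul_assoc]
    _ = ∫ t in Iic 0, ∫ x in 𝒟.pts, ψ (flow 𝒟 b t x) * c x := integral_integral_swap hint1
    _ = ∫ t in Iic 0, ∫ y in 𝒟.pts, ψ y * (F 𝒟 U b 1 (-t) y - A y * F 𝒟 U b 0 (-t) y) := by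
        refine integral_congr_ae (Eventually.of_forall fun t => ?_)
        dsimp only
        rw [← integral_comp_flow hb t fun y => ψ y * (F 𝒟 U b 1 (-t) y - A y * F 𝒟 U b 0 (-t) y)]
        refine setIntegral_congr_fun hm fun x hx => ?_
        have hJ : jac 𝒟 b (-t) (flow 𝒟 b t x) * jac 𝒟 b t x = 1 := by
          rw [← jac_add hb hx, neg_add_cancel, jac_zero hb hx]
        simp only [F, flow_neg_flow hb hx, hA, estimator_flow hb hx, hc, sub_mul,
          densityRatio_mul_exp]
        linear_combination (-(ψ (flow 𝒟 b t x) * (Real.exp (-U 1 x) -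
          estimator 𝒟 U b x * Real.exp (-U 0 x)))) * hJ
    _ = ∫ y in 𝒟.pts, ∫ t in Iic 0, ψ y * (F 𝒟 U b 1 (-t) y - A y * F 𝒟 U b 0 (-t) y) :=
        (integral_integral_swap hint2).symm
    _ = ∫ y in 𝒟.pts, ψ y * futureExcess 𝒟 U b y := by
        refine setIntegral_congr_fun hm fun y hy => ?_
        rw [integral_const_mul, integral_sub (hFneg 1 y hy) ((hFneg 0 y hy).const_mul _),
          integral_const_mul, hFint, hFint, futureExcess]

/-- A domain that is a subset of `ℝ^d` has no periods, so that every function is periodic. -/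
lemma isPeriodic_of_periods_eq_bot (hper : 𝒟.periods = ⊥) {α : Type*} (f : E d → α) :
    𝒟.IsPeriodic f := by
  intro v hv x
  rw [hper, Submodule.mem_bot] at hv
  rw [hv, add_zero]

lemma mem_testFields (hper : 𝒟.periods = ⊥) (hw : ContDiff ℝ ∞ w) (hwc : HasCompactSupport w)
    (hwp : tsupport w ⊆ 𝒟.pts) : w ∈ 𝒟.testFields :=
  ⟨hw, isPeriodic_of_periods_eq_bot hper w, tsupport w, hwc.isCompact, hwp, fun x hx =>
    ⟨0, zero_mem _, by rw [add_zero]; exact subset_tsupport w hx⟩⟩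

/-- Every test field is admissible. -/
lemma HasContinuousIntegrals.isAdmissible (h : HasContinuousIntegrals 𝒟 U b)
    (hU : IsPotentialPair 𝒟 U) (hper : 𝒟.periods = ⊥) (hb : b ∈ velocityFields 𝒟)
    (hw : ContDiff ℝ ∞ w) (hwc : HasCompactSupport w) (hwp : tsupport w ⊆ 𝒟.pts) :
    IsAdmissible 𝒟 U b w := by
  have hbw := add_smul_mem_velocityFields hb hw hwc hwp (isPeriodic_of_periods_eq_bot hper w)
  obtain ⟨T, -, hT⟩ := h.exists_hasTransitTime hw hwc hwp hbw
  refine ⟨mem_testFields hper hw hwc hwp, ?_⟩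
  filter_upwards [hT] with ε hε
  exact (h.perturbed hU.continuousOn hwc.isCompact hwp hb (hbw ε)
    (fun x hx => by simp [image_eq_zero_of_notMem_tsupport hx]) hε).mem_infiniteTimeFields (hbw ε)

/-- The Euler-Lagrange equation of the variance. -/
theorem futureExcess_smul_fderiv_estimator_eq_zero (hU : IsPotentialPair 𝒟 U)
    (hcell : 𝒟.cell = 𝒟.pts) (hper : 𝒟.periods = ⊥)
    (h : HasContinuousIntegrals 𝒟 U b) (hb : b ∈ velocityFields 𝒟)
    (hA : ∀ x ∈ 𝒟.pts, DifferentiableAt ℝ (estimator 𝒟 U b) x)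
    (hA' : ContinuousOn (fderiv ℝ (estimator 𝒟 U b)) 𝒟.pts)
    (hVar : ∀ w, IsAdmissible 𝒟 U b w → HasDerivAt (fun ε : ℝ => Var 𝒟 U (b + ε • w)) 0 0)
    {x : E d} (hx : x ∈ 𝒟.pts) :
    futureExcess 𝒟 U b x • fderiv ℝ (estimator 𝒟 U b) x = 0 := by
  ext e
  set f : E d → ℝ := fun y => futureExcess 𝒟 U b y * fderiv ℝ (estimator 𝒟 U b) y e with hf
  have hfc : ContinuousOn f 𝒟.pts :=
    (h.continuousOn_futureExcess hb).mul (hA'.clm_apply continuousOn_const)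
  have hae : ∀ᵐ y, y ∈ 𝒟.pts → f y = 0 := by
    refine 𝒟.isOpen_pts.ae_eq_zero_of_integral_contDiff_smul_eq_zero
      (hfc.locallyIntegrableOn 𝒟.isOpen_pts.measurableSet) fun φ hφ hφc hφp => ?_
    set w : E d → E d := fun y => φ y • e with hw
    have hwφ : tsupport w ⊆ tsupport φ := closure_mono fun y hy hφy => hy (by simp [hw, hφy])
    have hwc : HasCompactSupport w := hφc.smul_right
    have hws : ContDiff ℝ ∞ w := hφ.smul contDiff_const
    have hwp := hwφ.trans hφp
    have h1 := integral_pastIntegral_mul_eq_zero hU hcell h hws hwc hwp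
      (add_smul_mem_velocityFields hb hws hwc hwp (isPeriodic_of_periods_eq_bot hper w)) hA hA'
      (hVar w (h.isAdmissible hU hper hb hws hwc hwp))
    rw [integral_pastIntegral_mul_eq hU hcell h hb (continuousOn_estimatorDeriv hA' hws.continuous)
      hwc.isCompact hwp fun x hx => estimatorDeriv_eq_zero hx] at h1
    rw [← setIntegral_eq_integral_of_forall_compl_eq_zero (s := 𝒟.pts) fun y hy => by
      rw [image_eq_zero_of_notMem_tsupport fun hh => hy (hφp hh), zero_smul], ← h1]
    refine integral_congr_ae (Eventually.of_forall fun y => ?_)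
    simp only [estimatorDeriv, hw, hf, map_smul, smul_eq_mul]
    ring
  have h2 := Measure.eqOn_open_of_ae_eq (μ := volume) (f := f) (g := fun _ => 0)
    ((ae_restrict_iff' 𝒟.isOpen_pts.measurableSet).2 hae) 𝒟.isOpen_pts hfc continuousOn_const hx
  simpa [hf] using h2

end Stationarity

/-! ### Rigidity of the estimator -/

section Rigidity

variable {d : ℕ} {𝒟 : Domain d} {U : Fin 2 → E d → ℝ} {b w : E d → E d}

/-- The gradient of the estimator does not vanish along a trajectory unless it vanishes on the whole
trajectory. -/
lemma fderiv_estimator_flow_ne_zero (hb : b ∈ velocityFields 𝒟)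
    (hA : ∀ x ∈ 𝒟.pts, DifferentiableAt ℝ (estimator 𝒟 U b) x) {x : E d} (hx : x ∈ 𝒟.pts)
    (hne : fderiv ℝ (estimator 𝒟 U b) x ≠ 0) (t : ℝ) :
    fderiv ℝ (estimator 𝒟 U b) (flow 𝒟 b t x) ≠ 0 := by
  intro h0
  refine hne ?_
  have h1 : fderiv ℝ (estimator 𝒟 U b ∘ flow 𝒟 b t) x = fderiv ℝ (estimator 𝒟 U b) x := by
    refine Filter.EventuallyEq.fderiv_eq ?_
    filter_upwards [𝒟.isOpen_pts.mem_nhds hx] with y hy using estimator_flow hb hy t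
  rw [← h1, fderiv_comp x (hA _ (flow_mem hb hx t)) (differentiableAt_flow hb hx t), h0,
    ContinuousLinearMap.zero_comp]

/-- If the excess over the future vanishes along a trajectory, so does its derivative
`A ρ₀ - ρ₁`. -/
lemma densityRatio_eq_estimator_of_futureExcess (hU : ∀ k, ContinuousOn (U k) 𝒟.pts)
    (h : HasContinuousIntegrals 𝒟 U b) (hb : b ∈ velocityFields 𝒟) {x : E d} (hx : x ∈ 𝒟.pts)
    (hq : ∀ t, futureExcess 𝒟 U b (flow 𝒟 b t x) = 0) :
    densityRatio U x = estimator 𝒟 U b x := by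
  have hI : ∀ k t, ∫ s in (0 : ℝ)..t, F 𝒟 U b k s x =
      (∫ s in Ioi 0, F 𝒟 U b k s x) - ∫ s in Ioi t, F 𝒟 U b k s x := fun k t => by
    rw [← intervalIntegral.integral_interval_add_Ioi (h.integrable k x hx).integrableOn
      (h.integrable k x hx).integrableOn (b := t)]
    ring
  have hE : ∀ t, ∫ s in Ioi t, F 𝒟 U b 1 s x =
      estimator 𝒟 U b x * ∫ s in Ioi t, F 𝒟 U b 0 s x := fun t => by
    have h1 := hq t
    rw [futureExcess, estimator_flow hb hx, sub_eq_zero] at h1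
    rw [← setIntegral_Ioi_F_flow hb hx, ← setIntegral_Ioi_F_flow hb hx, h1]
    ring
  have h0 : (fun t => ∫ s in (0 : ℝ)..t, F 𝒟 U b 1 s x) =
      fun t => estimator 𝒟 U b x * ∫ s in (0 : ℝ)..t, F 𝒟 U b 0 s x := by
    ext t
    rw [hI, hI, hE, hE]
    ring
  have hd := fun k => ((continuous_F_time hU hb k hx).integral_hasStrictDerivAt 0 0).hasDerivAt
  have h2 := hd 1
  rw [h0] at h2
  have h3 := h2.unique ((hd 0).const_mul (estimator 𝒟 U b x))
  rw [F_zero hb hx, F_zero hb hx, ← densityRatio_mul_exp] at h3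
  exact mul_right_cancel₀ (Real.exp_pos _).ne' h3

/-- If the estimator of `b` agrees with the density ratio on an open invariant set that contains the
support of the perturbation `β` of `b`, and if `β` has no smaller variance than `b`, then both
fields have the same estimator: off the invariant set the trajectories are the same, and on it any
change of the estimator is a move away from the density ratio, which decreases the variance. -/
lemma estimator_eq_of_Var_le (hU : IsPotentialPair 𝒟 U) (hcell : 𝒟.cell = 𝒟.pts)
    {β : E d → E d} {K O : Set (E d)} (h : HasContinuousIntegrals 𝒟 U b)
    (hb : b ∈ velocityFields 𝒟) (h' : HasContinuousIntegrals 𝒟 U β) (hβ : β ∈ velocityFields 𝒟)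
    (hK : IsClosed K) (hβK : ∀ x ∉ K, β x = b x) (hKO : K ⊆ O)
    (hinv : ∀ x ∈ 𝒟.pts, ∀ t, flow 𝒟 b t x ∈ O → x ∈ O)
    (hO : ∀ x ∈ O, densityRatio U x = estimator 𝒟 U b x) (hVar : Var 𝒟 U b ≤ Var 𝒟 U β)
    {x : E d} (hx : x ∈ 𝒟.pts) : estimator 𝒟 U β x = estimator 𝒟 U b x := by
  have hUc := hU.continuousOn
  have hoff : ∀ y ∈ 𝒟.pts, y ∉ O → estimator 𝒟 U β y = estimator 𝒟 U b y := by
    intro y hy hyO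
    have hF : ∀ k t, F 𝒟 U β k t y = F 𝒟 U b k t y := fun k t =>
      F_eq_of_avoid hb hβ hK hβK hy (fun s _ hs => hyO (hinv y hy s (hKO hs))) k
    simp only [estimator, hF]
  set D : (E d → E d) → E d → ℝ := fun a y => (densityRatio U y - estimator 𝒟 U a y) ^ 2 with hD
  have hle : ∀ y ∈ 𝒟.pts, D b y ≤ D β y := by
    intro y hy
    by_cases hyO : y ∈ O
    · simp only [hD, hO y hyO, sub_self, ne_eq, OfNat.ofNat_ne_zero, not_false_eq_true, zero_pow]
      exact sq_nonneg _
    · simp only [hD, hoff y hy hyO, le_refl]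
  have hDi : ∀ a ∈ infiniteTimeFields 𝒟 U,
      IntegrableOn (fun y => D a y * Real.exp (-U 0 y)) 𝒟.pts :=
    fun a ha => (integrable_refMeasure_iff hUc _).1
      ((memLp_densityRatio hU hcell).sub (memLp_estimator hU hcell ha)).integrable_sq
  have hDc : ∀ a ∈ velocityFields 𝒟, HasContinuousIntegrals 𝒟 U a →
      ContinuousOn (fun y => D a y * Real.exp (-U 0 y)) 𝒟.pts := fun a ha ha' =>
    (((continuousOn_densityRatio hUc).sub (ha'.continuousOn_estimator ha)).pow 2).mul
      (Real.continuous_exp.comp_continuousOn (hUc 0).neg)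
  have hbI := h.mem_infiniteTimeFields hb
  have hβI := h'.mem_infiniteTimeFields hβ
  have hint : ∫ y in 𝒟.pts, (D β y * Real.exp (-U 0 y) - D b y * Real.exp (-U 0 y)) ≤ 0 := by
    have h1 := integral_sq_sub_estimator_eq hU hcell hbI
    have h2 := integral_sq_sub_estimator_eq hU hcell hβI
    rw [integral_refMeasure hUc] at h1 h2
    rw [integral_sub (hDi β hβI) (hDi b hbI), h1, h2]
    linarith
  have hnn : 0 ≤ᵐ[volume.restrict 𝒟.pts]
      fun y => D β y * Real.exp (-U 0 y) - D b y * Real.exp (-U 0 y) := by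
    filter_upwards [ae_restrict_mem 𝒟.isOpen_pts.measurableSet] with y hy
    exact sub_nonneg.2 (mul_le_mul_of_nonneg_right (hle y hy) (Real.exp_pos _).le)
  have hae := (integral_eq_zero_iff_of_nonneg_ae hnn ((hDi β hβI).sub (hDi b hbI))).1
    (le_antisymm hint (integral_nonneg_of_ae hnn))
  have heq := Measure.eqOn_open_of_ae_eq hae 𝒟.isOpen_pts ((hDc β hβ h').sub (hDc b hb h))
    continuousOn_const hx
  by_cases hxO : x ∈ O
  · simp only [Pi.zero_apply, ← sub_mul, mul_eq_zero, (Real.exp_pos _).ne', or_false, hD, hO x hxO,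
      sub_self, ne_eq, OfNat.ofNat_ne_zero, not_false_eq_true, zero_pow, sub_zero,
      pow_eq_zero_iff] at heq
    exact (sub_eq_zero.1 heq).symm
  · exact hoff x hx hxO

/-- The gradient of the estimator vanishes. On the open set where it does not, the Euler-Lagrange
equation identifies the estimator with the density ratio, so by `estimator_eq_of_Var_le` and by
minimality small perturbations supported there leave the estimator unchanged. It is therefore
constant along the perturbed trajectories as well, and its derivative vanishes in every direction.
-/
theorem fderiv_estimator_eq_zero (hU : IsPotentialPair 𝒟 U) (hcell : 𝒟.cell = 𝒟.pts)
    (hper : 𝒟.periods = ⊥) (h : HasContinuousIntegrals 𝒟 U b) (hb : b ∈ velocityFields 𝒟)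
    (hA : ∀ x ∈ 𝒟.pts, DifferentiableAt ℝ (estimator 𝒟 U b) x)
    (hA' : ContinuousOn (fderiv ℝ (estimator 𝒟 U b)) 𝒟.pts)
    (hmin : IsLocalMinimum 𝒟 U b)
    (hVar : ∀ w, IsAdmissible 𝒟 U b w → HasDerivAt (fun ε : ℝ => Var 𝒟 U (b + ε • w)) 0 0)
    {x : E d} (hx : x ∈ 𝒟.pts) : fderiv ℝ (estimator 𝒟 U b) x = 0 := by
  by_contra hne
  set O : Set (E d) := 𝒟.pts ∩ fderiv ℝ (estimator 𝒟 U b) ⁻¹' {0}ᶜ with hO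
  have hOo : IsOpen O := hA'.isOpen_inter_preimage 𝒟.isOpen_pts isOpen_compl_singleton
  have hflow : ∀ y ∈ O, ∀ t, flow 𝒟 b t y ∈ O := fun y hy t =>
    ⟨flow_mem hb hy.1 t, fderiv_estimator_flow_ne_zero hb hA hy.1 hy.2 t⟩
  have hhO : ∀ y ∈ O, densityRatio U y = estimator 𝒟 U b y := fun y hy =>
    densityRatio_eq_estimator_of_futureExcess hU.continuousOn h hb hy.1 fun t =>
      (smul_eq_zero.1 (futureExcess_smul_fderiv_estimator_eq_zero hU hcell hper h hb hA hA' hVar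
        (hflow y hy t).1)).resolve_right (hflow y hy t).2
  obtain ⟨e, he⟩ : ∃ e, fderiv ℝ (estimator 𝒟 U b) x e ≠ 0 := by
    by_contra! hc
    exact hne (ContinuousLinearMap.ext hc)
  obtain ⟨φ, hφO, hφc, hφ, -, hφx⟩ := exists_contDiff_tsupport_subset (n := ⊤)
    (hOo.mem_nhds (⟨hx, hne⟩ : x ∈ O))
  set w : E d → E d := fun y => φ y • e with hw
  have hwφ : tsupport w ⊆ tsupport φ := closure_mono fun y hy hφy => hy (by simp [hw, hφy])
  have hwc : HasCompactSupport w := hφc.smul_right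
  have hws : ContDiff ℝ ∞ w := hφ.smul contDiff_const
  have hwO : tsupport w ⊆ O := hwφ.trans hφO
  have hwp : tsupport w ⊆ 𝒟.pts := hwO.trans inter_subset_left
  have hbw := add_smul_mem_velocityFields hb hws hwc hwp (isPeriodic_of_periods_eq_bot hper w)
  obtain ⟨T, -, hT⟩ := h.exists_hasTransitTime hws hwc hwp hbw
  have hle := hmin w (h.isAdmissible hU hper hb hws hwc hwp)
  obtain ⟨ε, ⟨hεT, hεVar⟩, hε0⟩ := (((hT.and hle).filter_mono nhdsWithin_le_nhds).and
    (self_mem_nhdsWithin (s := {(0 : ℝ)}ᶜ))).exists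
  have hwb : ∀ y ∉ tsupport w, (b + ε • w) y = b y :=
    fun y hy => by simp [image_eq_zero_of_notMem_tsupport hy]
  have h' := h.perturbed hU.continuousOn hwc.isCompact hwp hb (hbw ε) hwb hεT
  have heq : ∀ y ∈ 𝒟.pts, estimator 𝒟 U (b + ε • w) y = estimator 𝒟 U b y := fun y hy =>
    estimator_eq_of_Var_le hU hcell h hb h' (hbw ε) (isClosed_tsupport w) hwb hwO
      (fun z hz t hzt => by simpa only [flow_neg_flow hb hz] using hflow _ hzt (-t)) hhO hεVar hy
  have hder := hasDerivAt_estimator_flow (hbw ε) hA hx 0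
  have hconst : (fun s => estimator 𝒟 U b (flow 𝒟 (b + ε • w) s x)) =
      fun _ => estimator 𝒟 U b x := by
    ext s
    rw [← heq _ (flow_mem (hbw ε) hx s), estimator_flow (hbw ε) hx, heq x hx]
  rw [hconst, flow_zero (hbw ε) hx, estimatorDeriv_add_smul hb hA hx] at hder
  have h0 := hder.unique (hasDerivAt_const _ _)
  refine he ?_
  have h1 := (mul_eq_zero.1 h0).resolve_left hε0
  simpa [estimatorDeriv, hw, hφx] using h1

/-- A constant estimator has zero variance, being unbiased. -/
lemma Var_eq_zero (hU : IsPotentialPair 𝒟 U) (hcell : 𝒟.cell = 𝒟.pts)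
    (hb : b ∈ infiniteTimeFields 𝒟 U) {c : ℝ} (hc : ∀ x ∈ 𝒟.pts, estimator 𝒟 U b x = c) :
    Var 𝒟 U b = 0 := by
  have := isProbabilityMeasure_refMeasure hU hcell
  have h1 : estimator 𝒟 U b =ᵐ[refMeasure 𝒟 U] fun _ => c := ae_refMeasure_of_forall hc
  have h2 : (fun x => estimator 𝒟 U b x ^ 2) =ᵐ[refMeasure 𝒟 U] fun _ => c ^ 2 :=
    ae_refMeasure_of_forall fun x hx => congrArg (· ^ 2) (hc x hx)
  rw [Var, secondMoment_eq hU hcell, ← integral_estimator hU hcell hb, integral_congr_ae h1,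
    integral_congr_ae h2]
  simp

end Rigidity

/-! ### Tori carry no field with integrable weights everywhere -/

section Torus

variable {d : ℕ} {𝒟 : Domain d} {U : Fin 2 → E d → ℝ} {b : E d → E d}

/-- The flow commutes with the periods of the field, by the uniqueness of trajectories. -/
lemma flow_add_period (hb : b ∈ velocityFields 𝒟) {x v : E d} (hv : v ∈ 𝒟.periods)
    (hp : ∀ y ∈ 𝒟.pts, y + v ∈ 𝒟.pts) (hx : x ∈ 𝒟.pts) (t : ℝ) :
    flow 𝒟 b t (x + v) = flow 𝒟 b t x + v := by
  have hxv := hp x hx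
  refine eqOn_of_hasDerivAt 𝒟.isOpen_pts (contDiffOn_one_pts hb) isOpen_univ isPreconnected_univ
    (mem_univ (0 : ℝ)) (γ := fun s => flow 𝒟 b s (x + v)) (η := fun s => flow 𝒟 b s x + v)
    (fun s _ => ⟨flow_mem hb hxv s, hasDerivAt_flow hb hxv s⟩)
    (fun s _ => ⟨hp _ (flow_mem hb hx s), ?_⟩)
    ?_ (mem_univ t)
  · rw [hb.2.1 v hv]
    exact (hasDerivAt_flow hb hx s).add_const v
  · simp only [flow_zero hb hx, flow_zero hb hxv]

/-- The compact closure of the fundamental domain meets every orbit of the period lattice. -/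
lemma exists_pos_bounds_of_periodic (B : Module.Basis (Fin d) ℝ (E d)) {f : E d → ℝ}
    (hf : Continuous f) (hpos : ∀ x, 0 < f x) (hper : (Domain.torus B).IsPeriodic f) :
    ∃ m > 0, ∃ M, ∀ x, m ≤ f x ∧ f x ≤ M := by
  have hc : IsCompact (closure (ZSpan.fundamentalDomain B)) :=
    (ZSpan.fundamentalDomain_isBounded B).isCompact_closure
  have hred : ∀ x, ∃ y ∈ closure (ZSpan.fundamentalDomain B), f x = f y := fun x => by
    refine ⟨ZSpan.fract B x, subset_closure (ZSpan.fract_mem_fundamentalDomain B x), ?_⟩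
    rw [← hper _ (ZSpan.floor B x).2 (ZSpan.fract B x), ZSpan.fract, sub_add_cancel]
  have hne : (closure (ZSpan.fundamentalDomain B)).Nonempty :=
    ⟨_, subset_closure (ZSpan.fract_mem_fundamentalDomain B 0)⟩
  obtain ⟨y, -, hy⟩ := hc.exists_isMinOn hne hf.continuousOn
  obtain ⟨z, -, hz⟩ := hc.exists_isMaxOn hne hf.continuousOn
  refine ⟨f y, hpos y, f z, fun x => ?_⟩
  obtain ⟨x', hx', hxx'⟩ := hred x
  rw [hxx']
  exact ⟨hy hx', hz hx'⟩

/-- On a torus, the total weight `G = ∫ F^{(0)}_t dt` is bounded above and below, so by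
`J_t = G / G ∘ X_t` the Jacobian and the weights are bounded below along each trajectory, and they
cannot be integrable. -/
theorem not_hasContinuousIntegrals_torus (B : Module.Basis (Fin d) ℝ (E d))
    (hU : IsPotentialPair (.torus B) U) (hb : b ∈ velocityFields (.torus B)) :
    ¬ HasContinuousIntegrals (.torus B) U b := by
  intro h
  have hmem : ∀ x, x ∈ (Domain.torus B).pts := fun x => mem_univ x
  have hFper : ∀ t, (Domain.torus B).IsPeriodic (F (.torus B) U b 0 t) := by
    intro t v hv x
    have h1 : ∀ y, flow (.torus B) b t (y + v) = flow (.torus B) b t y + v :=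
      fun y => flow_add_period hb hv (fun _ _ => hmem _) (hmem y) t
    have h2 : jac (.torus B) b t (x + v) = jac (.torus B) b t x := by
      rw [jac, jac, ← fderiv_comp_add_right]
      simp only [h1, fderiv_add_const]
    rw [F, F, h1, h2, hU.periodic 0 v hv]
  have hGc : Continuous fun x => ∫ t, F (.torus B) U b 0 t x :=
    continuousOn_univ.1 (h.continuousOn_integral 0)
  have hρc : Continuous fun x => Real.exp (-U 0 x) :=
    Real.continuous_exp.comp (continuousOn_univ.1 (hU.smooth 0).continuousOn).neg
  obtain ⟨m, hm, M, hmM⟩ := exists_pos_bounds_of_periodic B hGc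
    (fun x => integral_F_pos hb (hmem x) (h.integrable 0 x (hmem x)))
    (fun v hv x => by simp only [hFper _ v hv x])
  obtain ⟨c, hc, _, hcM⟩ := exists_pos_bounds_of_periodic B hρc (fun x => Real.exp_pos _)
    (fun v hv x => by simp only [hU.periodic 0 v hv x])
  have hM : 0 < M := hm.trans_le ((hmM 0).1.trans (hmM 0).2)
  have hle : ∀ t, c * (m / M) ≤ F (.torus B) U b 0 t 0 := by
    intro t
    refine mul_le_mul (hcM _).1 ?_ (by positivity) (Real.exp_pos _).le
    rw [div_le_iff₀ hM]
    have h1 := integral_F_flow (U := U) hb (hmem 0) 0 t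
    have h2 := mul_le_mul_of_nonneg_right (hmM (flow (.torus B) b t 0)).2 (jac_pos hb (hmem 0) t).le
    linarith [(hmM 0).1]
  have hi : Integrable fun _ : ℝ => c * (m / M) :=
    (h.integrable 0 0 (hmem 0)).mono' aestronglyMeasurable_const (Eventually.of_forall fun t => by
      rw [Real.norm_of_nonneg (by positivity)]
      exact hle t)
  rw [integrable_const_iff] at hi
  rcases hi with hi | hi
  · exact absurd hi (by positivity)
  · simp [isFiniteMeasure_iff] at hi

end Torus

end NEIS

end

theorem mainTheorem3 {d : ℕ} (𝒟 : NEIS.Domain d) (U : Fin 2 → NEIS.E d → ℝ)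
    (hU : NEIS.IsPotentialPair 𝒟 U)
    (b : NEIS.E d → NEIS.E d)
    (hb : b ∈ NEIS.infiniteTimeFields 𝒟 U)
    (hnontrivial : NEIS.Var 𝒟 U b < NEIS.VarMax 𝒟 U)
    (hmin : NEIS.IsLocalMinimum 𝒟 U b)
    (g : NEIS.E d → NEIS.E d)
    (hg : NEIS.IsFunctionalDerivative 𝒟 U b g)
    (hg_cont : ContinuousOn g 𝒟.pts)
    (hg_zero : ∀ x ∈ 𝒟.pts, g x = 0)
    (hA_diff : ∀ x ∈ 𝒟.pts, DifferentiableAt ℝ (NEIS.estimator 𝒟 U b) x)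
    (hA_cont : ContinuousOn (gradient (NEIS.estimator 𝒟 U b)) 𝒟.pts)
    (hmho : NEIS.mho 𝒟 U b = 𝒟.pts)
    (hunstable : volume (NEIS.unstablePoints 𝒟 U b) = 0)
    (hcritical : volume {x ∈ 𝒟.pts | gradient (fun y => U 1 y - U 0 y) x = 0} = 0) :
    NEIS.Var 𝒟 U b = 0 ∧
      ∀ b' ∈ NEIS.infiniteTimeFields 𝒟 U, NEIS.Var 𝒟 U b ≤ NEIS.Var 𝒟 U b' := by
  have h := NEIS.hasContinuousIntegrals_of_mho_eq hmho
  rcases 𝒟 with ⟨Ω, hΩ, hΩc, hΩs⟩ | B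
  · set 𝒟 := NEIS.Domain.euclidean Ω hΩ hΩc hΩs
    have hcell : 𝒟.cell = 𝒟.pts := rfl
    have hA' : ContinuousOn (fderiv ℝ (NEIS.estimator 𝒟 U b)) 𝒟.pts := by
      have h1 := (InnerProductSpace.toDual ℝ (NEIS.E d)).continuous.comp_continuousOn hA_cont
      refine h1.congr fun x _ => ?_
      simp [gradient]
    have hVar : ∀ w, NEIS.IsAdmissible 𝒟 U b w →
        HasDerivAt (fun ε : ℝ => NEIS.Var 𝒟 U (b + ε • w)) 0 0 := by
      intro w hw
      have h1 := hg w hw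
      rwa [setIntegral_eq_zero_of_forall_eq_zero fun x hx => by
        rw [hg_zero x hx, inner_zero_left]] at h1
    obtain ⟨c, hc⟩ := 𝒟.isOpen_pts.exists_is_const_of_fderiv_eq_zero hΩc.isPreconnected
      (fun x hx => (hA_diff x hx).differentiableWithinAt) fun x hx =>
        NEIS.fderiv_estimator_eq_zero hU hcell rfl h hb.1 hA_diff hA' hmin hVar hx
    have h0 := NEIS.Var_eq_zero hU hcell hb hc
    exact ⟨h0, fun b' hb' => h0 ▸ NEIS.Var_nonneg hU hcell hb'⟩
  · exact absurd h (NEIS.not_hasContinuousIntegrals_torus B hU hb.1)
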